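/- Let $n\ge 1$, $q\ge 1$, $m,l\ge 0$ be integers with $m+1=2^l\le 2^n$. Let $-1\le a<b\le 1$, $\Delta x=(b-a)/(2^n-1)$ and $\sum_{\kappa=0}^{2^n-1}(a+\kappa\Delta x)^2=1$. Let $\hat x=\mathrm{diag}(a+\kappa\Delta x)_{\kappa=0}^{2^n-1}$, and let $\hat p$ be the $2^n\times 2^n$ periodic central-difference matrix $\hat p_{ij}=-\frac{i}{2\Delta x}\left(\delta_{j,i+1}-\delta_{j,i-1}\right)$ (indices modulo $2^n$; the prefactor contains the imaginary unit). Let $P_q$ be a real polynomial of degree $q$ which contains only powers of the parity of $q$ and satisfies $|P_q(x)|<1$ for all $x\in[-1,1]$, and let $\mathcal N_{p^m}>0$ satisfy $\mathcal N_{p^m}\ge\max_{i,j}|(\hat p^m)_{ij}|^2$. A unitary $A_{P_qp^m}$ on $2n+3$ qubits is called a 1-term auxiliary for $P_q(\hat x)\hat p^m$ if for all $\sigma\in\mathbb C^{2^n}$ $$A_{P_qp^m}\sum_{j}\sigma_j|0\rangle^3|0\rangle^n|j\rangle^n=\frac{(-1)^m}{\sqrt{2^l\mathcal N_{p^m}}}\sum_{j}\sum_{i\in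 F_j^{(m)}}\big(P_q(\hat x)\hat p^m\big)_{ij}\,\sigma_j|0\rangle^3|i\rangle^n|j\rangle^n+|\bot\rangle,$$ where $F^{(m)}_j$ is the set of row indices of the non-zero elements of the $j$-th column of $\hat p^m$ and $|\bot\rangle$ is orthogonal to $|0\rangle^3|\kappa\rangle^{2n}$ for every $\kappa$. A 1-term auxiliary $A_{p^mP_q}$ for $\hat p^mP_q(\hat x)$ is defined in the same way with $\big(\hat p^mP_q(\hat x)\big)_{ij}$. Let $(\hat p^m)^{(s)}$ be the $s$-th ($s\ge 0$) non-zero element of the first row of $\hat p^m$, in column $r_s$ (with $(\hat p^m)^{(s)}=0$ if there are at most $s$ non-zero elements). Consider unitaries with - (coordinate-polynomial oracle) $\hat O_{P_q}|0\rangle^2|i\rangle^n=P_q(\hat x_{ii})|0\rangle^2|i\rangle^n+|\bot\rangle$, with $|\bot\rangle$ orthogonal to all $|0\rangle^2|k\rangle^n$; - (sparse-amplitude oracle) $\hat O^S_{p^m}|0\rangle|s\rangle^l=\frac{(\hat p^m)^{(s)}}{\sqrt{\mathcal N_{p^m}}}|0\rangle|s\rangle^l+\sqrt{1-\frac{|(\hat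 p^m)^{(s)}|^2}{\mathcal N_{p^m}}}\,|1\rangle|s\rangle^l$ for $0\le s<2^l$; - (banded-sparse access) $\hat O^{BS}_{p^m}|0\rangle^{n-l}|s\rangle^l|i\rangle^n=|r_s+i \bmod 2^n\rangle^n|i\rangle^n$, for every $0\le s<2^l$ for which $r_s$ exists. Then: 1. For every choice of such oracles, the following circuits on three flag qubits, an $n$-qubit row register and an $n$-qubit column register are 1-term auxiliaries. For $P_q(\hat x)\hat p^m$: apply $l$ Hadamard gates to the qubits of $|s\rangle^l$ in the row register, then $\hat O^S_{p^m}$ on the first flag and these $l$ qubits, then $\hat O^{BS}_{p^m}$ on the row and column registers, then $\hat O_{P_q}$ on the other two flags and the row register. For $\hat p^mP_q(\hat x)$: apply the $l$ Hadamard gates, then $\hat O_{P_q}$ on the other two flags and the column register, then $\hat O^S_{p^m}$, then $\hat O^{BS}_{p^m}$. 2. A 1-term auxiliary $A_{P_qp^m}$, and likewise a 1-term auxiliary $A_{p^mP_q}$, can be implemented with - at most $2304qn^2-1064qn+32\cdot2^ln+32n-108q-48\cdot2^l+2^l-48$ one-qubit operations, - at most $1864qn^2-860qn+25\cdot2^ln+32n-92q-17\cdot2^l-48$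 C-NOTs, - $2n-1$ pure ancillas, i.e. additional qubits which start in $|0\rangle^{2n-1}$ and are returned to $|0\rangle^{2n-1}$ for every input state of the other $2n+3$ qubits. -/

import Mathlib

open scoped Polynomial Matrix

noncomputable section

namespace BlockEnc

/-! ### Registers, states and operators -/

/-- Computational basis labels of a register whose qubits are indexed by `ι`. -/
abbrev Bits (ι : Type) : Type := ι → Bool

/-- (Not necessarily normalised) vectors of a register of qubits. -/
abbrev State (ι : Type) : Type := Bits ι → ℂ

/-- Operators on a register of qubits. -/
abbrev Op (ι : Type) : Type := Matrix (Bits ι) (Bits ι) ℂ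

/-- The basis vector `|x⟩`. -/
def ket {ι : Type} [Fintype ι] [DecidableEq ι] (x : Bits ι) : State ι := Pi.single x 1

/-- The all-zero bit string. -/
def zeroBits (ι : Type) : Bits ι := fun _ => false

/-- Binary digits of `k` on `n` qubits (qubit `t` carries the digit of weight `2 ^ t`);
`k < 2 ^ n` is always meant. -/
def bits (n k : ℕ) : Bits (Fin n) := fun t => k.testBit t

/-- The operator `U` applied to the qubits selected by `e`, identity on all other qubits. -/
def onWires {κ ι : Type} [Fintype κ] [Fintype ι] [DecidableEq κ] [DecidableEq ι]
    (e : κ ↪ ι) (U : Op κ) : Op ι :=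
  Matrix.of fun x y =>
    if ∀ i, (∀ k, e k ≠ i) → x i = y i then U (fun k => x (e k)) (fun k => y (e k)) else 0

/-! ### Circuits of one-qubit gates and C-NOTs -/

/-- Elementary gates: an arbitrary one-qubit unitary on qubit `t`, or a C-NOT. -/
inductive Gate (ι : Type) : Type
  | single (u : Matrix.unitaryGroup Bool ℂ) (t : ι) : Gate ι
  | cnot (c t : ι) (h : c ≠ t) : Gate ι

/-- The operator of a gate (`false` stands for `|0⟩`, `true` for `|1⟩`). -/
def Gate.op {ι : Type} [Fintype ι] [DecidableEq ι] : Gate ι → Op ι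
  | .single u t => Matrix.of fun x y =>
      if ∀ i, i ≠ t → x i = y i then (u : Matrix Bool Bool ℂ) (x t) (y t) else 0
  | .cnot c t _ => Matrix.of fun x y =>
      if x = Function.update y t (xor (y t) (y c)) then 1 else 0

def Gate.isSingle {ι : Type} : Gate ι → Bool
  | .single _ _ => true
  | .cnot _ _ _ => false

/-- A circuit is a list of gates, the head being applied first. -/
abbrev Circuit (ι : Type) : Type := List (Gate ι)

/-- The operator of a circuit. -/
def circuitOp {ι : Type} [Fintype ι] [DecidableEq ι] : Circuit ι → Op ι
  | [] => 1
  | g :: C => circuitOp C * g.op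

/-- Number of one-qubit gates of a circuit. -/
def singleCount {ι : Type} (C : Circuit ι) : ℕ := C.countP fun g => g.isSingle

/-- Number of C-NOTs of a circuit. -/
def cnotCount {ι : Type} (C : Circuit ι) : ℕ := C.countP fun g => !g.isSingle

/-- `ψ ⊗ |0…0⟩`, the second register being indexed by `α`. -/
def withZeros {ι α : Type} [Fintype α] [DecidableEq α] (ψ : State ι) : State (ι ⊕ α) :=
  fun x => if ∀ k, x (Sum.inr k) = false then ψ (fun i => x (Sum.inl i)) else 0

/-- The circuit `C` implements `U`, the register `α` being pure ancillas: it starts in `|0…0⟩`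
and is returned to `|0…0⟩` for every input of the other register. -/
def Implements {ι α : Type} [Fintype ι] [DecidableEq ι] [Fintype α] [DecidableEq α]
    (C : Circuit (ι ⊕ α)) (U : Op ι) : Prop :=
  ∀ ψ : State ι, circuitOp C *ᵥ withZeros (α := α) ψ = withZeros (α := α) (U *ᵥ ψ)

/-! ### Coordinate and momentum matrices -/

/-- Grid spacing of `2 ^ n` equidistant points from `a` to `b`. -/
def gridStep (n : ℕ) (a b : ℝ) : ℝ := (b - a) / (2 ^ n - 1)

def gridPoint (n : ℕ) (a b : ℝ) (i : Fin (2 ^ n)) : ℝ := a + (i : ℕ) * gridStep n a b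

/-- The coordinate matrix `x̂`. -/
def xHat (n : ℕ) (a b : ℝ) : Matrix (Fin (2 ^ n)) (Fin (2 ^ n)) ℂ :=
  Matrix.diagonal fun i => (gridPoint n a b i : ℂ)

/-- The momentum matrix `p̂` (periodic central differences; addition in `Fin (2 ^ n)` is
modulo `2 ^ n`). -/
def pHat (n : ℕ) (a b : ℝ) : Matrix (Fin (2 ^ n)) (Fin (2 ^ n)) ℂ :=
  Matrix.of fun i j =>
    -(Complex.I / (2 * (gridStep n a b : ℂ))) *
      ((if j = i + 1 then 1 else 0) - (if i = j + 1 then 1 else 0))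

/-- Real polynomials of degree `q` and parity `q mod 2` with `|P| < 1` on `[-1, 1]`. -/
structure IsCoordPoly (P : ℝ[X]) (q : ℕ) : Prop where
  degree_eq : P.degree = q
  parity : ∀ k, P.coeff k ≠ 0 → k % 2 = q % 2
  bound : ∀ x ∈ Set.Icc (-1 : ℝ) 1, |P.eval x| < 1

/-! ### Oracles -/

/-- Column `c` holds the `s`-th (counting from `0`) non-zero element of the first row of `A`. -/
def IsNthNonzero {n : ℕ} (A : Matrix (Fin (2 ^ n)) (Fin (2 ^ n)) ℂ) (s : ℕ)
    (c : Fin (2 ^ n)) : Prop :=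
  A 0 c ≠ 0 ∧ {d : Fin (2 ^ n) | d < c ∧ A 0 d ≠ 0}.ncard = s

open Classical in
/-- `A⁽ˢ⁾`: the `s`-th non-zero element of the first row of `A`
(and `0` if the first row has at most `s` non-zero elements). -/
def bandedEntry {n : ℕ} (A : Matrix (Fin (2 ^ n)) (Fin (2 ^ n)) ℂ) (s : ℕ) : ℂ :=
  ∑ c, if IsNthNonzero A s c then A 0 c else 0

/-- Coordinate-polynomial-oracle: `O |0⟩²|i⟩ⁿ = P(x̂ᵢᵢ)|0⟩²|i⟩ⁿ + ⊥`, where `⊥` is orthogonal to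
all `|0⟩²|k⟩ⁿ`. -/
def IsCoordPolyOracle (n : ℕ) (a b : ℝ) (P : ℝ[X]) (O : Op (Fin 2 ⊕ Fin n)) : Prop :=
  O ∈ Matrix.unitaryGroup (Bits (Fin 2 ⊕ Fin n)) ℂ ∧
  ∀ i : Fin (2 ^ n), ∃ bot : State (Fin 2 ⊕ Fin n),
    (∀ k : Bits (Fin n), bot (Sum.elim (zeroBits _) k) = 0) ∧
    O *ᵥ ket (Sum.elim (zeroBits _) (bits n i)) =
      ((P.eval (gridPoint n a b i) : ℝ) : ℂ) • ket (Sum.elim (zeroBits _) (bits n i)) + bot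

/-- Sparse-amplitude-oracle of a banded matrix `A` with normalisation constant `N`:
`O |0⟩|s⟩ˡ = A⁽ˢ⁾/√N |0⟩|s⟩ˡ + √(1 - |A⁽ˢ⁾|²/N) |1⟩|s⟩ˡ`. -/
def IsSparseAmplitudeOracle {n : ℕ} (l : ℕ) (A : Matrix (Fin (2 ^ n)) (Fin (2 ^ n)) ℂ) (N : ℝ)
    (O : Op (Fin 1 ⊕ Fin l)) : Prop :=
  O ∈ Matrix.unitaryGroup (Bits (Fin 1 ⊕ Fin l)) ℂ ∧
  ∀ s < 2 ^ l,
    O *ᵥ ket (Sum.elim (fun _ => false) (bits l s)) =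
      (bandedEntry A s / (Real.sqrt N : ℂ)) • ket (Sum.elim (fun _ => false) (bits l s)) +
      ((Real.sqrt (1 - ‖bandedEntry A s‖ ^ 2 / N) : ℝ) : ℂ) •
        ket (Sum.elim (fun _ => true) (bits l s))

/-- Banded-sparse-access: `O |0⟩ⁿ⁻ˡ|s⟩ˡ|i⟩ⁿ = |rₛ + i mod 2ⁿ⟩ⁿ|i⟩ⁿ`, where `rₛ` is the column of the
`s`-th non-zero element of the first row. -/
def IsBandedSparseAccess {n : ℕ} (l : ℕ) (A : Matrix (Fin (2 ^ n)) (Fin (2 ^ n)) ℂ)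
    (O : Op (Fin n ⊕ Fin n)) : Prop :=
  O ∈ Matrix.unitaryGroup (Bits (Fin n ⊕ Fin n)) ℂ ∧
  ∀ s < 2 ^ l, ∀ r : Fin (2 ^ n), IsNthNonzero A s r → ∀ i : Fin (2 ^ n),
    O *ᵥ ket (Sum.elim (bits n s) (bits n i)) =
      ket (Sum.elim (bits n (r + i : Fin (2 ^ n))) (bits n i))

/-! ### The auxiliary unitaries -/

/-- The `2 n + 3` qubits: three flags, the row register, the column register. -/
abbrev Wires (n : ℕ) : Type := Fin 3 ⊕ Fin n ⊕ Fin n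

/-- `|0⟩³|r⟩ⁿ|c⟩ⁿ`. -/
def flagKet (n : ℕ) (r c : ℕ) : State (Wires n) :=
  ket (Sum.elim (zeroBits _) (Sum.elim (bits n r) (bits n c)))

open Classical in
/-- `U` is unitary and, for every `σ`,
`U ∑ⱼ σⱼ |0⟩³|0⟩ⁿ|j⟩ⁿ = (-1)ᵐ/√(2ˡ N) ∑_{j, i ∈ Fⱼ} Bᵢⱼ σⱼ |0⟩³|i⟩ⁿ|j⟩ⁿ + ⊥`,
where `Fⱼ` is the set of (row indices of) non-zero elements of the `j`-th column of `p̂ᵐ`, and `⊥`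
is orthogonal to all `|0⟩³|κ⟩²ⁿ`. -/
def IsAuxiliary (n m l : ℕ) (a b N : ℝ) (B : Matrix (Fin (2 ^ n)) (Fin (2 ^ n)) ℂ)
    (U : Op (Wires n)) : Prop :=
  U ∈ Matrix.unitaryGroup (Bits (Wires n)) ℂ ∧
  ∀ σ : Fin (2 ^ n) → ℂ, ∃ bot : State (Wires n),
    (∀ κ : Bits (Fin n ⊕ Fin n), bot (Sum.elim (zeroBits _) κ) = 0) ∧
    U *ᵥ (∑ j, σ j • flagKet n 0 j) =
      ((-1) ^ m / (Real.sqrt (2 ^ l * N) : ℂ)) •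
        (∑ j, ∑ i with (pHat n a b ^ m) i j ≠ 0, (B i j * σ j) • flagKet n i j) + bot

/-- `A_{P p^m}`. -/
def IsAuxPp (n m l : ℕ) (a b N : ℝ) (P : ℝ[X]) (U : Op (Wires n)) : Prop :=
  IsAuxiliary n m l a b N (Polynomial.aeval (xHat n a b) P * pHat n a b ^ m) U

/-- `A_{p^m P}`. -/
def IsAuxpP (n m l : ℕ) (a b N : ℝ) (P : ℝ[X]) (U : Op (Wires n)) : Prop :=
  IsAuxiliary n m l a b N (pHat n a b ^ m * Polynomial.aeval (xHat n a b) P) U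

/-! ### Placement of the oracles -/

/-- The sparse-amplitude-oracle acts on flag `0` and the `l` low qubits of the row register. -/
def wiresS {n l : ℕ} (h : l ≤ n) : Fin 1 ⊕ Fin l ↪ Wires n where
  toFun := Sum.elim (fun _ => Sum.inl 0) (fun t => Sum.inr (Sum.inl (Fin.castLE h t)))
  inj' := by
    rintro (x | x) (y | y) hxy
    · exact congrArg _ (Subsingleton.elim x y)
    · simp at hxy
    · simp at hxy
    · simpa using hxy

/-- Flags `1`, `2` and the row register. -/
def wiresRow (n : ℕ) : Fin 2 ⊕ Fin n ↪ Wires n where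
  toFun := Sum.elim (fun f => Sum.inl f.succ) (fun t => Sum.inr (Sum.inl t))
  inj' := by
    rintro (x | x) (y | y) hxy <;> simp_all

/-- Flags `1`, `2` and the column register. -/
def wiresCol (n : ℕ) : Fin 2 ⊕ Fin n ↪ Wires n where
  toFun := Sum.elim (fun f => Sum.inl f.succ) (fun t => Sum.inr (Sum.inr t))
  inj' := by
    rintro (x | x) (y | y) hxy <;> simp_all

/-- Row register and column register. -/
def wiresBS (n : ℕ) : Fin n ⊕ Fin n ↪ Wires n := Function.Embedding.inr

/-- The Hadamard matrix. -/
def hadamard : Matrix Bool Bool ℂ :=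
  Matrix.of fun x y => ((Real.sqrt 2)⁻¹ : ℝ) * (if x && y then -1 else 1)

theorem hadamard_mem : hadamard ∈ Matrix.unitaryGroup Bool ℂ := by
  have h : ((Real.sqrt 2 : ℝ) : ℂ) * (Real.sqrt 2 : ℝ) = 2 := by
    rw [← Complex.ofReal_mul, Real.mul_self_sqrt (by norm_num)]; norm_num
  have h' : (((Real.sqrt 2 : ℝ) : ℂ))⁻¹ * (((Real.sqrt 2 : ℝ) : ℂ))⁻¹ = 1 / 2 := by
    rw [← mul_inv, h]; norm_num
  rw [Matrix.mem_unitaryGroup_iff]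
  ext x y
  cases x <;> cases y <;>
    (simp [hadamard, Matrix.mul_apply, Matrix.star_apply, h']; try norm_num)

/-- `l` Hadamard gates, on the `l` low qubits of the row register. -/
def hadamardLayer {n l : ℕ} (h : l ≤ n) : Circuit (Wires n) :=
  List.ofFn fun t : Fin l =>
    Gate.single ⟨hadamard, hadamard_mem⟩ (Sum.inr (Sum.inl (Fin.castLE h t)))

/-- Hadamards, amplitude oracle, banded-sparse-access, then polynomial oracle on the rows. -/
def composePp {n l : ℕ} (h : l ≤ n) (OP : Op (Fin 2 ⊕ Fin n)) (OS : Op (Fin 1 ⊕ Fin l))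
    (OBS : Op (Fin n ⊕ Fin n)) : Op (Wires n) :=
  onWires (wiresRow n) OP * onWires (wiresBS n) OBS * onWires (wiresS h) OS *
    circuitOp (hadamardLayer h)

/-- Hadamards, polynomial oracle on the columns, amplitude oracle, then banded-sparse-access. -/
def composepP {n l : ℕ} (h : l ≤ n) (OP : Op (Fin 2 ⊕ Fin n)) (OS : Op (Fin 1 ⊕ Fin l))
    (OBS : Op (Fin n ⊕ Fin n)) : Op (Wires n) :=
  onWires (wiresBS n) OBS * onWires (wiresS h) OS * onWires (wiresCol n) OP *
    circuitOp (hadamardLayer h)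

/-- The operator `U` on `2 n + 3` qubits has a circuit with `2 n - 1` pure ancillas and at most
the stated numbers of one-qubit gates and C-NOTs. -/
def HasResources (n q l : ℕ) (U : Op (Wires n)) : Prop :=
  ∃ C : Circuit (Wires n ⊕ Fin (2 * n - 1)), Implements C U ∧
    (singleCount C : ℤ) ≤ 2304 * q * n ^ 2 - 1064 * q * n + 32 * 2 ^ l * n + 32 * n - 108 * q
      - 48 * 2 ^ l + 2 ^ l - 48 ∧
    (cnotCount C : ℤ) ≤ 1864 * q * n ^ 2 - 860 * q * n + 25 * 2 ^ l * n + 32 * n - 92 * q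
      - 17 * 2 ^ l - 48

end BlockEnc

end

open scoped Polynomial Matrix

noncomputable section

namespace BlockEnc

/-! ### Calculus of circuits: action on kets, inverses, gate counts, supports. -/

section Basics

variable {ι : Type} [Fintype ι] [DecidableEq ι]

/-! ### Kets and gates -/

/-! Powers of `pHat` are translation invariant and symmetric or antisymmetric, so every entry is
read off the first row: $(\hat p^m)_{ij}=(-1)^m(\hat p^m)_{0,i-j}$ (`pHat_pow_apply`). An entry of
$\hat p^m$ arises from $m$ moves by $\pm1$, so the first row has at most $m+1=2^l$ non-zero entries
(`ncard_pHat_pow_support`).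

For the composed oracles this is nearly all. The Hadamards and the two sparse oracles put the entry
at column $r$ of the first row on row $r+j$ (`banded_mulVec`), the polynomial oracle multiplies by a
value of $P$, and every failing branch carries a flag that no later operator touches.
`isAuxiliary_of_entries` reduces the definition to amplitudes on flag-zero strings.

For the gate counts another circuit is built directly from elementary gates. Its engine is the
synthesis of diagonal unitaries (`exists_diagonal`). Conjugated by Hadamards, these give
multiplication by any contraction with flagged failure (`exists_amplitude`) and generalised
controlled NOTs (`exists_xor`), and from them state preparation (`exists_prepare`) and an adder
(`exists_adder`).

The polynomial is applied by quantum signal processing. A coordinate is a convex combination of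
$n+2$ signs, so a reflection with about $\log_2 n$ selection qubits block-encodes it
(`exists_reflection`). Fejér–Riesz supplies the complementary polynomial (`exists_fejer_riesz`), and
lowering the degree step by step supplies the coin gates (`exists_signal_layer`). The $q$ layers
cost $O(qn^2)$ gates.

When the polynomial fails, the selection register may be left non-zero, so it cannot consist of pure
ancillas; it is taken from the row register. The relevant offsets satisfy $r\equiv m$ modulo 2 and
$|r|\le m=2^l-1$, and the involution `signFold` compresses them onto the digits $1,\dots,l$, which
leaves all other row digits zero (`folded_signFold`). If too few digits remain, then $2^n\le
2^l(n+1)$ and a direct multiplexed rotation fits the budget (`exists_col_oracle`). The ancillas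
serve only as carries of the adders. -/

theorem mulVec_ket (M : Op ι) (y : Bits ι) : M *ᵥ ket y = fun x => M x y := by
  ext x; simp [ket]

theorem ket_apply (y x : Bits ι) : (ket y : State ι) x = if x = y then 1 else 0 := by
  simp [ket, Pi.single_apply]

theorem op_ext_ket {M N : Op ι} (h : ∀ y, M *ᵥ ket y = N *ᵥ ket y) : M = N := by
  ext x y
  have := congrFun (h y) x
  simpa [mulVec_ket] using this

theorem diagonal_mulVec_ket (d : Bits ι → ℂ) (y : Bits ι) :
    Matrix.diagonal d *ᵥ ket y = d y • ket y := by
  ext x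
  by_cases h : x = y
  · subst h; simp [mulVec_ket, ket_apply]
  · simp [mulVec_ket, ket_apply, h]

omit [Fintype ι] in
theorem agree_off_iff {x y : Bits ι} {t : ι} :
    (∀ i, i ≠ t → x i = y i) ↔ x = Function.update y t (x t) := by
  constructor
  · intro h
    ext i
    by_cases hi : i = t
    · subst hi; simp
    · simp [hi, h i hi]
  · intro h i hi
    rw [h]; simp [hi]

theorem single_op_mulVec_ket (u : Matrix.unitaryGroup Bool ℂ) (t : ι) (y : Bits ι) :
    (Gate.single u t).op *ᵥ ket y = ∑ b, u.1 b (y t) • ket (Function.update y t b) := by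
  rw [mulVec_ket]
  ext x
  simp only [Gate.op, Matrix.of_apply, Fintype.sum_bool, Pi.add_apply, Pi.smul_apply, ket_apply,
    smul_eq_mul, mul_ite, mul_one, mul_zero]
  by_cases h : ∀ i, i ≠ t → x i = y i
  · rw [if_pos h]
    have h' := agree_off_iff.1 h
    have h1 : ∀ b, (x = Function.update y t b) ↔ x t = b := fun b =>
      ⟨fun e => by rw [e]; simp, fun e => by rw [← e]; exact h'⟩
    simp only [h1]
    cases x t <;> simp
  · rw [if_neg h]
    have h1 : ∀ b, x ≠ Function.update y t b := by
      intro b e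
      apply h; intro i hi; rw [e]; simp [hi]
    simp [h1]

theorem cnot_op_mulVec_ket (c t : ι) (h : c ≠ t) (y : Bits ι) :
    (Gate.cnot c t h).op *ᵥ ket y = ket (Function.update y t (xor (y t) (y c))) := by
  rw [mulVec_ket]
  ext x
  simp [Gate.op, ket_apply]

/-- The qubits on which a gate acts. -/
def Gate.wires : Gate ι → Set ι
  | .single _ t => {t}
  | .cnot c t _ => {c, t}

/-- The inverse gate. -/
def Gate.inv : Gate ι → Gate ι
  | .single u t => .single u⁻¹ t
  | .cnot c t h => .cnot c t h

omit [Fintype ι] [DecidableEq ι] in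
theorem Gate.inv_wires (g : Gate ι) : g.inv.wires = g.wires := by cases g <;> rfl

omit [Fintype ι] [DecidableEq ι] in
theorem Gate.inv_isSingle (g : Gate ι) : g.inv.isSingle = g.isSingle := by cases g <;> rfl

theorem Gate.op_inv (g : Gate ι) : g.inv.op = star g.op := by
  cases g with
  | single u t =>
    ext x y
    simp only [Gate.inv, Gate.op, Matrix.of_apply, Matrix.star_apply, apply_ite star, star_zero]
    have : (∀ i, i ≠ t → x i = y i) ↔ (∀ i, i ≠ t → y i = x i) := by
      simp only [eq_comm]
    simp only [this]
    rfl
  | cnot c t h =>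
    ext x y
    simp only [Gate.inv, Gate.op, Matrix.of_apply, Matrix.star_apply, apply_ite star, star_zero,
      star_one]
    congr 1
    have key : ∀ x y : Bits ι, x = Function.update y t (xor (y t) (y c)) →
        y = Function.update x t (xor (x t) (x c)) := by
      intro x y e
      subst e
      ext i
      by_cases hi : i = t
      · subst hi; simp [h]
      · simp [hi]
    exact propext ⟨key x y, key y x⟩

theorem Gate.inv_op_mul_op (g : Gate ι) : g.inv.op * g.op = 1 := by
  apply op_ext_ket
  intro y
  rw [← Matrix.mulVec_mulVec, Matrix.one_mulVec]
  cases g with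
  | single u t =>
    have hu : (u⁻¹).1 * u.1 = 1 := by simp
    have h1 : ∀ a b, ∑ c, (u⁻¹).1 a c * u.1 c b = if a = b then 1 else 0 := by
      intro a b
      rw [← Matrix.mul_apply, hu, Matrix.one_apply]
    rw [single_op_mulVec_ket, Matrix.mulVec_sum]
    simp only [Matrix.mulVec_smul, Gate.inv]
    simp only [single_op_mulVec_ket, Finset.smul_sum, smul_smul, Function.update_self,
      Function.update_idem]
    rw [Finset.sum_comm]
    simp only [← Finset.sum_smul]
    have h2 : ∀ b, ∑ c, u.1 c (y t) * (u⁻¹).1 b c = if b = y t then 1 else 0 := by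
      intro b; rw [← h1]; exact Finset.sum_congr rfl fun c _ => mul_comm _ _
    simp only [h2, ite_smul, one_smul, zero_smul, Finset.sum_ite_eq', Finset.mem_univ, if_true,
      Function.update_eq_self]
  | cnot c t h =>
    rw [cnot_op_mulVec_ket]
    simp only [Gate.inv]
    rw [cnot_op_mulVec_ket]
    congr 1
    ext i
    by_cases hi : i = t
    · subst hi; simp [h]
    · simp [hi]

/-! ### Circuits -/

theorem circuitOp_append (C D : Circuit ι) :
    circuitOp (C ++ D) = circuitOp D * circuitOp C := by
  induction C with
  | nil => simp [circuitOp]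
  | cons g C ih => simp [circuitOp, ih, mul_assoc]

theorem circuitOp_singleton (g : Gate ι) : circuitOp [g] = g.op := by simp [circuitOp]

theorem circuitOp_append_mulVec (C D : Circuit ι) (ψ : State ι) :
    circuitOp (C ++ D) *ᵥ ψ = circuitOp D *ᵥ (circuitOp C *ᵥ ψ) := by
  rw [circuitOp_append, Matrix.mulVec_mulVec]

/-- The inverse circuit. -/
def circuitInv (C : Circuit ι) : Circuit ι := (C.map Gate.inv).reverse

theorem circuitOp_inv (C : Circuit ι) : circuitOp (circuitInv C) = star (circuitOp C) := by
  induction C with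
  | nil => simp [circuitInv, circuitOp]
  | cons g C ih =>
    have : circuitInv (g :: C) = circuitInv C ++ [g.inv] := by simp [circuitInv]
    rw [this, circuitOp_append, circuitOp_singleton, ih, circuitOp, star_mul, Gate.op_inv]

theorem star_circuitOp_mul (C : Circuit ι) : star (circuitOp C) * circuitOp C = 1 := by
  induction C with
  | nil => simp [circuitOp]
  | cons g C ih =>
    rw [circuitOp, star_mul, mul_assoc, ← mul_assoc _ (circuitOp C), ih, one_mul, ← Gate.op_inv,
      Gate.inv_op_mul_op]

theorem circuitOp_mem_unitary (C : Circuit ι) :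
    circuitOp C ∈ Matrix.unitaryGroup (Bits ι) ℂ :=
  Matrix.mem_unitaryGroup_iff'.2 (star_circuitOp_mul C)

theorem circuitOp_mul_star (C : Circuit ι) : circuitOp C * star (circuitOp C) = 1 :=
  Matrix.mem_unitaryGroup_iff.1 (circuitOp_mem_unitary C)

/-- At most `a` one-qubit gates and at most `b` C-NOTs. -/
def Costs (C : Circuit ι) (a b : ℕ) : Prop := singleCount C ≤ a ∧ cnotCount C ≤ b

omit [Fintype ι] [DecidableEq ι] in
theorem Costs.append {C D : Circuit ι} {a b a' b' : ℕ} (h : Costs C a b) (h' : Costs D a' b') :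
    Costs (C ++ D) (a + a') (b + b') := by
  unfold Costs singleCount cnotCount at *
  rw [List.countP_append, List.countP_append]
  omega

omit [Fintype ι] [DecidableEq ι] in
theorem Costs.mono {C : Circuit ι} {a b a' b' : ℕ} (h : Costs C a b) (ha : a ≤ a')
    (hb : b ≤ b') : Costs C a' b' :=
  ⟨h.1.trans ha, h.2.trans hb⟩

omit [Fintype ι] [DecidableEq ι] in
theorem costs_nil : Costs ([] : Circuit ι) 0 0 := by simp [Costs, singleCount, cnotCount]

omit [Fintype ι] [DecidableEq ι] in
theorem costs_single (u : Matrix.unitaryGroup Bool ℂ) (t : ι) : Costs [Gate.single u t] 1 0 := by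
  simp [Costs, singleCount, cnotCount, Gate.isSingle]

omit [Fintype ι] [DecidableEq ι] in
theorem costs_cnot (c t : ι) (h : c ≠ t) : Costs [Gate.cnot c t h] 0 1 := by
  simp [Costs, singleCount, cnotCount, Gate.isSingle]

omit [Fintype ι] [DecidableEq ι] in
theorem Costs.inv {C : Circuit ι} {a b : ℕ} (h : Costs C a b) : Costs (circuitInv C) a b := by
  unfold Costs singleCount cnotCount circuitInv at *
  rw [List.countP_reverse, List.countP_reverse, List.countP_map, List.countP_map]
  simpa [Function.comp_def, Gate.inv_isSingle] using h

/-- All gates of `C` act on qubits in `S`. -/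
def ActsOn (C : Circuit ι) (S : Set ι) : Prop := ∀ g ∈ C, g.wires ⊆ S

omit [Fintype ι] [DecidableEq ι] in
theorem ActsOn.append {C D : Circuit ι} {S : Set ι} (h : ActsOn C S) (h' : ActsOn D S) :
    ActsOn (C ++ D) S := by
  intro g hg
  rcases List.mem_append.1 hg with hg | hg
  exacts [h g hg, h' g hg]

omit [Fintype ι] [DecidableEq ι] in
theorem ActsOn.mono {C : Circuit ι} {S S' : Set ι} (h : ActsOn C S) (hS : S ⊆ S') :
    ActsOn C S' := fun g hg => (h g hg).trans hS

omit [Fintype ι] [DecidableEq ι] in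
theorem actsOn_nil (S : Set ι) : ActsOn ([] : Circuit ι) S := by simp [ActsOn]

omit [Fintype ι] [DecidableEq ι] in
theorem actsOn_single (u : Matrix.unitaryGroup Bool ℂ) {t : ι} {S : Set ι} (ht : t ∈ S) :
    ActsOn [Gate.single u t] S := by
  simp [ActsOn, Gate.wires, ht]

omit [Fintype ι] [DecidableEq ι] in
theorem actsOn_cnot {c t : ι} (h : c ≠ t) {S : Set ι} (hc : c ∈ S) (ht : t ∈ S) :
    ActsOn [Gate.cnot c t h] S := by
  simp [ActsOn, Gate.wires, ht, hc, Set.insert_subset_iff]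

omit [Fintype ι] [DecidableEq ι] in
theorem ActsOn.inv {C : Circuit ι} {S : Set ι} (h : ActsOn C S) : ActsOn (circuitInv C) S := by
  intro g hg
  simp only [circuitInv, List.mem_reverse, List.mem_map] at hg
  obtain ⟨g', hg', rfl⟩ := hg
  rw [Gate.inv_wires]
  exact h g' hg'

/-- Qubits on which no gate acts keep their value. -/
theorem ActsOn.apply_eq_zero {C : Circuit ι} {S : Set ι} (h : ActsOn C S) {w : ι} (hw : w ∉ S)
    {x y : Bits ι} (hxy : x w ≠ y w) : circuitOp C x y = 0 := by
  induction C generalizing x y with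
  | nil =>
    have : x ≠ y := fun e => hxy (by rw [e])
    simp [circuitOp, this]
  | cons g C ih =>
    have hC : ActsOn C S := fun g' hg' => h g' (List.mem_cons_of_mem _ hg')
    have hg : g.wires ⊆ S := h g List.mem_cons_self
    rw [circuitOp, Matrix.mul_apply]
    refine Finset.sum_eq_zero fun z _ => ?_
    by_cases hz : x w = z w
    · have hzy : z w ≠ y w := hz ▸ hxy
      have : g.op z y = 0 := by
        cases g with
        | single u t =>
          have hwt : w ≠ t := fun e => hw (hg (by simp [Gate.wires, e]))
          simp only [Gate.op, Matrix.of_apply]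
          rw [if_neg]
          intro H; exact hzy (H w hwt)
        | cnot c t hct =>
          have hwt : w ≠ t := fun e => hw (hg (by simp [Gate.wires, e]))
          simp only [Gate.op, Matrix.of_apply]
          rw [if_neg]
          intro H; apply hzy; rw [H]; simp [hwt]
      rw [this, mul_zero]
    · rw [ih hC hz, zero_mul]

/-- `d` depends only on the qubits in `S`. -/
def DependsOn {α : Type*} (d : Bits ι → α) (S : Set ι) : Prop :=
  ∀ x y, (∀ w ∈ S, x w = y w) → d x = d y

omit [Fintype ι] in
theorem DependsOn.update {α : Type*} {d : Bits ι → α} {S : Set ι} (h : DependsOn d S) {w : ι}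
    (hw : w ∉ S) (x : Bits ι) (b : Bool) : d (Function.update x w b) = d x :=
  h _ _ fun v hv => by
    rw [Function.update_of_ne]
    rintro rfl; exact hw hv

/-- An entry of the circuit operator between strings that differ on `S'` vanishes, and on the
remaining entries the two diagonal values coincide. -/
theorem ActsOn.commute_diagonal {C : Circuit ι} {S S' : Set ι} (h : ActsOn C S) {d : Bits ι → ℂ}
    (hd : DependsOn d S') (hS : Disjoint S S') :
    Commute (circuitOp C) (Matrix.diagonal d) := by
  ext x y
  rw [Matrix.mul_diagonal, Matrix.diagonal_mul]
  by_cases hxy : ∀ w ∈ S', x w = y w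
  · rw [hd x y hxy, mul_comm]
  · push Not at hxy
    obtain ⟨w, hw, hne⟩ := hxy
    rw [h.apply_eq_zero (fun hwS => Set.disjoint_left.1 hS hwS hw) hne]
    simp

theorem Gate.commute_single (g : Gate ι) (u : Matrix.unitaryGroup Bool ℂ) (w : ι)
    (hw : w ∉ g.wires) : Commute g.op (Gate.single u w).op := by
  apply op_ext_ket
  intro y
  rw [← Matrix.mulVec_mulVec, ← Matrix.mulVec_mulVec]
  cases g with
  | single v t =>
    have hwt : w ≠ t := fun e => hw (by simp [Gate.wires, e])
    simp only [single_op_mulVec_ket, Matrix.mulVec_sum, Matrix.mulVec_smul, Finset.smul_sum,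
      smul_smul, Function.update_of_ne hwt, Function.update_of_ne hwt.symm]
    rw [Finset.sum_comm]
    refine Finset.sum_congr rfl fun a _ => Finset.sum_congr rfl fun b _ => ?_
    rw [Function.update_comm hwt, mul_comm]
  | cnot c t hct =>
    have hwt : w ≠ t := fun e => hw (by simp [Gate.wires, e])
    have hwc : w ≠ c := fun e => hw (by simp [Gate.wires, e])
    simp only [single_op_mulVec_ket, Matrix.mulVec_sum, Matrix.mulVec_smul, cnot_op_mulVec_ket,
      Function.update_of_ne hwt, Function.update_of_ne hwt.symm, Function.update_of_ne hwc.symm]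
    refine Finset.sum_congr rfl fun a _ => ?_
    rw [Function.update_comm hwt]

theorem ActsOn.commute_single {C : Circuit ι} {S : Set ι} (h : ActsOn C S)
    (u : Matrix.unitaryGroup Bool ℂ) {w : ι} (hw : w ∉ S) :
    Commute (circuitOp C) (Gate.single u w).op := by
  induction C with
  | nil => exact Commute.one_left _
  | cons g C ih =>
    have hC : ActsOn C S := fun g' hg' => h g' (List.mem_cons_of_mem _ hg')
    exact (ih hC).mul_left (g.commute_single u w fun hg => hw (h g List.mem_cons_self hg))

end Basics

/-! ### Building blocks with gate counts, from diagonal unitaries to the adder. -/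

section Gadgets

variable {ι : Type} [Fintype ι] [DecidableEq ι]

/-! ### Diagonal operators -/

/-- The diagonal one-qubit gate with phases `α`, `β`. -/
def phaseGate (α β : ℝ) : Matrix.unitaryGroup Bool ℂ :=
  ⟨Matrix.diagonal fun b => Complex.exp (Complex.I * ((if b then β else α : ℝ) : ℂ)), by
    rw [Matrix.mem_unitaryGroup_iff, Matrix.star_eq_conjTranspose, Matrix.diagonal_conjTranspose,
      Matrix.diagonal_mul_diagonal, ← Matrix.diagonal_one]
    congr 1
    ext b
    rw [Pi.star_apply, Complex.star_def, ← Complex.exp_conj, ← Complex.exp_add]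
    simp⟩

theorem phaseGate_op (α β : ℝ) (t : ι) :
    (Gate.single (phaseGate α β) t).op =
      Matrix.diagonal fun x => Complex.exp (Complex.I * ((if x t then β else α : ℝ) : ℂ)) := by
  apply op_ext_ket
  intro y
  rw [single_op_mulVec_ket, diagonal_mulVec_ket]
  have : ∀ b, Function.update y t b = y ↔ b = y t := by
    intro b; rw [Function.update_eq_self_iff]
  simp only [phaseGate, Matrix.diagonal_apply, Fintype.sum_bool]
  cases h : y t <;> simp [← h]

theorem cnot_conj_diagonal {C : Circuit ι} {d : Bits ι → ℂ}
    (hC : circuitOp C = Matrix.diagonal d) (c t : ι) (h : c ≠ t) :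
    circuitOp ([Gate.cnot c t h] ++ C ++ [Gate.cnot c t h]) =
      Matrix.diagonal fun x => d (Function.update x t (xor (x t) (x c))) := by
  apply op_ext_ket
  intro y
  rw [circuitOp_append_mulVec, circuitOp_append_mulVec, circuitOp_singleton, cnot_op_mulVec_ket,
    hC, diagonal_mulVec_ket, Matrix.mulVec_smul, cnot_op_mulVec_ket, diagonal_mulVec_ket]
  congr 2
  ext i
  by_cases hi : i = t
  · subst hi; simp [h]
  · simp [hi]

omit [Fintype ι] in
theorem DependsOn.update_cons {α : Type*} {d : Bits ι → α} {c : ι} {cs : List ι}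
    (hd : DependsOn d {w | w ∈ c :: cs}) (b : Bool) :
    DependsOn (fun x => d (Function.update x c b)) {w | w ∈ cs} := by
  intro x y hxy
  refine hd _ _ fun w hw => ?_
  by_cases h : w = c
  · subst h; simp
  · have : w ∈ cs := by simpa [h] using hw
    simp [h, hxy w this]

omit [Fintype ι] [DecidableEq ι] in
theorem DependsOn.map₂ {α β γ : Type*} {d : Bits ι → α} {e : Bits ι → β} {S : Set ι}
    (hd : DependsOn d S) (he : DependsOn e S) (f : α → β → γ) :
    DependsOn (fun x => f (d x) (e x)) S := fun x y hxy => by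
  simp only [hd x y hxy, he x y hxy]

/-- Multiplexed `z`-rotation. -/
theorem exists_mux (cs : List ι) (b : ι) (hb : b ∉ cs) (d : Bits ι → ℝ)
    (hd : DependsOn d {w | w ∈ cs}) :
    ∃ C : Circuit ι,
      circuitOp C = Matrix.diagonal (fun x => Complex.exp
        (Complex.I * (((if x b then -1 else 1) * d x : ℝ) : ℂ))) ∧
      ActsOn C {w | w ∈ b :: cs} ∧ Costs C (2 ^ cs.length) (2 * 2 ^ cs.length - 2) := by
  induction cs generalizing d with
  | nil =>
    refine ⟨[Gate.single (phaseGate (d (zeroBits _)) (-d (zeroBits _))) b], ?_,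
      actsOn_single _ (by simp), costs_single _ _⟩
    rw [circuitOp_singleton, phaseGate_op]
    congr 1
    ext x
    have : d x = d (zeroBits _) := hd _ _ (by simp)
    rw [this]
    cases x b <;> simp
  | cons c cs ih =>
    have hbc : b ≠ c := fun e => hb (by simp [e])
    have hb' : b ∉ cs := fun e => hb (by simp [e])
    have hu := fun v => hd.update_cons v
    obtain ⟨C₀, h₀, s₀, k₀⟩ := ih hb'
      (fun x => (d (Function.update x c false) + d (Function.update x c true)) / 2)
      ((hu false).map₂ (hu true) fun p q => (p + q) / 2)
    obtain ⟨C₁, h₁, s₁, k₁⟩ := ih hb'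
      (fun x => (d (Function.update x c false) - d (Function.update x c true)) / 2)
      ((hu false).map₂ (hu true) fun p q => (p - q) / 2)
    have hsub : {w | w ∈ b :: cs} ⊆ {w | w ∈ b :: c :: cs} := by
      intro w hw
      simp only [List.mem_cons, Set.mem_ofPred_eq] at hw ⊢
      tauto
    -- The C-NOTs from `c` reverse the second rotation exactly when `c` is 1, so half-sum plus or
    -- minus half-difference is the wanted angle for either value of `c`.
    refine ⟨C₀ ++ ([Gate.cnot c b hbc.symm] ++ C₁ ++ [Gate.cnot c b hbc.symm]), ?_, ?_, ?_⟩
    · rw [circuitOp_append, cnot_conj_diagonal h₁, h₀, Matrix.diagonal_mul_diagonal]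
      congr 1
      ext x
      rw [← Complex.exp_add, ← mul_add, ← Complex.ofReal_add]
      congr 3
      have hcomm : ∀ v w, d (Function.update (Function.update x b v) c w) =
          d (Function.update x c w) := by
        intro v w
        rw [Function.update_comm hbc]
        exact hd.update (by simpa using hb) _ _
      simp only [hcomm, Function.update_self]
      have hx : d x = d (Function.update x c (x c)) := by simp
      rw [hx]
      cases x b <;> cases x c <;> simp <;> ring
    · have hcn : ActsOn [Gate.cnot c b hbc.symm] {w | w ∈ b :: c :: cs} :=
        actsOn_cnot _ (by simp) (by simp)
      exact (s₀.mono hsub).append ((hcn.append (s₁.mono hsub)).append hcn)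
    · have hcn := costs_cnot c b hbc.symm
      refine (k₀.append ((hcn.append k₁).append hcn)).mono ?_ ?_
      · simp only [List.length_cons, pow_succ]; omega
      · have := Nat.one_le_two_pow (n := cs.length)
        simp only [List.length_cons, pow_succ]; omega

/-- Every diagonal unitary on `k` qubits is a circuit of `O (2 ^ k)` gates. -/
theorem exists_diagonal (w : ι) (ws : List ι) (hws : (w :: ws).Nodup) (φ : Bits ι → ℝ)
    (hφ : DependsOn φ {v | v ∈ w :: ws}) :
    ∃ C : Circuit ι,
      circuitOp C = Matrix.diagonal (fun x => Complex.exp (Complex.I * (φ x : ℂ))) ∧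
      ActsOn C {v | v ∈ w :: ws} ∧
      Costs C (2 ^ (ws.length + 1)) (2 ^ (ws.length + 2)) := by
  induction ws generalizing w φ with
  | nil =>
    refine ⟨[Gate.single (phaseGate (φ (zeroBits _)) (φ (fun _ => true))) w], ?_,
      actsOn_single _ (by simp), (costs_single _ _).mono (by simp) (by simp)⟩
    rw [circuitOp_singleton, phaseGate_op]
    congr 1
    ext x
    congr 3
    split_ifs with h
    · exact hφ _ _ (by simp [h])
    · exact hφ _ _ (by simpa [zeroBits] using (Bool.not_eq_true _ ▸ h : x w = false).symm)
  | cons w' ws ih =>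
    have hw : w ∉ w' :: ws := (List.nodup_cons.1 hws).1
    have hu := fun v => hφ.update_cons v
    -- The phase is its average over `w`, which no longer involves `w`, plus a multiplexed rotation
    -- of `w` by half the difference.
    obtain ⟨C₀, h₀, s₀, k₀⟩ := ih w' (List.nodup_cons.1 hws).2
      (fun x => (φ (Function.update x w false) + φ (Function.update x w true)) / 2)
      ((hu false).map₂ (hu true) fun p q => (p + q) / 2)
    obtain ⟨C₁, h₁, s₁, k₁⟩ := exists_mux (w' :: ws) w hw
      (fun x => (φ (Function.update x w false) - φ (Function.update x w true)) / 2)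
      ((hu false).map₂ (hu true) fun p q => (p - q) / 2)
    refine ⟨C₀ ++ C₁, ?_, (s₀.mono ?_).append s₁, (k₀.append k₁).mono ?_ ?_⟩
    · rw [circuitOp_append, h₁, h₀, Matrix.diagonal_mul_diagonal]
      congr 1
      ext x
      rw [← Complex.exp_add, ← mul_add, ← Complex.ofReal_add]
      congr 3
      have hx : φ x = φ (Function.update x w (x w)) := by simp
      rw [hx]
      cases x w <;> simp <;> ring
    · intro v hv
      exact List.mem_cons_of_mem _ hv
    · simp only [List.length_cons, pow_succ]; omega
    · simp only [List.length_cons, pow_succ]; omega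

/-! ### Gadgets built from diagonal operators and Hadamards -/

/-- The Hadamard gate. -/
abbrev hGate (t : ι) : Gate ι := Gate.single ⟨hadamard, hadamard_mem⟩ t

theorem inv_sqrt_two_mul_self :
    (((Real.sqrt 2)⁻¹ : ℝ) : ℂ) * (((Real.sqrt 2)⁻¹ : ℝ) : ℂ) = 1 / 2 := by
  rw [← Complex.ofReal_mul, ← mul_inv, Real.mul_self_sqrt (by norm_num)]; norm_num

theorem hGate_mulVec_ket (t : ι) (y : Bits ι) :
    (hGate t).op *ᵥ ket y = (((Real.sqrt 2)⁻¹ : ℝ) : ℂ) • (ket (Function.update y t false) +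
      (if y t then -1 else 1 : ℂ) • ket (Function.update y t true)) := by
  rw [single_op_mulVec_ket, Fintype.sum_bool]
  cases h : y t <;> simp [hadamard, add_comm]

theorem state_eq_sum (ψ : State ι) : ψ = ∑ z, ψ z • ket z := by
  ext x
  simp [Finset.sum_apply, ket_apply]

/-- Between two Hadamards the diagonal values at `t = 0` and `t = 1` appear through their half-sum
and half-difference. `exists_amplitude` and `exists_xor` are choices of these two values. -/
theorem hConj_mulVec_ket {D : Circuit ι} {d : Bits ι → ℂ}
    (hD : circuitOp D = Matrix.diagonal d) (t : ι) (y : Bits ι) :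
    circuitOp ([hGate t] ++ D ++ [hGate t]) *ᵥ ket y =
      ((d (Function.update y t false) + (if y t then -1 else 1) * d (Function.update y t true)) / 2)
        • ket (Function.update y t false) +
      ((d (Function.update y t false) - (if y t then -1 else 1) * d (Function.update y t true)) / 2)
        • ket (Function.update y t true) := by
  have h2 := inv_sqrt_two_mul_self
  rw [circuitOp_append_mulVec, circuitOp_append_mulVec, circuitOp_singleton, hGate_mulVec_ket, hD]
  simp only [Matrix.mulVec_smul, Matrix.mulVec_add, diagonal_mulVec_ket, hGate_mulVec_ket,
    Function.update_self, Function.update_idem]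
  generalize (((Real.sqrt 2)⁻¹ : ℝ) : ℂ) = s at h2
  generalize d (Function.update y t false) = p
  generalize d (Function.update y t true) = r
  generalize (if y t then -1 else 1 : ℂ) = σ
  ext x
  simp only [Pi.add_apply, Pi.smul_apply, smul_eq_mul]
  generalize (ket (Function.update y t false) : State ι) x = A
  generalize (ket (Function.update y t true) : State ι) x = B
  simp only [Bool.false_eq_true, if_false, if_true]
  linear_combination ((p + σ * r) * A + (p - σ * r) * B) * h2

/-- Amplitude gadget: multiplies by an arbitrary contraction, flagging the failure on qubit `f`. -/
theorem exists_amplitude (f : ι) (ws : List ι) (hws : (f :: ws).Nodup) (α : Bits ι → ℂ)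
    (hα : DependsOn α {w | w ∈ ws}) (hα1 : ∀ x, ‖α x‖ ≤ 1) :
    ∃ (C : Circuit ι) (β : Bits ι → ℂ), ActsOn C {w | w ∈ f :: ws} ∧
      Costs C (2 ^ (ws.length + 1) + 2) (2 ^ (ws.length + 2)) ∧
      ∀ y, ‖α y‖ ^ 2 + ‖β y‖ ^ 2 = 1 ∧ (y f = false →
        circuitOp C *ᵥ ket y = α y • ket y + β y • ket (Function.update y f true)) := by
  have hf : f ∉ ws := (List.nodup_cons.1 hws).1
  -- The phases are $\arg\alpha\pm\arccos|\alpha|$: the half-sum of their exponentials is $\alpha$,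
  -- and the half-difference has modulus $\sqrt{1-|\alpha|^2}$.
  obtain ⟨D, hD, sD, kD⟩ := exists_diagonal f ws hws
    (fun x => Complex.arg (α x) + (if x f then -1 else 1) * Real.arccos ‖α x‖) (by
      intro x y hxy
      have h1 : α x = α y := hα x y fun w hw => hxy w (List.mem_cons_of_mem _ hw)
      have h2 : x f = y f := hxy f (by simp)
      simp only [h1, h2])
  have hE : ∀ x (b : Bool), Complex.exp (Complex.I * ((Complex.arg (α x) +
      (if b then -1 else 1) * Real.arccos ‖α x‖ : ℝ) : ℂ)) =
      Complex.exp (Complex.arg (α x) * Complex.I) *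
        (((‖α x‖ : ℝ) : ℂ) + (if b then -1 else 1) *
          ((Real.sin (Real.arccos ‖α x‖) : ℝ) : ℂ) * Complex.I) := by
    intro x b
    have hc : Complex.cos (Real.arccos ‖α x‖) = ((‖α x‖ : ℝ) : ℂ) := by
      rw [← Complex.ofReal_cos, Real.cos_arccos (by linarith [norm_nonneg (α x)]) (hα1 x)]
    rw [mul_comm, Complex.ofReal_add, add_mul, Complex.exp_add]
    congr 1
    cases b
    · simp only [Bool.false_eq_true, if_false, one_mul]
      rw [Complex.exp_mul_I, hc, Complex.ofReal_sin]
    · simp only [if_true]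
      rw [Complex.ofReal_mul, Complex.ofReal_neg, Complex.ofReal_one, neg_one_mul,
        Complex.exp_mul_I, Complex.cos_neg, Complex.sin_neg, hc, Complex.ofReal_sin]
      ring
  have hpol : ∀ x, Complex.exp (Complex.arg (α x) * Complex.I) * ((‖α x‖ : ℝ) : ℂ) = α x := by
    intro x; rw [mul_comm]; exact Complex.norm_mul_exp_arg_mul_I _
  have hH : ActsOn [hGate f] {w | w ∈ f :: ws} := actsOn_single _ (by simp)
  refine ⟨[hGate f] ++ D ++ [hGate f], fun y => Complex.exp (Complex.arg (α y) * Complex.I) *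
    (((Real.sin (Real.arccos ‖α y‖) : ℝ) : ℂ) * Complex.I), (hH.append sD).append hH,
    (((costs_single _ _).append kD).append (costs_single _ _)).mono (by omega) (by omega), ?_⟩
  intro y
  constructor
  · rw [norm_mul, Complex.norm_exp_ofReal_mul_I, one_mul, norm_mul, Complex.norm_I, mul_one,
      Complex.norm_real, Real.sin_arccos, Real.norm_eq_abs, sq_abs, Real.sq_sqrt]
    · ring
    · nlinarith [hα1 y, norm_nonneg (α y)]
  · intro hy
    have hαu : ∀ b, α (Function.update y f b) = α y := fun b => hα.update (by simpa using hf) _ _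
    have h0 : Function.update y f false = y := by rw [← hy]; simp
    rw [hConj_mulVec_ket hD]
    have hE0 := hE y false
    have hE1 := hE y true
    simp only [Bool.false_eq_true, if_false, if_true] at hE0 hE1
    simp only [hαu, hy, Function.update_self, h0, Bool.false_eq_true, if_false, if_true]
    rw [hE0, hE1]
    congr 2
    · linear_combination hpol y
    · ring

/-- Controlled NOT with an arbitrary Boolean control function. -/
theorem exists_xor (t : ι) (ws : List ι) (hws : (t :: ws).Nodup) (g : Bits ι → Bool)
    (hg : DependsOn g {w | w ∈ ws}) :
    ∃ C : Circuit ι, ActsOn C {w | w ∈ t :: ws} ∧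
      Costs C (2 ^ (ws.length + 1) + 2) (2 ^ (ws.length + 2)) ∧
      ∀ y, circuitOp C *ᵥ ket y = ket (Function.update y t (xor (y t) (g y))) := by
  have ht : t ∉ ws := (List.nodup_cons.1 hws).1
  -- A sign on `t = 1` under the control `g`; the Hadamards on `t` turn it into a flip.
  obtain ⟨D, hD, sD, kD⟩ := exists_diagonal t ws hws
    (fun x => if g x && x t then Real.pi else 0) (by
      intro x y hxy
      have h1 : g x = g y := hg x y fun w hw => hxy w (List.mem_cons_of_mem _ hw)
      have h2 : x t = y t := hxy t (by simp)
      simp only [h1, h2])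
  have hH : ActsOn [hGate t] {w | w ∈ t :: ws} := actsOn_single _ (by simp)
  refine ⟨[hGate t] ++ D ++ [hGate t], (hH.append sD).append hH,
    (((costs_single _ _).append kD).append (costs_single _ _)).mono (by omega) (by omega), ?_⟩
  intro y
  have hgu : ∀ b, g (Function.update y t b) = g y := fun b => hg.update (by simpa using ht) _ _
  have hpi : Complex.exp (Complex.I * (Real.pi : ℂ)) = -1 := by
    rw [mul_comm]; exact Complex.exp_pi_mul_I
  rw [hConj_mulVec_ket hD]
  simp only [hgu, Function.update_self]
  cases g y <;> cases h : y t <;> simp [hpi]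

/-- Hadamard gates on distinct qubits, on an input where these qubits are zero. -/
theorem hadamards_mulVec_ket (ws : List ι) (hws : ws.Nodup) (y : Bits ι)
    (hy : ∀ w ∈ ws, y w = false) :
    circuitOp (ws.map hGate) *ᵥ ket y = fun x => if ∀ i, i ∉ ws → x i = y i then
      (((Real.sqrt 2)⁻¹ : ℝ) : ℂ) ^ ws.length else 0 := by
  induction ws generalizing y with
  | nil =>
    ext x
    simp [circuitOp, ket_apply, funext_iff]
  | cons w ws ih =>
    have hw : w ∉ ws := (List.nodup_cons.1 hws).1
    have hws' := (List.nodup_cons.1 hws).2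
    have hyw : y w = false := hy w (by simp)
    have hz : ∀ b, ∀ v ∈ ws, Function.update y w b v = false := by
      intro b v hv
      have : v ≠ w := fun e => hw (e ▸ hv)
      simp [this, hy v (List.mem_cons_of_mem _ hv)]
    simp only [List.map_cons, circuitOp, ← Matrix.mulVec_mulVec, hGate_mulVec_ket,
      Matrix.mulVec_smul, Matrix.mulVec_add, ih hws' _ (hz _), hyw, Bool.false_eq_true, if_false,
      one_smul]
    ext x
    simp only [Pi.smul_apply, Pi.add_apply, smul_eq_mul, List.length_cons, pow_succ']
    have key : ∀ b, (∀ i, i ∉ ws → x i = Function.update y w b i) ↔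
        (x w = b ∧ ∀ i, i ∉ w :: ws → x i = y i) := by
      intro b
      constructor
      · intro h
        refine ⟨by simpa using h w hw, fun i hi => ?_⟩
        simp only [List.mem_cons, not_or] at hi
        simpa [hi.1] using h i hi.2
      · rintro ⟨h1, h2⟩ i hi
        by_cases hiw : i = w
        · subst hiw; simpa using h1
        · simpa [hiw] using h2 i (by simp [hiw, hi])
    simp only [key]
    by_cases h : ∀ i, i ∉ w :: ws → x i = y i
    · cases x w <;> simp
    · rw [if_neg (fun h' => h h'.2), if_neg (fun h' => h h'.2), if_neg h]
      simp

omit [Fintype ι] [DecidableEq ι] in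
theorem costs_hadamards (ws : List ι) : Costs (ws.map hGate) ws.length 0 := by
  induction ws with
  | nil => exact costs_nil
  | cons w ws ih =>
    exact ((costs_single _ w).append ih).mono (by simp [add_comm]) (by simp)

omit [Fintype ι] [DecidableEq ι] in
theorem actsOn_hadamards (ws : List ι) : ActsOn (ws.map hGate) {w | w ∈ ws} := by
  intro g hg
  obtain ⟨w, hw, rfl⟩ := List.mem_map.1 hg
  simpa [Gate.wires] using hw

/-! ### State preparation -/

/-- One step of marginalisation: the value of `w` is summed out. Sums run over all strings, the free
qubits being singled out by agreement with `y` elsewhere, so that no smaller type of strings is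
needed. -/
theorem sum_agree_cons (w : ι) (ws : List ι) (hw : w ∉ ws) (y : Bits ι) (F : Bits ι → ℝ) :
    (∑ x, if ∀ i, i ∉ w :: ws → x i = y i then F x else 0) =
      ∑ x, if ∀ i, i ∉ ws → x i = y i then
        (F (Function.update x w false) + F (Function.update x w true)) else 0 := by
  rw [← Finset.sum_filter, ← Finset.sum_filter, Finset.sum_add_distrib]
  have h1 : ∀ b, ∑ x with ∀ i, i ∉ ws → x i = y i, F (Function.update x w b) =
      ∑ x ∈ Finset.univ.filter (fun x : Bits ι => ∀ i, i ∉ w :: ws → x i = y i) with x w = b,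
        F x := by
    intro b
    refine Finset.sum_nbij' (fun x => Function.update x w b) (fun x => Function.update x w (y w))
      ?_ ?_ ?_ ?_ ?_
    · intro x hx
      simp only [Finset.mem_filter, Finset.mem_univ, true_and] at hx ⊢
      refine ⟨fun i hi => ?_, by simp⟩
      simp only [List.mem_cons, not_or] at hi
      simpa [hi.1] using hx i hi.2
    · intro x hx
      simp only [Finset.mem_filter, Finset.mem_univ, true_and] at hx ⊢
      intro i hi
      by_cases hiw : i = w
      · subst hiw; simp
      · simpa [hiw] using hx.1 i (by simp [hiw, hi])
    · intro x hx
      simp only [Finset.mem_filter, Finset.mem_univ, true_and] at hx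
      simp [← hx w hw]
    · intro x hx
      simp only [Finset.mem_filter, Finset.mem_univ, true_and] at hx
      simp [← hx.2]
    · intro x hx; rfl
  rw [h1, h1, ← Finset.sum_union]
  · congr 1
    ext x
    simp only [Finset.mem_union, Finset.mem_filter, Finset.mem_univ, true_and]
    cases x w <;> simp
  · rw [Finset.disjoint_left]
    intro x hx hx'
    simp only [Finset.mem_filter] at hx hx'
    simp [hx.2] at hx'

/-- Binary-tree state preparation: the marginal distribution on the tail is prepared recursively,
then the head qubit is rotated by conditional amplitudes. Only the moduli of the amplitudes `v` are
controlled; this suffices because `exists_reflection` undoes the preparation by its inverse, so that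
only $|v|^2$ enters. -/
theorem exists_prepare (ws : List ι) (hws : ws.Nodup) (ω : Bits ι → ℝ) (hω : ∀ x, 0 ≤ ω x)
    (hωd : DependsOn ω {w | w ∈ ws})
    (hsum : ∀ y : Bits ι, (∑ x : Bits ι, if ∀ i, i ∉ ws → x i = y i then ω x else 0) = 1) :
    ∃ (C : Circuit ι) (v : Bits ι → ℂ), ActsOn C {w | w ∈ ws} ∧
      Costs C (4 * 2 ^ ws.length) (4 * 2 ^ ws.length) ∧ (∀ x, ‖v x‖ ^ 2 = ω x) ∧
      ∀ y, (∀ w ∈ ws, y w = false) →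
        circuitOp C *ᵥ ket y = fun x => if ∀ i, i ∉ ws → x i = y i then v x else 0 := by
  induction ws generalizing ω with
  | nil =>
    refine ⟨[], fun _ => 1, actsOn_nil _, costs_nil.mono (by simp) (by simp), fun x => ?_, ?_⟩
    · have := hsum x
      have e : ∀ z : Bits ι, (∀ i, i ∉ ([] : List ι) → z i = x i) ↔ z = x := by
        simp [funext_iff]
      simp only [e, Finset.sum_ite_eq', Finset.mem_univ, if_true] at this
      simpa using this.symm
    · intro y _
      ext x
      simp [circuitOp, ket_apply, funext_iff]
  | cons w ws ih =>
    have hw : w ∉ ws := (List.nodup_cons.1 hws).1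
    have hws' := (List.nodup_cons.1 hws).2
    have hd0 := hωd.update_cons false
    have hd1 := hωd.update_cons true
    obtain ⟨C, v, sC, kC, hv, hC⟩ := ih hws'
      (fun x => ω (Function.update x w false) + ω (Function.update x w true))
      (fun x => add_nonneg (hω _) (hω _)) (hd0.map₂ hd1 (· + ·))
      (fun y => by rw [← sum_agree_cons w ws hw y ω]; exact hsum y)
    -- The conditional probability of `w = 0`. Where the marginal vanishes the quotient is 0 by
    -- convention, which is harmless because the earlier amplitude `v` vanishes there too.
    set A : Bits ι → ℝ := fun x => ω (Function.update x w false) /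
      (ω (Function.update x w false) + ω (Function.update x w true)) with hA
    have hA0 : ∀ x, 0 ≤ A x := fun x => div_nonneg (hω _) (add_nonneg (hω _) (hω _))
    have hA1 : ∀ x, A x ≤ 1 := fun x =>
      div_le_one_of_le₀ (by linarith [hω (Function.update x w true)])
        (add_nonneg (hω _) (hω _))
    obtain ⟨D, β, sD, kD, hD⟩ := exists_amplitude w ws hws (fun x => ((Real.sqrt (A x) : ℝ) : ℂ))
      (hd0.map₂ hd1 fun p q => ((Real.sqrt (p / (p + q)) : ℝ) : ℂ)) (fun x => by
        rw [Complex.norm_real, Real.norm_of_nonneg (Real.sqrt_nonneg _)]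
        exact Real.sqrt_le_one.2 (hA1 x))
    have hnα : ∀ x, ‖((Real.sqrt (A x) : ℝ) : ℂ)‖ ^ 2 = A x := fun x => by
      rw [Complex.norm_real, Real.norm_of_nonneg (Real.sqrt_nonneg _), Real.sq_sqrt (hA0 x)]
    have hnβ : ∀ x, ‖β x‖ ^ 2 = 1 - A x := fun x => by
      have := (hD x).1
      rw [hnα] at this
      linarith
    refine ⟨C ++ D, fun x => if x w then v (Function.update x w false) *
      β (Function.update x w false) else v x * ((Real.sqrt (A x) : ℝ) : ℂ),
      (sC.mono fun _ h => List.mem_cons_of_mem _ h).append sD, (kC.append kD).mono ?_ ?_, ?_, ?_⟩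
    · have := Nat.one_le_two_pow (n := ws.length)
      simp only [List.length_cons, pow_succ]; omega
    · simp only [List.length_cons, pow_succ]; omega
    · intro x
      have hz : ∀ p q : ℝ, 0 ≤ p → 0 ≤ q → (p + q) * (p / (p + q)) = p := by
        intro p q hp hq
        rcases eq_or_ne (p + q) 0 with h | h
        · rw [h, zero_mul]; linarith
        · field_simp
      have hx := hz _ _ (hω (Function.update x w false)) (hω (Function.update x w true))
      cases h : x w
      · have : Function.update x w false = x := by rw [← h]; simp
        simp only [h, Bool.false_eq_true, if_false]
        rw [norm_mul, mul_pow, hv, hnα]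
        simp only [hA]
        rw [hx, this]
      · have : Function.update x w true = x := by rw [← h]; simp
        simp only [h, if_true]
        rw [norm_mul, mul_pow, hv, hnβ]
        simp only [hA, Function.update_idem]
        rw [mul_sub, hx, this]
        ring
    · intro y hy
      rw [circuitOp_append_mulVec, hC y fun v hv => hy v (List.mem_cons_of_mem _ hv),
        state_eq_sum (fun x => _), Matrix.mulVec_sum]
      have hyw : y w = false := hy w (by simp)
      have hterm : ∀ z : Bits ι, circuitOp D *ᵥ ((if ∀ i, i ∉ ws → z i = y i then v z else 0) •
          (ket z : State ι)) = if ∀ i, i ∉ ws → z i = y i then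
            (v z * ((Real.sqrt (A z) : ℝ) : ℂ)) • ket z +
            (v z * β z) • ket (Function.update z w true) else 0 := by
        intro z
        split_ifs with hz
        · rw [Matrix.mulVec_smul, (hD z).2 ((hz w hw).trans hyw), smul_add, smul_smul, smul_smul]
        · rw [zero_smul, Matrix.mulVec_zero]
      simp only [hterm]
      ext x
      rw [Finset.sum_apply]
      -- The input of `D` is supported on strings with `w = 0`, so the output at `x` comes from a
      -- single `z`, namely `x` with `w` reset to 0.
      have hsplit : ∀ z : Bits ι, (if ∀ i, i ∉ ws → z i = y i then
            (v z * ((Real.sqrt (A z) : ℝ) : ℂ)) • ket z +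
            (v z * β z) • ket (Function.update z w true) else 0 : State ι) x =
          if z = Function.update x w false then
            (if ∀ i, i ∉ w :: ws → x i = y i then (if x w then v z * β z else
              v z * ((Real.sqrt (A z) : ℝ) : ℂ)) else 0) else 0 := by
        intro z
        by_cases hz : ∀ i, i ∉ ws → z i = y i
        · have hzw : z w = false := (hz w hw).trans hyw
          have hzu : Function.update z w false = z := by rw [← hzw]; simp
          rw [if_pos hz]
          simp only [Pi.add_apply, Pi.smul_apply, ket_apply, smul_eq_mul]
          by_cases hzx : z = Function.update x w false
          · have hxy : ∀ i, i ∉ w :: ws → x i = y i := by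
              intro i hi
              simp only [List.mem_cons, not_or] at hi
              rw [← hz i hi.2, hzx]; simp [hi.1]
            rw [if_pos hzx, if_pos hxy]
            cases hxw : x w
            · have h1 : x = z := by rw [hzx, ← hxw]; simp
              have h2 : x ≠ Function.update z w true := by
                intro e; rw [e] at hxw; simp at hxw
              rw [if_pos h1, if_neg h2]; simp
            · have h1 : x ≠ z := by
                intro e; rw [e, hzw] at hxw; simp at hxw
              have h2 : x = Function.update z w true := by
                rw [hzx, ← hxw]; simp
              rw [if_neg h1, if_pos h2]; simp
          · have h1 : x ≠ z := by
              rintro rfl; exact hzx hzu.symm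
            have h2 : x ≠ Function.update z w true := by
              rintro rfl
              apply hzx; rw [Function.update_idem, hzu]
            rw [if_neg h1, if_neg h2, if_neg hzx]; simp
        · rw [if_neg hz]
          by_cases hzx : z = Function.update x w false
          · rw [if_pos hzx, if_neg]
            · rfl
            · intro hxy
              apply hz
              intro i hi
              rw [hzx]
              by_cases hiw : i = w
              · subst hiw; simp [hyw]
              · simpa [hiw] using hxy i (by simp [hiw, hi])
          · rw [if_neg hzx]; rfl
      simp only [hsplit]
      rw [Finset.sum_ite_eq' Finset.univ]
      simp only [Finset.mem_univ, if_true]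
      by_cases hxy : ∀ i, i ∉ w :: ws → x i = y i
      · rw [if_pos hxy, if_pos hxy]
        cases hxw : x w
        · have h1 : Function.update x w false = x := by rw [← hxw]; simp
          simp [h1]
        · simp
      · rw [if_neg hxy, if_neg hxy]

end Gadgets

section Adder

variable {ι : Type} [Fintype ι] [DecidableEq ι]

/-! ### Ripple-carry addition -/

/-- The number whose binary digits, starting with the lowest, are on the qubits `ws`. -/
def numOn (b : Bits ι) : List ι → ℕ
  | [] => 0
  | w :: ws => (b w).toNat + 2 * numOn b ws

omit [Fintype ι] [DecidableEq ι] in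
theorem numOn_congr {b b' : Bits ι} {ws : List ι} (h : ∀ w ∈ ws, b w = b' w) :
    numOn b ws = numOn b' ws := by
  induction ws with
  | nil => rfl
  | cons w ws ih =>
    simp only [numOn]
    rw [h w (by simp), ih fun v hv => h v (List.mem_cons_of_mem _ hv)]

omit [Fintype ι] [DecidableEq ι] in
theorem numOn_lt (b : Bits ι) (ws : List ι) : numOn b ws < 2 ^ ws.length := by
  induction ws with
  | nil => simp [numOn]
  | cons w ws ih =>
    simp only [numOn, List.length_cons, pow_succ]
    have := Bool.toNat_lt (b w)
    omega

omit [Fintype ι] [DecidableEq ι] in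
theorem testBit_numOn (b : Bits ι) (ws : List ι) (t : ℕ) (ht : t < ws.length) :
    (numOn b ws).testBit t = b ws[t] := by
  induction ws generalizing t with
  | nil => simp at ht
  | cons w ws ih =>
    have hlt := Bool.toNat_lt (b w)
    cases t with
    | zero =>
      simp only [numOn, Nat.testBit_zero, List.getElem_cons_zero]
      cases b w <;> simp
    | succ t =>
      rw [Nat.testBit_succ]
      have : numOn b (w :: ws) / 2 = numOn b ws := by
        simp only [numOn]; omega
      rw [this, ih t (by simpa using ht)]
      simp

/-- The majority of three bits. -/
def maj (p q r : Bool) : Bool := (p && q) || (p && r) || (q && r)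

/-- Each triple holds a digit of either summand and a zero qubit for the outgoing carry. The
majority is written into the carry qubit, the higher digits are added with it as carry-in, and the
same majority gate clears it. The second summand's digit must be overwritten last, since the
majority depends on its old value. One digit takes two majority gates of at most 18 one-qubit gates
and 32 C-NOTs each, and two more C-NOTs. -/
theorem exists_adder (L : List (ι × ι × ι)) (c : ι)
    (hL : (c :: L.flatMap fun p => [p.1, p.2.1, p.2.2]).Nodup) :
    ∃ C : Circuit ι, ActsOn C {w | w ∈ c :: L.flatMap fun p => [p.1, p.2.1, p.2.2]} ∧
      Costs C (36 * L.length) (66 * L.length) ∧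
      ∀ b, (∀ p ∈ L, b p.2.2 = false) → ∃ b', circuitOp C *ᵥ ket b = ket b' ∧
        (∀ w, w ∉ L.map (fun p => p.2.1) → b' w = b w) ∧
        numOn b' (L.map fun p => p.2.1) = (numOn b (L.map fun p => p.1) +
          numOn b (L.map fun p => p.2.1) + (b c).toNat) % 2 ^ L.length := by
  induction L generalizing c with
  | nil =>
    refine ⟨[], actsOn_nil _, costs_nil, fun b _ => ⟨b, by simp [circuitOp], fun _ _ => rfl, ?_⟩⟩
    simp [numOn, Nat.mod_one]
  | cons p L ih =>
    obtain ⟨x, y, c'⟩ := p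
    simp only [List.flatMap_cons, List.cons_append, List.nil_append] at hL ⊢
    set F := L.flatMap fun p => [p.1, p.2.1, p.2.2] with hF
    simp only [List.nodup_cons, List.mem_cons, not_or] at hL
    obtain ⟨⟨hcx, hcy, hcc', hcF⟩, ⟨hxy, hxc', hxF⟩, ⟨hyc', hyF⟩, hc'F, hFn⟩ := hL
    have hxsF : ∀ w ∈ L.map (fun p => p.1), w ∈ F := by
      intro w hw
      obtain ⟨p, hp, rfl⟩ := List.mem_map.1 hw
      exact List.mem_flatMap.2 ⟨p, hp, by simp⟩
    have hysF : ∀ w ∈ L.map (fun p => p.2.1), w ∈ F := by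
      intro w hw
      obtain ⟨p, hp, rfl⟩ := List.mem_map.1 hw
      exact List.mem_flatMap.2 ⟨p, hp, by simp⟩
    have hcsF : ∀ p ∈ L, p.2.2 ∈ F := fun p hp => List.mem_flatMap.2 ⟨p, hp, by simp⟩
    obtain ⟨D, sD, kD, hD⟩ := ih c' (by simp [List.nodup_cons, hc'F, hFn])
    obtain ⟨M, sM, kM, hM⟩ := exists_xor c' [x, y, c]
      (by simp [List.nodup_cons, Ne.symm hcx, Ne.symm hcy, Ne.symm hcc', hxy, Ne.symm hxc',
        Ne.symm hyc']) (fun b => maj (b x) (b y) (b c)) (by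
        intro b b' h
        simp only [h x (by simp), h y (by simp), h c (by simp)])
    have hsub : {w | w ∈ [c', x, y, c]} ⊆ {w | w ∈ c :: x :: y :: c' :: F} := by
      intro w hw
      simp only [List.mem_cons, Set.mem_ofPred_eq, List.not_mem_nil, or_false] at hw ⊢
      tauto
    have sM' := sM.mono hsub
    have sD' := sD.mono (S' := {w | w ∈ c :: x :: y :: c' :: F}) (by
      intro w hw
      simp only [List.mem_cons, Set.mem_ofPred_eq] at hw ⊢
      tauto)
    refine ⟨M ++ D ++ M ++ [Gate.cnot x y hxy] ++ [Gate.cnot c y hcy],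
      ((((sM'.append sD').append sM').append (actsOn_cnot _ (by simp) (by simp))).append
        (actsOn_cnot _ (by simp) (by simp))),
      ((((kM.append kD).append kM).append (costs_cnot _ _ _)).append (costs_cnot _ _ _)).mono
        ?_ ?_, ?_⟩
    · simp only [List.length_cons, List.length_nil]; omega
    · simp only [List.length_cons, List.length_nil]; omega
    intro b hb
    have hbc' : b c' = false := hb (x, y, c') (by simp)
    set m := maj (b x) (b y) (b c) with hm
    set b₁ := Function.update b c' m with hb₁
    have hb₁F : ∀ w ∈ F, b₁ w = b w := fun w hw => by
      have : w ≠ c' := fun e => hc'F (e ▸ hw)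
      simp [hb₁, this]
    obtain ⟨b₂, hDb, hb₂, hnum⟩ := hD b₁ (fun p hp => by
      rw [hb₁F _ (hcsF p hp)]; exact hb p (List.mem_cons_of_mem _ hp))
    have hout : ∀ w, w ∉ F → b₂ w = b₁ w := fun w hw => hb₂ w fun h => hw (hysF w h)
    have h2x : b₂ x = b x := by rw [hout x hxF]; simp [hb₁, hxc']
    have h2y : b₂ y = b y := by rw [hout y hyF]; simp [hb₁, hyc']
    have h2c : b₂ c = b c := by rw [hout c hcF]; simp [hb₁, hcc']
    have h2c' : b₂ c' = m := by rw [hout c' hc'F]; simp [hb₁]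
    refine ⟨Function.update (Function.update b₂ c' false) y (xor (xor (b y) (b x)) (b c)),
      ?_, ?_, ?_⟩
    · simp only [circuitOp_append_mulVec, circuitOp_singleton]
      rw [hM, hbc', Bool.false_xor, ← hm, ← hb₁, hDb, hM, h2x, h2y, h2c, h2c', ← hm, Bool.xor_self,
        cnot_op_mulVec_ket, cnot_op_mulVec_ket]
      congr 1
      simp [hyc', hxc', hcc', h2x, h2y, h2c, hcy]
    · intro w hw
      simp only [List.map_cons, List.mem_cons, not_or] at hw
      rw [Function.update_of_ne hw.1]
      by_cases hwc : w = c'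
      · subst hwc; simp [hbc']
      · rw [Function.update_of_ne hwc, hb₂ w hw.2]; simp [hb₁, hwc]
    · simp only [List.map_cons, numOn, Function.update_self, List.length_cons]
      have e1 : ∀ B v, numOn (Function.update (Function.update b₂ c' B) y v)
          (L.map fun p => p.2.1) = numOn b₂ (L.map fun p => p.2.1) := by
        intro B v
        apply numOn_congr
        intro w hw
        have h1 : w ≠ y := fun e => hyF (e ▸ hysF w hw)
        have h2 : w ≠ c' := fun e => hc'F (e ▸ hysF w hw)
        simp [h1, h2]
      have e2 : numOn b₁ (L.map fun p => p.1) = numOn b (L.map fun p => p.1) :=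
        numOn_congr fun w hw => hb₁F w (hxsF w hw)
      have e3 : numOn b₁ (L.map fun p => p.2.1) = numOn b (L.map fun p => p.2.1) :=
        numOn_congr fun w hw => hb₁F w (hysF w hw)
      have e4 : b₁ c' = m := by simp [hb₁]
      rw [e1, hnum, e2, e3, e4, pow_succ']
      generalize numOn b (L.map fun p => p.1) = X
      generalize numOn b (L.map fun p => p.2.1) = Y
      have hpos : 0 < 2 ^ L.length := by positivity
      generalize 2 ^ L.length = K at hpos
      have hbit : (b x).toNat + (b y).toNat + (b c).toNat =
          (xor (xor (b y) (b x)) (b c)).toNat + 2 * m.toNat := by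
        rw [hm]; cases b x <;> cases b y <;> cases b c <;> rfl
      have hs := Bool.toNat_lt (xor (xor (b y) (b x)) (b c))
      have hsum : (b x).toNat + 2 * X + ((b y).toNat + 2 * Y) + (b c).toNat =
          (xor (xor (b y) (b x)) (b c)).toNat + 2 * (X + Y + m.toNat) := by omega
      rw [hsum]
      generalize X + Y + m.toNat = Z
      generalize (xor (xor (b y) (b x)) (b c)).toNat = s at hs
      have hZ := Nat.div_add_mod Z K
      have hlt := Nat.mod_lt Z hpos
      have : s + 2 * Z = (s + 2 * (Z % K)) + 2 * K * (Z / K) := by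
        nlinarith
      rw [this, Nat.add_mul_mod_self_left]
      exact (Nat.mod_eq_of_lt (by omega)).symm

end Adder

/-! ### Quantum signal processing, from Fejér–Riesz to the coordinate oracle. -/

/-! ### Complementary polynomials -/

section FejerRiesz

open Polynomial ComplexConjugate

/-- The solutions $\rho\pm\sqrt{\rho^2-1}$ have product 1. Either one of them lies in the open unit
disc, or both lie on the circle and are conjugate, and then their mean $\rho$ is a real number in
$[-1,1]$. -/
theorem exists_joukowski (ρ : ℂ) (hρ : ∀ c : ℝ, -1 ≤ c → c ≤ 1 → ρ ≠ c) :
    ∃ ζ : ℂ, ζ ≠ 0 ∧ ‖ζ‖ < 1 ∧ ζ ^ 2 + 1 = 2 * ρ * ζ := by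
  obtain ⟨s, hs⟩ := IsAlgClosed.exists_pow_nat_eq (ρ ^ 2 - 1) (n := 2) (by norm_num)
  have h1 : (ρ + s) * (ρ - s) = 1 := by linear_combination -hs
  have hp : ρ + s ≠ 0 := left_ne_zero_of_mul_eq_one h1
  have hm : ρ - s ≠ 0 := right_ne_zero_of_mul_eq_one h1
  have hn : ‖ρ + s‖ * ‖ρ - s‖ = 1 := by rw [← norm_mul, h1, norm_one]
  rcases lt_trichotomy ‖ρ + s‖ 1 with h | h | h
  · exact ⟨ρ + s, hp, h, by linear_combination hs⟩
  · exfalso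
    have hinv : ρ - s = conj (ρ + s) := by
      have h2 : (ρ + s) * conj (ρ + s) = 1 := by
        rw [Complex.mul_conj, Complex.normSq_eq_norm_sq, h]; norm_num
      exact mul_left_cancel₀ hp (h1.trans h2.symm)
    have h3 : ρ = ((ρ + s).re : ℂ) := by
      have := Complex.add_conj (ρ + s)
      rw [← hinv] at this
      push_cast at this ⊢
      linear_combination this / 2
    have h4 := abs_le.1 ((Complex.abs_re_le_norm (ρ + s)).trans h.le)
    exact hρ _ h4.1 h4.2 h3
  · refine ⟨ρ - s, hm, ?_, by linear_combination hs⟩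
    have := norm_pos_iff.2 hm
    nlinarith

/-- Distinct solutions for the same $\rho$ are mutually inverse, so they cannot both lie in the open
disc. Uniqueness makes the choice of $\zeta$ commute with conjugation. -/
theorem joukowski_unique {ρ ζ ζ' : ℂ} (h : ζ ≠ 0 ∧ ‖ζ‖ < 1 ∧ ζ ^ 2 + 1 = 2 * ρ * ζ)
    (h' : ζ' ≠ 0 ∧ ‖ζ'‖ < 1 ∧ ζ' ^ 2 + 1 = 2 * ρ * ζ') : ζ = ζ' := by
  have h1 : (ζ - ζ') * (ζ * ζ' - 1) = 0 := by
    linear_combination ζ' * h.2.2 - ζ * h'.2.2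
  rcases mul_eq_zero.1 h1 with h2 | h2
  · exact sub_eq_zero.1 h2
  · exfalso
    have h3 : ‖ζ‖ * ‖ζ'‖ = 1 := by rw [← norm_mul, sub_eq_zero.1 h2, norm_one]
    have := h.2.1
    have := h'.2.1
    nlinarith [norm_nonneg ζ, norm_nonneg ζ']

/-- Fejér–Riesz: a real polynomial that is positive on `[-1, 1]` is a squared modulus on the
unit circle. -/
theorem exists_fejer_riesz (H : ℝ[X]) (hH : ∀ c : ℝ, -1 ≤ c → c ≤ 1 → 0 < H.eval c) :
    ∃ g : ℂ[X], g.natDegree ≤ H.natDegree ∧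
      ∀ w : ℂ, ‖w‖ = 1 → ‖g.eval w‖ ^ 2 = H.eval w.re := by
  classical
  set Hc := H.map Complex.ofRealHom with hHc
  have hHc0 : Hc ≠ 0 := by
    have : H ≠ 0 := by rintro rfl; simpa using hH 0 (by norm_num) (by norm_num)
    exact (Polynomial.map_ne_zero_iff Complex.ofRealHom.injective).2 this
  have heval : ∀ c : ℝ, Hc.eval (c : ℂ) = (H.eval c : ℝ) := fun c => by
    rw [hHc]; exact Polynomial.eval_map_apply (f := Complex.ofRealHom) c
  have hroot : ∀ ρ ∈ Hc.roots, ∀ c : ℝ, -1 ≤ c → c ≤ 1 → ρ ≠ c := by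
    rintro ρ hρ c h1 h2 rfl
    have h3 := (Polynomial.mem_roots hHc0).1 hρ
    rw [Polynomial.IsRoot, heval, Complex.ofReal_eq_zero] at h3
    exact (hH c h1 h2).ne' h3
  -- The coefficients are real, so the multiset of complex roots is invariant under conjugation.
  have hconj : Hc.roots.map (starRingEnd ℂ) = Hc.roots := by
    have h1 : Hc.map (starRingEnd ℂ) = Hc := by
      rw [hHc, Polynomial.map_map]
      congr 1
      ext x; simp
    have h2 := (IsAlgClosed.splits Hc).roots_map (starRingEnd ℂ)
    rw [h1] at h2
    exact h2.symm
  have hex : ∀ ρ : ℂ, ∃ ζ : ℂ, ρ ∈ Hc.roots → (ζ ≠ 0 ∧ ‖ζ‖ < 1 ∧ ζ ^ 2 + 1 = 2 * ρ * ζ) := by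
    intro ρ
    by_cases h : ρ ∈ Hc.roots
    · obtain ⟨ζ, hζ⟩ := exists_joukowski ρ (hroot ρ h)
      exact ⟨ζ, fun _ => hζ⟩
    · exact ⟨0, fun h' => absurd h' h⟩
  choose ζ hζ using hex
  have hmem : ∀ ρ ∈ Hc.roots, conj ρ ∈ Hc.roots := by
    intro ρ hρ
    rw [← hconj]
    exact Multiset.mem_map_of_mem _ hρ
  have hζc : ∀ ρ ∈ Hc.roots, conj (ζ ρ) = ζ (conj ρ) := by
    intro ρ hρ
    refine joukowski_unique (ρ := conj ρ) ?_ (hζ _ (hmem ρ hρ))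
    obtain ⟨h1, h2, h3⟩ := hζ ρ hρ
    refine ⟨by simpa using h1, by simpa using h2, ?_⟩
    have := congrArg conj h3
    simpa [Complex.conj_ofNat] using this
  set K : ℝ := ‖Hc.leadingCoeff‖ * (Hc.roots.map fun ρ => (2 * ‖ζ ρ‖)⁻¹).prod with hK
  have hK0 : 0 ≤ K := by
    refine mul_nonneg (norm_nonneg _) (Multiset.prod_nonneg ?_)
    intro a ha
    obtain ⟨ρ, _, rfl⟩ := Multiset.mem_map.1 ha
    positivity
  refine ⟨C ((Real.sqrt K : ℝ) : ℂ) * (Hc.roots.map fun ρ => X - C (ζ ρ)).prod, ?_, ?_⟩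
  · refine (Polynomial.natDegree_C_mul_le _ _).trans ?_
    have h1 := Polynomial.natDegree_multiset_prod_X_sub_C_eq_card (Hc.roots.map ζ)
    rw [Multiset.map_map, Multiset.card_map] at h1
    have h2 := Polynomial.card_roots' Hc
    have h3 : Hc.natDegree = H.natDegree := Polynomial.natDegree_map _
    simp only [Function.comp_def] at h1
    omega
  · intro w hw
    have hc := abs_le.1 ((Complex.abs_re_le_norm w).trans hw.le)
    have hw0 : w ≠ 0 := by rintro rfl; simp at hw
    have hww : w * conj w = 1 := by
      rw [Complex.mul_conj, Complex.normSq_eq_norm_sq, hw]; norm_num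
    have hre : ((w.re : ℝ) : ℂ) = (w + conj w) / 2 := by rw [Complex.add_conj]; simp
    -- On the circle $\mathrm{Re}\,w-\rho=(w-\zeta)(\zeta-\bar w)/(2\zeta)$. Over all roots the
    -- products of $|w-\zeta|$ and of $|w-\bar\zeta|$ agree (`hsym`), so $|H|$ is a square up to
    -- `K`, which collects the leading coefficient and the factors $1/(2|\zeta|)$.
    have hfac : ∀ ρ ∈ Hc.roots, ‖((w.re : ℝ) : ℂ) - ρ‖ =
        (2 * ‖ζ ρ‖)⁻¹ * ‖w - ζ ρ‖ * ‖w - conj (ζ ρ)‖ := by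
      intro ρ hρ
      obtain ⟨h1, h2, h3⟩ := hζ ρ hρ
      have h4 : 2 * ζ ρ * (((w.re : ℝ) : ℂ) - ρ) = (w - ζ ρ) * (ζ ρ - conj w) := by
        rw [hre]; linear_combination h3 + hww
      have h5 := congrArg norm h4
      have h6 : ‖ζ ρ - conj w‖ = ‖w - conj (ζ ρ)‖ := by
        rw [← Complex.norm_conj, map_sub, Complex.conj_conj, norm_sub_rev]
      rw [norm_mul, norm_mul, norm_mul, h6, Complex.norm_two] at h5
      have := norm_pos_iff.2 h1
      field_simp
      linarith
    have hsym : (Hc.roots.map fun ρ => ‖w - conj (ζ ρ)‖) =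
        Hc.roots.map fun ρ => ‖w - ζ ρ‖ := by
      conv_rhs => rw [← hconj, Multiset.map_map]
      exact Multiset.map_congr rfl fun ρ hρ => by rw [hζc ρ hρ]; rfl
    have hH1 : (H.eval w.re : ℝ) = ‖Hc.eval ((w.re : ℝ) : ℂ)‖ := by
      rw [heval, Complex.norm_real, Real.norm_of_nonneg (hH _ hc.1 hc.2).le]
    have hspl := (IsAlgClosed.splits Hc).eq_prod_roots
    have hmn : ∀ s : Multiset ℂ, ‖s.prod‖ = (s.map norm).prod := fun s =>
      map_multiset_prod (normHom : ℂ →*₀ ℝ) s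
    rw [hH1, hspl, Polynomial.eval_mul, Polynomial.eval_C, norm_mul, Polynomial.eval_mul,
      Polynomial.eval_C, norm_mul, Polynomial.eval_multiset_prod, Polynomial.eval_multiset_prod,
      hmn, hmn, Multiset.map_map, Multiset.map_map, Multiset.map_map, Multiset.map_map, ← hspl]
    have e1 : (Hc.roots.map (norm ∘ eval w ∘ fun ρ => X - C (ζ ρ))) =
        Hc.roots.map fun ρ => ‖w - ζ ρ‖ := by
      refine Multiset.map_congr rfl fun ρ _ => ?_
      simp
    have e2 : (Hc.roots.map (norm ∘ eval ((w.re : ℝ) : ℂ) ∘ fun ρ => X - C ρ)) =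
        Hc.roots.map fun ρ => (2 * ‖ζ ρ‖)⁻¹ * ‖w - ζ ρ‖ * ‖w - conj (ζ ρ)‖ := by
      refine Multiset.map_congr rfl fun ρ hρ => ?_
      rw [← hfac ρ hρ]; simp
    have e1' := congrArg Multiset.prod e1
    have e2' := congrArg Multiset.prod e2
    simp only [Function.comp_def] at e1' e2' ⊢
    rw [e1', e2', Multiset.prod_map_mul, Multiset.prod_map_mul, hsym, Complex.norm_real,
      Real.norm_of_nonneg (Real.sqrt_nonneg _), mul_pow, Real.sq_sqrt hK0, hK]
    ring

theorem infinite_unit_circle : {w : ℂ | ‖w‖ = 1}.Infinite := by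
  have h := (isPreconnected_sphere (E := ℂ) (by simp) 0 1).infinite_of_nontrivial
    ⟨1, by simp, -1, by simp, by norm_num⟩
  refine h.mono fun w hw => by simpa using hw

/-- On the circle, complex conjugation is reflection of the coefficients up to the factor $w^{d+1}$.
Since the circle is infinite, `hfg` becomes a polynomial identity $f f^*+g g^*=X^{d+1}$, and its
constant coefficient is the claim. -/
theorem circle_coeff_orthogonal {f g : ℂ[X]} {d : ℕ} (hf : f.natDegree ≤ d + 1)
    (hg : g.natDegree ≤ d + 1)
    (hfg : ∀ w : ℂ, ‖w‖ = 1 → ‖f.eval w‖ ^ 2 + ‖g.eval w‖ ^ 2 = 1) :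
    f.coeff 0 * conj (f.coeff (d + 1)) + g.coeff 0 * conj (g.coeff (d + 1)) = 0 := by
  have hrefl : ∀ p : ℂ[X], p.natDegree ≤ d + 1 → ∀ w : ℂ, ‖w‖ = 1 →
      (reflect (d + 1) (p.map (starRingEnd ℂ))).eval w = w ^ (d + 1) * conj (p.eval w) := by
    intro p hp w hw
    have hw0 : w ≠ 0 := by rintro rfl; simp at hw
    have hww : w * conj w = 1 := by
      rw [Complex.mul_conj, Complex.normSq_eq_norm_sq, hw]; norm_num
    let _ : Invertible (conj w) := ⟨w, hww, by rw [mul_comm]; exact hww⟩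
    have h := Polynomial.eval₂_reflect_mul_pow (RingHom.id ℂ) (conj w) (d + 1)
      (p.map (starRingEnd ℂ)) ((Polynomial.natDegree_map_le).trans hp)
    have hinv : ⅟(conj w) = w := rfl
    rw [hinv, Polynomial.eval₂_id, Polynomial.eval₂_id, Polynomial.eval_map_apply] at h
    rw [← h, mul_comm, mul_assoc, ← mul_pow, mul_comm (conj w), hww, one_pow, mul_one]
  have hpoly : f * reflect (d + 1) (f.map (starRingEnd ℂ)) +
      g * reflect (d + 1) (g.map (starRingEnd ℂ)) = X ^ (d + 1) := by
    apply Polynomial.eq_of_infinite_eval_eq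
    refine infinite_unit_circle.mono fun w hw => ?_
    have hn : ∀ z : ℂ, z * conj z = ((‖z‖ ^ 2 : ℝ) : ℂ) := fun z => by
      rw [Complex.mul_conj, Complex.normSq_eq_norm_sq]
    have h1 : f.eval w * conj (f.eval w) + g.eval w * conj (g.eval w) = 1 := by
      rw [hn, hn, ← Complex.ofReal_add, hfg w hw, Complex.ofReal_one]
    show eval w _ = eval w _
    rw [eval_add, eval_mul, eval_mul, hrefl f hf w hw, hrefl g hg w hw, eval_pow, eval_X]
    linear_combination w ^ (d + 1) * h1
  have h0 := congrArg (fun p => p.coeff 0) hpoly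
  simpa [Polynomial.mul_coeff_zero, Polynomial.coeff_reflect, Polynomial.coeff_X_pow] using h0

/-- A unitary adapted to two orthogonal vectors of `ℂ²`. -/
theorem exists_unit_orthogonal (p q s t : ℂ) (h : p * conj s + q * conj t = 0) :
    ∃ α γ : ℂ, ‖α‖ ^ 2 + ‖γ‖ ^ 2 = 1 ∧ conj α * p + conj γ * q = 0 ∧ -γ * s + α * t = 0 := by
  have key : ∀ a c : ℂ, (a ≠ 0 ∨ c ≠ 0) → ∃ r : ℝ, ‖(r : ℂ) * a‖ ^ 2 + ‖(r : ℂ) * c‖ ^ 2 = 1 := by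
    intro a c hac
    have hpos : 0 < ‖a‖ ^ 2 + ‖c‖ ^ 2 := by
      rcases hac with h | h <;> have := norm_pos_iff.2 h <;> positivity
    refine ⟨(Real.sqrt (‖a‖ ^ 2 + ‖c‖ ^ 2))⁻¹, ?_⟩
    rw [norm_mul, norm_mul, mul_pow, mul_pow, ← mul_add, Complex.norm_real, norm_inv, inv_pow,
      Real.norm_of_nonneg (Real.sqrt_nonneg _), Real.sq_sqrt hpos.le, inv_mul_cancel₀ hpos.ne']
  by_cases h1 : s ≠ 0 ∨ t ≠ 0
  · obtain ⟨r, hr⟩ := key s t h1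
    refine ⟨r * s, r * t, hr, ?_, by ring⟩
    rw [map_mul, map_mul, Complex.conj_ofReal]
    linear_combination (r : ℂ) * h
  · push Not at h1
    by_cases h2 : -conj q ≠ 0 ∨ conj p ≠ 0
    · obtain ⟨r, hr⟩ := key _ _ h2
      refine ⟨r * -conj q, r * conj p, hr, ?_, by rw [h1.1, h1.2]; ring⟩
      simp only [map_mul, map_neg, Complex.conj_conj, Complex.conj_ofReal]
      ring
    · push Not at h2
      have hq : q = 0 := by simpa using h2.1
      have hp : p = 0 := by simpa using h2.2
      exact ⟨1, 0, by simp, by simp [hp], by simp [h1.2]⟩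

/-- The unitary with first column `(α, γ)`. -/
def columnGate (α γ : ℂ) (h : ‖α‖ ^ 2 + ‖γ‖ ^ 2 = 1) : Matrix.unitaryGroup Bool ℂ :=
  ⟨Matrix.of fun x y => if y then (if x then conj α else -conj γ) else (if x then γ else α), by
    have h1 : α * conj α + γ * conj γ = 1 := by
      rw [Complex.mul_conj, Complex.mul_conj, Complex.normSq_eq_norm_sq,
        Complex.normSq_eq_norm_sq, ← Complex.ofReal_add, h, Complex.ofReal_one]
    rw [Matrix.mem_unitaryGroup_iff]
    ext x y
    cases x <;> cases y <;> simp [Matrix.mul_apply, Matrix.star_apply]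
    · linear_combination h1
    · ring
    · ring
    · linear_combination h1⟩

/-- One layer of quantum signal processing. -/
theorem exists_signal_layer {f g : ℂ[X]} {d : ℕ} (hf : f.natDegree ≤ d + 1)
    (hg : g.natDegree ≤ d + 1)
    (hfg : ∀ w : ℂ, ‖w‖ = 1 → ‖f.eval w‖ ^ 2 + ‖g.eval w‖ ^ 2 = 1) :
    ∃ (u : Matrix.unitaryGroup Bool ℂ) (f' g' : ℂ[X]), f'.natDegree ≤ d ∧ g'.natDegree ≤ d ∧
      (∀ w : ℂ, ‖w‖ = 1 → ‖f'.eval w‖ ^ 2 + ‖g'.eval w‖ ^ 2 = 1) ∧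
      f = C (u.1 false false) * (X * f') + C (u.1 false true) * g' ∧
      g = C (u.1 true false) * (X * f') + C (u.1 true true) * g' := by
  obtain ⟨α, γ, h1, h2, h3⟩ := exists_unit_orthogonal _ _ _ _ (circle_coeff_orthogonal hf hg hfg)
  have h1' : α * conj α + γ * conj γ = 1 := by
    rw [Complex.mul_conj, Complex.mul_conj, Complex.normSq_eq_norm_sq,
      Complex.normSq_eq_norm_sq, ← Complex.ofReal_add, h1, Complex.ofReal_one]
  have hC : C α * C (conj α) + C γ * C (conj γ) = (1 : ℂ[X]) := by
    rw [← C_mul, ← C_mul, ← C_add, h1', C_1]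
  -- By the choice of `α` and `γ`, `f₁` has no constant term and `g'` has no coefficient at `d + 1`.
  -- Dividing `f₁` by `X` therefore brings both down to degree `d`.
  set f₁ : ℂ[X] := C (conj α) * f + C (conj γ) * g with hf₁
  set g' : ℂ[X] := -C γ * f + C α * g with hg'
  have hdeg : ∀ a c : ℂ, (C a * f + C c * g).natDegree ≤ d + 1 := fun a c =>
    (natDegree_add_le _ _).trans (max_le ((natDegree_C_mul_le _ _).trans hf)
      ((natDegree_C_mul_le _ _).trans hg))
  have hf₁X : f₁ = X * f₁.divX := by
    have h0 : f₁.coeff 0 = 0 := by simpa [hf₁] using h2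
    have := divX_mul_X_add f₁
    rw [h0, C_0, add_zero] at this
    rw [mul_comm]; exact this.symm
  refine ⟨columnGate α γ h1, f₁.divX, g', ?_, ?_, ?_, ?_, ?_⟩
  · rw [natDegree_divX_eq_natDegree_tsub_one]
    have := hdeg (conj α) (conj γ)
    rw [← hf₁] at this
    omega
  · have hle : g'.natDegree ≤ d + 1 := by
      have := hdeg (-γ) α
      rwa [C_neg] at this
    rw [natDegree_le_iff_coeff_eq_zero]
    intro N hN
    rcases Nat.lt_or_ge (d + 1) N with h | h
    · exact coeff_eq_zero_of_natDegree_lt (hle.trans_lt h)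
    · have : N = d + 1 := by omega
      subst this
      rw [hg', ← C_neg, coeff_add, coeff_C_mul, coeff_C_mul]
      exact h3
  · intro w hw
    have e1 : ‖f₁.divX.eval w‖ = ‖f₁.eval w‖ := by
      conv_rhs => rw [hf₁X, eval_mul, eval_X, norm_mul, hw, one_mul]
    rw [e1, ← hfg w hw]
    have hn : ∀ z : ℂ, ((‖z‖ ^ 2 : ℝ) : ℂ) = z * conj z := fun z => by
      rw [Complex.mul_conj, Complex.normSq_eq_norm_sq]
    apply Complex.ofReal_injective
    rw [Complex.ofReal_add, Complex.ofReal_add, hn, hn, hn, hn]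
    simp only [hf₁, hg', eval_add, eval_mul, eval_neg, eval_C, map_add, map_mul, map_neg,
      Complex.conj_conj]
    linear_combination (eval w f * conj (eval w f) + eval w g * conj (eval w g)) * h1'
  · rw [← hf₁X, hf₁, hg']
    simp only [columnGate, Matrix.of_apply, Bool.false_eq_true, if_false, if_true, C_neg]
    linear_combination -f * hC
  · rw [← hf₁X, hf₁, hg']
    simp only [columnGate, Matrix.of_apply, Bool.false_eq_true, if_false, if_true]
    linear_combination -g * hC

/-- The polynomial `f` of degree `q` with `z ^ q * P ((z + z⁻¹) / 2) = f (z ^ 2)`. -/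
def signalPoly (P : ℝ[X]) (q : ℕ) : ℂ[X] :=
  ∑ k ∈ Finset.range (q + 1),
    C (P.coeff k : ℂ) * (X ^ ((q - k) / 2) * (C (1 / 2) * (X + 1)) ^ k)

theorem natDegree_half_X_add_one_pow {R : Type*} [CommRing R] (r : R) (k : ℕ) :
    ((C r * (X + 1) : R[X]) ^ k).natDegree ≤ k := by
  have h1 : (X + 1 : R[X]).natDegree ≤ 1 := by
    refine (natDegree_add_le _ _).trans (max_le natDegree_X_le ?_)
    rw [natDegree_one]; norm_num
  have := natDegree_pow_le_of_le k ((natDegree_C_mul_le r (X + 1)).trans h1)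
  simpa using this

theorem natDegree_signalPoly (P : ℝ[X]) (q : ℕ) : (signalPoly P q).natDegree ≤ q := by
  refine natDegree_sum_le_of_forall_le _ _ fun k hk => ?_
  have hk' : k ≤ q := Nat.lt_succ_iff.1 (Finset.mem_range.1 hk)
  refine (natDegree_C_mul_le _ _).trans (natDegree_mul_le.trans ?_)
  have h1 := natDegree_half_X_add_one_pow (1 / 2 : ℂ) k
  have h2 := natDegree_X_pow_le (R := ℂ) ((q - k) / 2)
  omega

theorem IsCoordPoly.natDegree_eq {P : ℝ[X]} {q : ℕ} (hP : IsCoordPoly P q) : P.natDegree = q :=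
  natDegree_eq_of_degree_eq_some hP.degree_eq

/-- With $Y=(W+V)/2$ one has $WY=(W^2+1)/2$, hence $W^qY^k=W^{q-k}((W^2+1)/2)^k$, and the parity of
`P` makes $q-k$ even. A general algebra is allowed because the identity is used both for numbers on
the circle and for operators. -/
theorem aeval_signalPoly {A : Type*} [Ring A] [Algebra ℂ A] {P : ℝ[X]} {q : ℕ}
    (hP : IsCoordPoly P q) (W V : A) (hWV : W * V = 1) (hVW : V * W = 1) :
    aeval (W ^ 2) (signalPoly P q) =
      W ^ q * aeval ((1 / 2 : ℂ) • (W + V)) (P.map Complex.ofRealHom) := by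
  set Y : A := (1 / 2 : ℂ) • (W + V) with hY
  have hcomm : Commute W Y := by
    have : Commute W V := by rw [Commute, SemiconjBy, hWV, hVW]
    exact ((Commute.refl W).add_right this).smul_right _
  have hWY : W * Y = (1 / 2 : ℂ) • (W ^ 2 + 1) := by
    rw [hY, mul_smul_comm, mul_add, hWV, sq]
  have hdeg : (P.map Complex.ofRealHom).natDegree < q + 1 := by
    have := natDegree_map (p := P) Complex.ofRealHom
    rw [hP.natDegree_eq] at this
    omega
  rw [aeval_eq_sum_range' hdeg, signalPoly, map_sum, Finset.mul_sum]
  refine Finset.sum_congr rfl fun k hk => ?_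
  have hk' : k ≤ q := Nat.lt_succ_iff.1 (Finset.mem_range.1 hk)
  rw [coeff_map, mul_smul_comm, map_mul, aeval_C, ← Algebra.smul_def]
  by_cases hc : P.coeff k = 0
  · simp [hc]
  · congr 1
    have hpar := hP.parity k hc
    simp only [map_mul, map_pow, aeval_X, map_add, map_one, aeval_C, ← Algebra.smul_def]
    have h1 : q = 2 * ((q - k) / 2) + k := by omega
    conv_rhs => rw [h1, pow_add, mul_assoc, ← hcomm.mul_pow, hWY, pow_mul]

theorem exists_unit_sqrt {w : ℂ} (hw : ‖w‖ = 1) : ∃ z : ℂ, ‖z‖ = 1 ∧ z ^ 2 = w := by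
  obtain ⟨z, hz⟩ := IsAlgClosed.exists_pow_nat_eq w (n := 2) (by norm_num)
  refine ⟨z, ?_, hz⟩
  have h1 : ‖z‖ ^ 2 = 1 := by rw [← norm_pow, hz, hw]
  nlinarith [norm_nonneg z]

/-- `1 - P ^ 2` as a polynomial in `2 x ^ 2 - 1`. -/
def complementPoly (P : ℝ[X]) (q : ℕ) : ℝ[X] :=
  1 - ∑ j ∈ Finset.range (q + 1), ∑ k ∈ Finset.range (q + 1),
    C (P.coeff j * P.coeff k) * (C (1 / 2) * (X + 1)) ^ ((j + k) / 2)

theorem natDegree_complementPoly (P : ℝ[X]) (q : ℕ) : (complementPoly P q).natDegree ≤ q := by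
  refine (natDegree_sub_le _ _).trans (max_le (by simp) ?_)
  refine natDegree_sum_le_of_forall_le _ _ fun j hj =>
    natDegree_sum_le_of_forall_le _ _ fun k hk => ?_
  have hj' := Finset.mem_range.1 hj
  have hk' := Finset.mem_range.1 hk
  refine (natDegree_C_mul_le _ _).trans ?_
  have h1 := natDegree_half_X_add_one_pow (1 / 2 : ℝ) ((j + k) / 2)
  omega

/-- Any two monomials that occur in `P` have a product of even degree, and $x^2=(c+1)/2$. -/
theorem eval_complementPoly {P : ℝ[X]} {q : ℕ} (hP : IsCoordPoly P q) (x c : ℝ)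
    (hc : c = 2 * x ^ 2 - 1) : (complementPoly P q).eval c = 1 - P.eval x ^ 2 := by
  have hdeg : P.natDegree < q + 1 := by rw [hP.natDegree_eq]; omega
  rw [complementPoly, eval_sub, eval_one, sq (eval x P), eval_eq_sum_range' hdeg,
    Finset.sum_mul_sum, eval_finsetSum]
  congr 1
  refine Finset.sum_congr rfl fun j _ => ?_
  rw [eval_finsetSum]
  refine Finset.sum_congr rfl fun k _ => ?_
  by_cases hj : P.coeff j = 0
  · simp [hj]
  by_cases hk : P.coeff k = 0
  · simp [hk]
  have h1 := hP.parity j hj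
  have h2 := hP.parity k hk
  have h3 : 1 / 2 * (c + 1) = x ^ 2 := by rw [hc]; ring
  have h4 : 2 * ((j + k) / 2) = j + k := by omega
  simp only [eval_mul, eval_C, eval_pow, eval_add, eval_X, eval_one]
  rw [h3, ← pow_mul, h4, pow_add]
  ring

/-- Complementary polynomials for quantum signal processing. -/
theorem exists_signal_pair {P : ℝ[X]} {q : ℕ} (hP : IsCoordPoly P q) :
    ∃ g : ℂ[X], g.natDegree ≤ q ∧ ∀ w : ℂ, ‖w‖ = 1 →
      ‖(signalPoly P q).eval w‖ ^ 2 + ‖g.eval w‖ ^ 2 = 1 := by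
  -- At $c=2x^2-1$ the value is $1-P(x)^2$; the strict bound on $|P|$ keeps it positive, as
  -- Fejér–Riesz demands.
  obtain ⟨g, hg, hgw⟩ := exists_fejer_riesz (complementPoly P q) (by
    intro c h1 h2
    have hx : (Real.sqrt ((1 + c) / 2)) ^ 2 = (1 + c) / 2 := Real.sq_sqrt (by linarith)
    have hx0 := Real.sqrt_nonneg ((1 + c) / 2)
    rw [eval_complementPoly hP (Real.sqrt ((1 + c) / 2)) c (by rw [hx]; ring)]
    have := hP.bound (Real.sqrt ((1 + c) / 2)) ⟨by linarith, by
      rw [Real.sqrt_le_one]; linarith⟩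
    have h3 := (sq_lt_one_iff_abs_lt_one _).2 this
    linarith)
  refine ⟨g, hg.trans (natDegree_complementPoly P q), fun w hw => ?_⟩
  -- For $w=z^2$ on the circle, $\mathrm{Re}\,w=2(\mathrm{Re}\,z)^2-1$ and the signal polynomial has
  -- modulus $|P(\mathrm{Re}\,z)|$ at $w$.
  obtain ⟨z, hz, rfl⟩ := exists_unit_sqrt hw
  have hz0 : z ≠ 0 := by rintro rfl; simp at hz
  have hzz : z * conj z = 1 := by
    rw [Complex.mul_conj, Complex.normSq_eq_norm_sq, hz]; norm_num
  have h1 := aeval_signalPoly hP z (conj z) hzz (by rw [mul_comm]; exact hzz)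
  have h2 : (1 / 2 : ℂ) • (z + conj z) = ((z.re : ℝ) : ℂ) := by
    rw [Complex.add_conj]; simp
  rw [h2, coe_aeval_eq_eval, coe_aeval_eq_eval] at h1
  have h3 : eval ((z.re : ℝ) : ℂ) (P.map Complex.ofRealHom) = (P.eval z.re : ℝ) :=
    eval_map_apply (f := Complex.ofRealHom) z.re
  rw [h3] at h1
  rw [h1, norm_mul, norm_pow, hz, one_pow, one_mul, Complex.norm_real, Real.norm_eq_abs, sq_abs,
    hgw _ hw, eval_complementPoly hP z.re _ ?_]
  · ring
  · have h4 : z.re ^ 2 + z.im ^ 2 = 1 := by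
      have := Complex.normSq_eq_norm_sq z
      rw [hz, Complex.normSq_apply] at this
      linarith
    rw [sq, Complex.mul_re]
    linarith

end FejerRiesz

section Signal

open Polynomial

/-! ### Quantum signal processing -/

theorem commute_aeval {A : Type*} [Ring A] [Algebra ℂ A] {a x : A} (h : Commute a x)
    (p : ℂ[X]) : Commute a (aeval x p) := by
  induction p using Polynomial.induction_on' with
  | add p q hp hq => rw [map_add]; exact hp.add_right hq
  | monomial n c =>
    rw [aeval_monomial]
    exact (Algebra.commute_algebraMap_right c a).mul_right (h.pow_right n)

variable {ι : Type} [Fintype ι] [DecidableEq ι]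

theorem aeval_mulVec_of_eigen {Y : Op ι} {ψ : State ι} {c : ℂ} (h : Y *ᵥ ψ = c • ψ) (p : ℂ[X]) :
    aeval Y p *ᵥ ψ = p.eval c • ψ := by
  induction p using Polynomial.induction_on' with
  | add p q hp hq => rw [map_add, Matrix.add_mulVec, hp, hq, eval_add, add_smul]
  | monomial n a =>
    have hpow : ∀ n, Y ^ n *ᵥ ψ = c ^ n • ψ := by
      intro n
      induction n with
      | zero => simp
      | succ n ih =>
        rw [pow_succ, ← Matrix.mulVec_mulVec, h, Matrix.mulVec_smul, ih, smul_smul, pow_succ']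
    rw [aeval_monomial, ← Algebra.smul_def, Matrix.smul_mulVec, hpow, eval_monomial, smul_smul]

/-- The projector onto the value `b` of qubit `k`. -/
def bitProj (k : ι) (b : Bool) : Op ι := Matrix.diagonal fun x => if x k = b then 1 else 0

omit [Fintype ι] [DecidableEq ι] in
theorem dependsOn_bit (k : ι) (b : Bool) :
    DependsOn (fun x : Bits ι => if x k = b then (1 : ℂ) else 0) {k} := fun x y h => by
  simp only [h k rfl]

theorem bitProj_mulVec_apply (k : ι) (b : Bool) (ψ : State ι) (x : Bits ι) :
    (bitProj k b *ᵥ ψ) x = if x k = b then ψ x else 0 := by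
  rw [bitProj, Matrix.mulVec_diagonal]; split_ifs <;> simp

theorem bitProj_mulVec_ket {k : ι} {b : Bool} {y : Bits ι} (h : y k = b) :
    bitProj k b *ᵥ ket y = ket y := by
  rw [bitProj, diagonal_mulVec_ket, if_pos h, one_smul]

/-- Quantum signal processing: the coin `k` steers between `W` and its inverse `V`. -/
theorem exists_signal_circuit (k : ι) (W V : Op ι) (hWV : W * V = 1) (hVW : V * W = 1)
    (hW : ∀ u, Commute W (Gate.single u k).op) (hV : ∀ u, Commute V (Gate.single u k).op)
    (hWk : ∀ b, Commute W (bitProj k b)) (hVk : ∀ b, Commute V (bitProj k b))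
    (D : Circuit ι) (S : Set ι) (hk : k ∈ S) (hDS : ActsOn D S) (a b : ℕ) (hDc : Costs D a b)
    (hD0 : ∀ ψ : State ι, bitProj k false *ᵥ ψ = ψ → circuitOp D *ᵥ ψ = W *ᵥ ψ)
    (hD1 : ∀ ψ : State ι, bitProj k true *ᵥ ψ = ψ → circuitOp D *ᵥ ψ = V *ᵥ ψ)
    (d : ℕ) (f g : ℂ[X]) (hf : f.natDegree ≤ d) (hg : g.natDegree ≤ d)
    (hfg : ∀ w : ℂ, ‖w‖ = 1 → ‖f.eval w‖ ^ 2 + ‖g.eval w‖ ^ 2 = 1) :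
    ∃ C : Circuit ι, ActsOn C S ∧ Costs C (d * (a + 1) + 1) (d * b) ∧
      ∀ y, y k = false → circuitOp C *ᵥ ket y = (V ^ d * aeval (W ^ 2) f) *ᵥ ket y +
        (V ^ d * aeval (W ^ 2) g) *ᵥ ket (Function.update y k true) := by
  induction d generalizing f g with
  | zero =>
    rw [eq_C_of_natDegree_le_zero hf, eq_C_of_natDegree_le_zero hg] at hfg ⊢
    have h1 : ‖f.coeff 0‖ ^ 2 + ‖g.coeff 0‖ ^ 2 = 1 := by simpa using hfg 1 (by simp)
    refine ⟨[Gate.single (columnGate _ _ h1) k], actsOn_single _ hk,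
      (costs_single _ _).mono (by omega) (by omega), fun y hy => ?_⟩
    have hy' : Function.update y k false = y := by rw [← hy]; simp
    rw [circuitOp_singleton, single_op_mulVec_ket, Fintype.sum_bool, hy, hy', pow_zero, one_mul,
      one_mul, aeval_C, aeval_C, Algebra.algebraMap_eq_smul_one, Algebra.algebraMap_eq_smul_one,
      Matrix.smul_mulVec, Matrix.smul_mulVec, Matrix.one_mulVec, Matrix.one_mulVec, add_comm]
    simp [columnGate]
  | succ d ih =>
    obtain ⟨u, f', g', hf', hg', hfg', ef, eg⟩ := exists_signal_layer hf hg hfg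
    obtain ⟨C, sC, kC, hC⟩ := ih f' g' hf' hg' hfg'
    refine ⟨C ++ D ++ [Gate.single u k], (sC.append hDS).append (actsOn_single _ hk),
      ((kC.append hDc).append (costs_single _ _)).mono ?_ ?_, fun y hy => ?_⟩
    · linarith
    · linarith
    have hy' : Function.update y k false = y := by rw [← hy]; simp
    have hVWc : Commute V W := by rw [Commute, SemiconjBy, hWV, hVW]
    have hcomm : ∀ (B : Op ι), Commute W B → Commute V B → ∀ (n : ℕ) (p : ℂ[X]),
        Commute B (V ^ n * aeval (W ^ 2) p) := fun B h1 h2 n p =>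
      (h2.symm.pow_right n).mul_right (commute_aeval (h1.symm.pow_right 2) p)
    have hsupp : ∀ (c : Bool) (n : ℕ) (p : ℂ[X]) (z : Bits ι), z k = c →
        bitProj k c *ᵥ ((V ^ n * aeval (W ^ 2) p) *ᵥ ket z) =
          (V ^ n * aeval (W ^ 2) p) *ᵥ ket z := by
      intro c n p z hz
      rw [Matrix.mulVec_mulVec, (hcomm _ (hWk c) (hVk c) n p).eq, ← Matrix.mulVec_mulVec,
        bitProj_mulVec_ket hz]
    rw [circuitOp_append_mulVec, circuitOp_append_mulVec, hC y hy, Matrix.mulVec_add,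
      hD0 _ (hsupp false d f' y hy), hD1 _ (hsupp true d g' _ (by simp)), Matrix.mulVec_mulVec,
      Matrix.mulVec_mulVec]
    -- On coin 0 the layer applies $W$, and $WV^d=V^{d+1}W^2$ turns this into multiplication of `f'`
    -- by `X`; on coin 1 it applies $V$ and leaves `g'` alone. The gate `u` then recombines the two
    -- as in `exists_signal_layer`.
    have hpw : V ^ (d + 1) * W ^ 2 = W * V ^ d := by
      rw [pow_succ V d, sq W, ← mul_assoc, mul_assoc (V ^ d) V W, hVW, mul_one,
        (hVWc.symm.pow_right d).eq]
    have e1 : W * (V ^ d * aeval (W ^ 2) f') = V ^ (d + 1) * aeval (W ^ 2) (X * f') := by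
      rw [map_mul, aeval_X, ← mul_assoc, ← mul_assoc, hpw]
    have e2 : V * (V ^ d * aeval (W ^ 2) g') = V ^ (d + 1) * aeval (W ^ 2) g' := by
      rw [← mul_assoc, ← pow_succ']
    have e3 : ∀ (p : ℂ[X]) (z : Bits ι),
        (Gate.single u k).op *ᵥ ((V ^ (d + 1) * aeval (W ^ 2) p) *ᵥ ket z) =
          (V ^ (d + 1) * aeval (W ^ 2) p) *ᵥ ((Gate.single u k).op *ᵥ ket z) := by
      intro p z
      rw [Matrix.mulVec_mulVec, (hcomm _ (hW u) (hV u) (d + 1) p).eq, ← Matrix.mulVec_mulVec]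
    rw [e1, e2, circuitOp_singleton, Matrix.mulVec_add, e3, e3,
      single_op_mulVec_ket, single_op_mulVec_ket]
    simp only [Fintype.sum_bool, Function.update_self, Function.update_idem, hy, hy']
    rw [ef, eg]
    simp only [map_add, map_mul, aeval_C, Algebra.algebraMap_eq_smul_one, mul_add, smul_mul_assoc,
      one_mul, mul_smul_comm, Matrix.add_mulVec, Matrix.smul_mulVec, Matrix.mulVec_add,
      Matrix.mulVec_smul, aeval_X]
    abel

/-- Polynomials of a block-encoded diagonal operator: if `U` is a reflection that block-encodes
`diag ξ` with respect to the zero state of the qubits `w :: ws`, then a circuit block-encodes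
`diag (P ∘ ξ)`, the coin `k` flagging the failure. -/
theorem exists_polynomial_of_reflection {P : ℝ[X]} {q : ℕ} (hP : IsCoordPoly P q) (k w : ι)
    (ws : List ι) (hws : (k :: w :: ws).Nodup) (U : Circuit ι) (S : Set ι) (hUS : ActsOn U S)
    (hkS : k ∉ S) (a b : ℕ) (hUc : Costs U a b) (hUU : circuitOp U * circuitOp U = 1)
    (ξ : Bits ι → ℝ) (hξ : ∀ y, (∀ v ∈ w :: ws, y v = false) →
      ∀ x, (∀ v ∈ w :: ws, x v = false) → circuitOp U x y = if x = y then (ξ y : ℂ) else 0) :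
    ∃ C : Circuit ι, ActsOn C (S ∪ {v | v ∈ k :: w :: ws}) ∧
      Costs C (q * (a + 2 * 2 ^ (ws.length + 2) + 1) + 1) (q * (b + 2 * 2 ^ (ws.length + 3))) ∧
      ∀ y, y k = false → (∀ v ∈ w :: ws, y v = false) → ∃ bot : State ι,
        (∀ x, x k = false → bot x = 0) ∧
        circuitOp C *ᵥ ket y = ((P.eval (ξ y) : ℝ) : ℂ) • ket y + bot := by
  classical
  set r : Bits ι → ℂ := fun x => if ∀ v ∈ w :: ws, x v = false then 1 else -1 with hr
  have hrd : DependsOn r {v | v ∈ w :: ws} := by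
    intro x y h
    have : (∀ v ∈ w :: ws, x v = false) ↔ (∀ v ∈ w :: ws, y v = false) :=
      forall₂_congr fun v hv => by rw [h v hv]
    simp only [hr, this]
  have hkws : k ∉ w :: ws := (List.nodup_cons.1 hws).1
  set R : Op ι := Matrix.diagonal r with hR
  have hRR : R * R = 1 := by
    rw [hR, Matrix.diagonal_mul_diagonal, ← Matrix.diagonal_one]
    congr 1; ext x; simp only [hr]; split_ifs <;> norm_num
  have hrefl : ∀ c : Bool, ∃ Q : Circuit ι, circuitOp Q = Matrix.diagonal (fun x =>
      if x k = c then r x else 1) ∧ ActsOn Q {v | v ∈ k :: w :: ws} ∧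
      Costs Q (2 ^ (ws.length + 2)) (2 ^ (ws.length + 3)) := by
    intro c
    obtain ⟨Q, hQ, sQ, kQ⟩ := exists_diagonal k (w :: ws) hws
      (fun x => if x k = c ∧ ¬ (∀ v ∈ w :: ws, x v = false) then Real.pi else 0) (by
        intro x y h
        have h1 : (∀ v ∈ w :: ws, x v = false) ↔ (∀ v ∈ w :: ws, y v = false) :=
          forall₂_congr fun v hv => by rw [h v (List.mem_cons_of_mem _ hv)]
        have h2 : x k = y k := h k (by simp)
        simp only [h1, h2])
    refine ⟨Q, ?_, sQ, by simpa using kQ⟩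
    rw [hQ]
    congr 1
    ext x
    have hpi : Complex.exp (Complex.I * (Real.pi : ℂ)) = -1 := by
      rw [mul_comm]; exact Complex.exp_pi_mul_I
    simp only [hr]
    by_cases h1 : x k = c
    · by_cases h2 : ∀ v ∈ w :: ws, x v = false
      · rw [if_neg (fun h => h.2 h2), if_pos h1, if_pos h2]; simp
      · rw [if_pos ⟨h1, h2⟩, if_pos h1, if_neg h2, hpi]
    · rw [if_neg (fun h => h1 h.1), if_neg h1]; simp
  obtain ⟨Q₀, hQ₀, sQ₀, kQ₀⟩ := hrefl false
  obtain ⟨Q₁, hQ₁, sQ₁, kQ₁⟩ := hrefl true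
  set M : Op ι := circuitOp U with hM
  have hMk : ∀ c, Commute M (bitProj k c) := fun c =>
    hUS.commute_diagonal (dependsOn_bit k c) (Set.disjoint_singleton_right.2 hkS)
  have hMu : ∀ u, Commute M (Gate.single u k).op := fun u => hUS.commute_single u hkS
  have hRk : ∀ c, Commute R (bitProj k c) := fun c => Matrix.commute_diagonal _ _
  have hRu : ∀ u, Commute R (Gate.single u k).op := fun u => by
    have := (actsOn_single u (S := {k}) rfl).commute_diagonal hrd
      (Set.disjoint_singleton_left.2 (by simpa using hkws))
    rw [circuitOp_singleton] at this
    exact this.symm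
  have hQ : ∀ (c : Bool) (Q : Circuit ι), circuitOp Q = Matrix.diagonal (fun x =>
      if x k = c then r x else 1) → ∀ ψ : State ι,
      (bitProj k c *ᵥ ψ = ψ → circuitOp Q *ᵥ ψ = R *ᵥ ψ) ∧
      (bitProj k (!c) *ᵥ ψ = ψ → circuitOp Q *ᵥ ψ = ψ) := by
    intro c Q hQ ψ
    constructor
    · intro h
      ext x
      have h1 := congrFun h x
      rw [bitProj_mulVec_apply] at h1
      rw [hQ, hR, Matrix.mulVec_diagonal, Matrix.mulVec_diagonal]
      split_ifs with h2
      · rfl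
      · rw [if_neg h2] at h1; simp [← h1]
    · intro h
      ext x
      have h1 := congrFun h x
      rw [bitProj_mulVec_apply] at h1
      rw [hQ, Matrix.mulVec_diagonal]
      split_ifs with h2
      · rw [if_neg (by rw [h2]; simp)] at h1; simp [← h1]
      · simp
  have hMs : ∀ (c : Bool) (ψ : State ι), bitProj k c *ᵥ ψ = ψ →
      bitProj k c *ᵥ (M *ᵥ ψ) = M *ᵥ ψ := by
    intro c ψ h
    rw [Matrix.mulVec_mulVec, ← (hMk c).eq, ← Matrix.mulVec_mulVec, h]
  have hRs : ∀ (c : Bool) (ψ : State ι), bitProj k c *ᵥ ψ = ψ →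
      bitProj k c *ᵥ (R *ᵥ ψ) = R *ᵥ ψ := by
    intro c ψ h
    rw [Matrix.mulVec_mulVec, ← (hRk c).eq, ← Matrix.mulVec_mulVec, h]
  obtain ⟨g, hg, hfg⟩ := exists_signal_pair hP
  have hWV : (R * M) * (M * R) = 1 := by
    rw [mul_assoc, ← mul_assoc M M, hUU, one_mul, hRR]
  have hVW : (M * R) * (R * M) = 1 := by
    rw [mul_assoc, ← mul_assoc R R, hRR, one_mul, hUU]
  have hsub : {v | v ∈ k :: w :: ws} ⊆ S ∪ {v | v ∈ k :: w :: ws} := Set.subset_union_right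
  -- Only the reflections are controlled by the coin, `U` is not: `Q₁`, `U`, `Q₀` act as $RM$ on
  -- coin 0 and as $MR$ on coin 1. These are mutually inverse because $R$ and $M$ are involutions.
  obtain ⟨C, sC, kC, hC⟩ := exists_signal_circuit k (R * M) (M * R) hWV hVW
    (fun u => (hRu u).mul_left (hMu u)) (fun u => (hMu u).mul_left (hRu u))
    (fun c => (hRk c).mul_left (hMk c)) (fun c => (hMk c).mul_left (hRk c))
    (Q₁ ++ U ++ Q₀) (S ∪ {v | v ∈ k :: w :: ws}) (by right; simp)
    (((sQ₁.mono hsub).append (hUS.mono Set.subset_union_left)).append (sQ₀.mono hsub)) _ _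
    ((kQ₁.append hUc).append kQ₀)
    (by
      intro ψ h
      rw [circuitOp_append_mulVec, circuitOp_append_mulVec, (hQ true Q₁ hQ₁ ψ).2 h,
        (hQ false Q₀ hQ₀ _).1 (hMs _ _ h), Matrix.mulVec_mulVec])
    (by
      intro ψ h
      rw [circuitOp_append_mulVec, circuitOp_append_mulVec, (hQ true Q₁ hQ₁ ψ).1 h,
        (hQ false Q₀ hQ₀ _).2 (hMs _ _ (hRs _ _ h)), Matrix.mulVec_mulVec])
    q (signalPoly P q) g (natDegree_signalPoly P q) hg hfg
  refine ⟨C, sC, kC.mono (le_of_eq (by ring)) (le_of_eq (by ring)), fun y hy hyw => ?_⟩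
  refine ⟨_, ?_, (hC y hy).trans (congrArg₂ (· + ·) ?_ rfl)⟩
  · intro x hx
    have hcomm : Commute (bitProj k true) ((M * R) ^ q * aeval ((R * M) ^ 2) g) :=
      ((((hMk true).mul_left (hRk true)).symm.pow_right q).mul_right
        (commute_aeval (((hRk true).mul_left (hMk true)).symm.pow_right 2) g))
    have h1 := congrArg (fun B : Op ι => (B *ᵥ ket (Function.update y k true)) x) hcomm.eq
    simp only [← Matrix.mulVec_mulVec] at h1
    rw [bitProj_mulVec_apply, bitProj_mulVec_ket (by simp), if_neg (by simp [hx])] at h1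
    rw [← Matrix.mulVec_mulVec]
    exact h1.symm
  · rw [aeval_signalPoly hP _ _ hWV hVW, ← mul_assoc]
    have h1 : (M * R) ^ q * (R * M) ^ q = 1 := by
      have hc : Commute (M * R) (R * M) := by rw [Commute, SemiconjBy, hWV, hVW]
      rw [← hc.mul_pow, hVW, one_pow]
    rw [h1, one_mul]
    -- $R$ fixes `ket y`, so the average acts on it as $\frac12(R+1)M$, and $\frac12(R+1)$ is the
    -- projector onto the zero state of `w :: ws`.
    have heig : ((1 / 2 : ℂ) • (R * M + M * R)) *ᵥ ket y = (ξ y : ℂ) • (ket y : State ι) := by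
      have hry : R *ᵥ ket y = ket y := by
        rw [hR, diagonal_mulVec_ket]
        simp only [hr]
        rw [if_pos hyw, one_smul]
      rw [Matrix.smul_mulVec, Matrix.add_mulVec, ← Matrix.mulVec_mulVec, ← Matrix.mulVec_mulVec,
        hry]
      ext x
      simp only [Pi.smul_apply, Pi.add_apply, smul_eq_mul]
      rw [hR, Matrix.mulVec_diagonal, mulVec_ket]
      simp only [hr, ket_apply]
      by_cases hx : ∀ v ∈ w :: ws, x v = false
      · rw [if_pos hx, hξ y hyw x hx]
        split_ifs <;> ring
      · rw [if_neg hx, if_neg (fun e : x = y => hx (by rw [e]; exact hyw))]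
        ring
    rw [aeval_mulVec_of_eigen heig]
    congr 1
    exact eval_map_apply (f := Complex.ofRealHom) (ξ y)

/-- Linear combination of diagonal signs, as a block-encoding reflection. -/
theorem exists_reflection (ws : List ι) (hws : ws.Nodup) (ω : Bits ι → ℝ) (hω : ∀ x, 0 ≤ ω x)
    (hωd : DependsOn ω {v | v ∈ ws})
    (hsum : ∀ y : Bits ι, (∑ x : Bits ι, if ∀ i, i ∉ ws → x i = y i then ω x else 0) = 1)
    (Q : Circuit ι) (sgn : Bits ι → ℝ) (hsgn : ∀ x, sgn x ^ 2 = 1)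
    (hQ : circuitOp Q = Matrix.diagonal fun x => (sgn x : ℂ)) (S : Set ι) (hQS : ActsOn Q S)
    (a b : ℕ) (hQc : Costs Q a b) :
    ∃ U : Circuit ι, ActsOn U (S ∪ {v | v ∈ ws}) ∧
      Costs U (a + 8 * 2 ^ ws.length) (b + 8 * 2 ^ ws.length) ∧ circuitOp U * circuitOp U = 1 ∧
      ∀ y, (∀ v ∈ ws, y v = false) → ∀ x, (∀ v ∈ ws, x v = false) → circuitOp U x y = if x = y then
        ((∑ z, if ∀ i, i ∉ ws → z i = y i then ω z * sgn z else 0 : ℝ) : ℂ) else 0 := by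
  classical
  obtain ⟨V, v, sV, kV, hv, hV⟩ := exists_prepare ws hws ω hω hωd hsum
  -- $V^*QV$ is an involution because the sign matrix $Q$ is one, and its block on the zero state is
  -- the mean of the signs with weights $|v|^2=\omega$.
  have hop : circuitOp (V ++ Q ++ circuitInv V) =
      star (circuitOp V) * circuitOp Q * circuitOp V := by
    rw [circuitOp_append, circuitOp_append, circuitOp_inv, mul_assoc]
  have hQQ : circuitOp Q * circuitOp Q = 1 := by
    rw [hQ, Matrix.diagonal_mul_diagonal, ← Matrix.diagonal_one]
    congr 1; ext x; rw [← Complex.ofReal_mul, ← sq, hsgn, Complex.ofReal_one]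
  refine ⟨V ++ Q ++ circuitInv V, ((sV.mono Set.subset_union_right).append
    (hQS.mono Set.subset_union_left)).append (sV.inv.mono Set.subset_union_right),
    ((kV.append hQc).append kV.inv).mono (by omega) (by omega), ?_, ?_⟩
  · have h1 := circuitOp_mul_star V
    have h2 := star_circuitOp_mul V
    rw [hop]
    calc star (circuitOp V) * circuitOp Q * circuitOp V *
          (star (circuitOp V) * circuitOp Q * circuitOp V)
        = star (circuitOp V) * (circuitOp Q * (circuitOp V * star (circuitOp V)) * circuitOp Q) *
          circuitOp V := by noncomm_ring
      _ = 1 := by rw [h1, mul_one, hQQ, mul_one, h2]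
  · intro y hy x hx
    have hVe : ∀ y, (∀ w ∈ ws, y w = false) → ∀ z, circuitOp V z y =
        if ∀ i, i ∉ ws → z i = y i then v z else 0 := by
      intro y hy z
      have := congrFun (hV y hy) z
      rwa [mulVec_ket] at this
    rw [hop, Matrix.mul_apply]
    simp only [hQ, Matrix.mul_diagonal, Matrix.star_apply, hVe y hy, hVe x hx]
    by_cases hxy : x = y
    · subst hxy
      rw [if_pos rfl, Complex.ofReal_sum]
      refine Finset.sum_congr rfl fun z _ => ?_
      split_ifs
      · rw [← hv z]
        have : star (v z) * v z = ((‖v z‖ ^ 2 : ℝ) : ℂ) := by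
          rw [Complex.star_def, mul_comm, Complex.mul_conj, Complex.normSq_eq_norm_sq]
        rw [Complex.ofReal_mul, ← this]
        ring
      · simp
    · rw [if_neg hxy]
      refine Finset.sum_eq_zero fun z _ => ?_
      by_cases h1 : ∀ i, i ∉ ws → z i = x i
      · by_cases h2 : ∀ i, i ∉ ws → z i = y i
        · exfalso
          apply hxy
          ext i
          by_cases hi : i ∈ ws
          · rw [hx i hi, hy i hi]
          · rw [← h1 i hi, ← h2 i hi]
        · rw [if_neg h2, mul_zero]
      · rw [if_neg h1]; simp

end Signal

section Coordinate

open Polynomial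

variable {ι : Type} [Fintype ι] [DecidableEq ι]

/-! ### The coordinate oracle -/

omit [Fintype ι] [DecidableEq ι] in
theorem numOn_ofFn (y : Bits ι) {n : ℕ} (cols : Fin n → ι) :
    numOn y (List.ofFn cols) = ∑ t, (y (cols t)).toNat * 2 ^ (t : ℕ) := by
  induction n with
  | zero => simp [numOn]
  | succ n ih =>
    rw [List.ofFn_succ, numOn, ih, Fin.sum_univ_succ, Finset.mul_sum]
    congr 1
    · simp
    · refine Finset.sum_congr rfl fun t _ => ?_
      simp only [Fin.val_succ, pow_succ]
      ring

theorem sum_range_two_mul (F : ℕ → ℝ) (m : ℕ) :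
    ∑ u ∈ Finset.range (2 * m), F u = ∑ u ∈ Finset.range m, (F (2 * u) + F (1 + 2 * u)) := by
  induction m with
  | zero => simp
  | succ m ih =>
    rw [mul_add, mul_one, Finset.sum_range_succ, Finset.sum_range_succ, ih, Finset.sum_range_succ,
      add_comm (2 * m) 1]
    ring

/-- Converts weights indexed by bit strings of the selection register into weights indexed by
numbers. The list starts with the lowest digit, hence the pairing of even and odd numbers in
`sum_range_two_mul`. -/
theorem sum_agree_numOn (ws : List ι) (hws : ws.Nodup) (y : Bits ι) (F : ℕ → ℝ) :
    (∑ x : Bits ι, if ∀ i, i ∉ ws → x i = y i then F (numOn x ws) else 0) =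
      ∑ u ∈ Finset.range (2 ^ ws.length), F u := by
  induction ws generalizing F with
  | nil =>
    have e : ∀ z : Bits ι, (∀ i, i ∉ ([] : List ι) → z i = y i) ↔ z = y := by
      simp [funext_iff]
    simp only [e]
    simp [numOn]
  | cons w ws ih =>
    have hw : w ∉ ws := (List.nodup_cons.1 hws).1
    rw [sum_agree_cons w ws hw y (fun x => F (numOn x (w :: ws))), List.length_cons, pow_succ',
      sum_range_two_mul, ← ih (List.nodup_cons.1 hws).2 (fun u => F (2 * u) + F (1 + 2 * u))]
    refine Finset.sum_congr rfl fun x _ => ?_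
    have h : ∀ b, numOn (Function.update x w b) ws = numOn x ws := fun b =>
      numOn_congr fun v hv => by
        have : v ≠ w := fun e => hw (e ▸ hv)
        simp [this]
    simp only [numOn, h, Function.update_self, Bool.toNat_false, Bool.toNat_true, zero_add]

/-- The weights of the linear combination of signs that represents the coordinate. -/
def coordWeight (n : ℕ) (a b : ℝ) : ℕ → ℝ
  | 0 => (1 + a) / 2
  | 1 => (1 - b) / 2
  | t + 2 => if t < n then gridStep n a b * 2 ^ t / 2 else 0

theorem gridStep_nonneg (n : ℕ) {a b : ℝ} (hab : a < b) : 0 ≤ gridStep n a b := by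
  have : (1 : ℝ) ≤ 2 ^ n := one_le_pow₀ (by norm_num)
  exact div_nonneg (by linarith) (by linarith)

theorem gridStep_mul {n : ℕ} (hn : 1 ≤ n) (a b : ℝ) : gridStep n a b * (2 ^ n - 1) = b - a := by
  have : (1 : ℝ) < 2 ^ n := one_lt_pow₀ (by norm_num) (by omega)
  rw [gridStep, div_mul_cancel₀]
  linarith

theorem coordWeight_nonneg (n : ℕ) {a b : ℝ} (ha : -1 ≤ a) (hab : a < b) (hb : b ≤ 1) (u : ℕ) :
    0 ≤ coordWeight n a b u := by
  match u with
  | 0 => simp only [coordWeight]; linarith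
  | 1 => simp only [coordWeight]; linarith
  | t + 2 =>
    simp only [coordWeight]
    have := gridStep_nonneg n hab
    split_ifs <;> positivity

theorem sum_coordWeight_mul {n : ℕ} (a b : ℝ) {N : ℕ} (hN : n + 2 ≤ N) (σ : ℕ → ℝ) :
    ∑ u ∈ Finset.range N, coordWeight n a b u * σ u =
      (1 + a) / 2 * σ 0 + (1 - b) / 2 * σ 1 +
        ∑ t : Fin n, gridStep n a b * 2 ^ (t : ℕ) / 2 * σ (t + 2) := by
  have h1 : ∑ u ∈ Finset.range (n + 2), coordWeight n a b u * σ u =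
      ∑ u ∈ Finset.range N, coordWeight n a b u * σ u := by
    refine Finset.sum_subset (fun u hu => ?_) fun u _ hu => ?_
    · simp only [Finset.mem_range] at *; omega
    · simp only [Finset.mem_range, not_lt] at hu
      obtain ⟨t, rfl⟩ : ∃ t, u = t + 2 := ⟨u - 2, by omega⟩
      simp only [coordWeight]
      rw [if_neg (by omega), zero_mul]
  rw [← h1, Finset.sum_range_succ', Finset.sum_range_succ', Finset.sum_range]
  have h2 : ∀ t : Fin n, coordWeight n a b (t + 1 + 1) * σ (t + 1 + 1) =
      gridStep n a b * 2 ^ (t : ℕ) / 2 * σ (t + 2) := by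
    intro t
    show coordWeight n a b (t + 2) * σ (t + 2) = _
    simp only [coordWeight]
    rw [if_pos t.2]
  rw [Finset.sum_congr rfl fun t _ => h2 t]
  simp only [coordWeight, zero_add]
  ring

theorem sum_two_pow_real (n : ℕ) : ∑ t : Fin n, (2 : ℝ) ^ (t : ℕ) = 2 ^ n - 1 := by
  rw [Fin.sum_univ_eq_sum_range (fun t => (2 : ℝ) ^ t), geom_sum_eq (by norm_num)]
  norm_num

/-- The coordinate of the grid point whose index is written on the qubits `cols`. -/
def coordOn (n : ℕ) (a b : ℝ) (cols : Fin n → ι) (y : Bits ι) : ℝ :=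
  a + numOn y (List.ofFn cols) * gridStep n a b

omit [Fintype ι] [DecidableEq ι] in
theorem dependsOn_coordOn (n : ℕ) (a b : ℝ) (cols : Fin n → ι) :
    DependsOn (coordOn n a b cols) {v | v ∈ List.ofFn cols} := fun x y h => by
  simp only [coordOn]
  rw [numOn_congr h]

omit [Fintype ι] [DecidableEq ι] in
theorem coordOn_mem {n : ℕ} (hn : 1 ≤ n) {a b : ℝ} (ha : -1 ≤ a) (hab : a < b) (hb : b ≤ 1)
    (cols : Fin n → ι) (y : Bits ι) : coordOn n a b cols y ∈ Set.Icc (-1 : ℝ) 1 := by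
  have h0 := gridStep_nonneg n hab
  have h1 := gridStep_mul hn a b
  have h2 : (numOn y (List.ofFn cols) : ℝ) ≤ 2 ^ n - 1 := by
    have := numOn_lt y (List.ofFn cols)
    rw [List.length_ofFn] at this
    have h3 : (numOn y (List.ofFn cols) : ℝ) + 1 ≤ 2 ^ n := by exact_mod_cast this
    linarith
  have h3 : (0 : ℝ) ≤ numOn y (List.ofFn cols) := Nat.cast_nonneg _
  simp only [coordOn, Set.mem_Icc]
  constructor
  · nlinarith
  · nlinarith

/-- The signs of the linear combination, for the selected summand `u`. -/
def coordSign {n : ℕ} (cols : Fin n → ι) (x : Bits ι) (u : ℕ) : ℝ :=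
  (if u = 1 then -1 else 1) * ∏ t : Fin n, if u = t + 2 ∧ x (cols t) = false then (-1 : ℝ) else 1

omit [Fintype ι] [DecidableEq ι] in
theorem coordSign_add_two {n : ℕ} (cols : Fin n → ι) (x : Bits ι) (t : Fin n) :
    coordSign cols x (t + 2) = if x (cols t) = false then -1 else 1 := by
  rw [coordSign, if_neg (by omega), one_mul, Finset.prod_eq_single t]
  · simp
  · intro t' _ ht'
    rw [if_neg]
    rintro ⟨h, _⟩
    exact ht' (Fin.ext (by omega))
  · simp

omit [Fintype ι] [DecidableEq ι] in
theorem coordSign_sq {n : ℕ} (cols : Fin n → ι) (x : Bits ι) (u : ℕ) :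
    coordSign cols x u ^ 2 = 1 := by
  rw [coordSign, mul_pow, ← Finset.prod_pow, Finset.prod_eq_one, mul_one]
  · split_ifs <;> norm_num
  · intro t _; split_ifs <;> norm_num

omit [Fintype ι] [DecidableEq ι] in
-- A digit is $d=\frac12(1+(2d-1))$, so the coordinate equals $\frac{a+b}2+\sum_t\frac12 2^t\Delta
-- x\,(2d_t-1)$. The constant is split as $\frac{1+a}2-\frac{1-b}2$, which keeps all weights
-- non-negative and makes their sum exactly 1.
theorem sum_coordWeight_coordSign {n : ℕ} (hn : 1 ≤ n) (a b : ℝ) {N : ℕ} (hN : n + 2 ≤ N)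
    (cols : Fin n → ι) (y : Bits ι) :
    ∑ u ∈ Finset.range N, coordWeight n a b u * coordSign cols y u = coordOn n a b cols y := by
  rw [sum_coordWeight_mul a b hN]
  have h0 : coordSign cols y 0 = 1 := by simp [coordSign]
  have h1 : coordSign cols y 1 = -1 := by
    rw [coordSign, Finset.prod_eq_one]
    · simp
    · intro t _; rw [if_neg]; rintro ⟨h, _⟩; omega
  have h2 : ∀ t : Fin n, gridStep n a b * 2 ^ (t : ℕ) / 2 * coordSign cols y (t + 2) =
      gridStep n a b * (((y (cols t)).toNat * 2 ^ (t : ℕ) : ℕ) : ℝ) -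
        gridStep n a b / 2 * 2 ^ (t : ℕ) := by
    intro t
    rw [coordSign_add_two]
    cases y (cols t)
    · simp; ring
    · simp; ring
  simp only [h2]
  rw [Finset.sum_sub_distrib, ← Finset.mul_sum, ← Finset.mul_sum, sum_two_pow_real, h0, h1,
    coordOn, numOn_ofFn, ← Nat.cast_sum]
  linear_combination (-1 / 2 : ℝ) * gridStep_mul hn a b

/-- Every factor of the sign involves the selection register and at most one column digit, so $n+1$
small diagonals suffice, whereas one diagonal on all columns would be exponential in `n`. -/
theorem exists_coord_select {n : ℕ} (w : ι) (ws : List ι) (cols : Fin n → ι)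
    (hws : (w :: ws).Nodup) (hcols : ∀ t, cols t ∉ w :: ws) :
    ∃ Q : Circuit ι, circuitOp Q = Matrix.diagonal (fun x =>
        ((coordSign cols x (numOn x (w :: ws)) : ℝ) : ℂ)) ∧
      ActsOn Q ({v | v ∈ w :: ws} ∪ Set.range cols) ∧
      Costs Q ((n + 1) * 2 ^ (ws.length + 2)) ((n + 1) * 2 ^ (ws.length + 3)) := by
  have hpi : Complex.exp (Complex.I * (Real.pi : ℂ)) = -1 := by
    rw [mul_comm]; exact Complex.exp_pi_mul_I
  have key : ∀ T : Finset (Fin n), ∃ Q : Circuit ι, circuitOp Q = Matrix.diagonal (fun x =>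
        ((∏ t ∈ T, if numOn x (w :: ws) = t + 2 ∧ x (cols t) = false then (-1 : ℝ) else 1 : ℝ) : ℂ))
      ∧ ActsOn Q ({v | v ∈ w :: ws} ∪ Set.range cols) ∧
      Costs Q (T.card * 2 ^ (ws.length + 2)) (T.card * 2 ^ (ws.length + 3)) := by
    intro T
    induction T using Finset.induction_on with
    | empty => exact ⟨[], by simp [circuitOp], actsOn_nil _, costs_nil.mono (by simp) (by simp)⟩
    | insert t T ht ih =>
      obtain ⟨Q, hQ, sQ, kQ⟩ := ih
      obtain ⟨D, hD, sD, kD⟩ := exists_diagonal (cols t) (w :: ws)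
        (List.nodup_cons.2 ⟨hcols t, hws⟩)
        (fun x => if numOn x (w :: ws) = t + 2 ∧ x (cols t) = false then Real.pi else 0) (by
          intro x y h
          have h1 : numOn x (w :: ws) = numOn y (w :: ws) :=
            numOn_congr fun v hv => h v (List.mem_cons_of_mem _ hv)
          have h2 : x (cols t) = y (cols t) := h _ (by simp)
          simp only [h1, h2])
      refine ⟨Q ++ D, ?_, sQ.append (sD.mono ?_), (kQ.append kD).mono ?_ ?_⟩
      · rw [circuitOp_append, hD, hQ, Matrix.diagonal_mul_diagonal]
        congr 1
        ext x
        rw [Finset.prod_insert ht, Complex.ofReal_mul]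
        congr 1
        split_ifs
        · rw [hpi]; simp
        · simp
      · intro v hv
        rcases List.mem_cons.1 hv with rfl | hv
        · exact Or.inr ⟨t, rfl⟩
        · exact Or.inl hv
      · rw [Finset.card_insert_of_notMem ht, add_mul, one_mul, List.length_cons]
      · rw [Finset.card_insert_of_notMem ht, add_mul, one_mul, List.length_cons]
  obtain ⟨Q, hQ, sQ, kQ⟩ := key Finset.univ
  obtain ⟨D, hD, sD, kD⟩ := exists_diagonal w ws hws
    (fun x => if numOn x (w :: ws) = 1 then Real.pi else 0) (by
      intro x y h
      simp only [numOn_congr h])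
  refine ⟨Q ++ D, ?_, sQ.append (sD.mono Set.subset_union_left), (kQ.append kD).mono ?_ ?_⟩
  · rw [circuitOp_append, hD, hQ, Matrix.diagonal_mul_diagonal]
    congr 1
    ext x
    rw [coordSign, Complex.ofReal_mul]
    congr 1
    split_ifs
    · rw [hpi]; simp
    · simp
  · rw [Finset.card_univ, Fintype.card_fin, add_mul, one_mul]
    have : 2 ^ (ws.length + 1) ≤ 2 ^ (ws.length + 2) := Nat.pow_le_pow_right (by norm_num) (by omega)
    omega
  · rw [Finset.card_univ, Fintype.card_fin, add_mul, one_mul]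
    have : 2 ^ (ws.length + 2) ≤ 2 ^ (ws.length + 3) := Nat.pow_le_pow_right (by norm_num) (by omega)
    omega

/-- The coordinate-polynomial oracle by quantum signal processing; the qubits `w :: ws` are the
selection register. -/
theorem exists_coord_oracle_of_select {P : ℝ[X]} {q : ℕ} (hP : IsCoordPoly P q) {n : ℕ}
    (hn : 1 ≤ n) {a b : ℝ} (ha : -1 ≤ a) (hab : a < b) (hb : b ≤ 1) (k w : ι) (ws : List ι)
    (hws : (k :: w :: ws).Nodup) (cols : Fin n → ι) (hcols : ∀ t, cols t ∉ k :: w :: ws)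
    (hlen : n + 2 ≤ 2 ^ (ws.length + 1)) :
    ∃ C : Circuit ι, ActsOn C ({v | v ∈ k :: w :: ws} ∪ Set.range cols) ∧
      Costs C (q * ((n + 7) * 2 ^ (ws.length + 2) + 1) + 1)
        (q * ((n + 5) * 2 ^ (ws.length + 3))) ∧
      ∀ y, y k = false → (∀ v ∈ w :: ws, y v = false) → ∃ bot : State ι,
        (∀ x, x k = false → bot x = 0) ∧
        circuitOp C *ᵥ ket y = ((P.eval (coordOn n a b cols y) : ℝ) : ℂ) • ket y + bot := by
  have hws' := (List.nodup_cons.1 hws).2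
  have hk := (List.nodup_cons.1 hws).1
  have hcols' : ∀ t, cols t ∉ w :: ws := fun t h => hcols t (List.mem_cons_of_mem _ h)
  obtain ⟨Q, hQ, sQ, kQ⟩ := exists_coord_select w ws cols hws' hcols'
  have hsum : ∀ y : Bits ι, (∑ x : Bits ι, if ∀ i, i ∉ w :: ws → x i = y i then
      coordWeight n a b (numOn x (w :: ws)) else 0) = 1 := by
    intro y
    rw [sum_agree_numOn _ hws']
    have h1 := sum_coordWeight_mul (n := n) a b hlen (fun _ => 1)
    simp only [mul_one] at h1
    have h2 : ∑ t : Fin n, gridStep n a b * 2 ^ (t : ℕ) / 2 =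
        gridStep n a b / 2 * ∑ t : Fin n, (2 : ℝ) ^ (t : ℕ) := by
      rw [Finset.mul_sum]; exact Finset.sum_congr rfl fun t _ => by ring
    rw [List.length_cons, h1, h2, sum_two_pow_real]
    linear_combination (1 / 2 : ℝ) * gridStep_mul hn a b
  obtain ⟨U, sU, kU, hUU, hU⟩ := exists_reflection (w :: ws) hws'
    (fun x => coordWeight n a b (numOn x (w :: ws)))
    (fun x => coordWeight_nonneg n ha hab hb _)
    (fun x y h => by simp only [numOn_congr h]) hsum Q _ (fun x => coordSign_sq cols x _) hQ _ sQ
    _ _ kQ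
  have hkS : k ∉ {v | v ∈ w :: ws} ∪ Set.range cols ∪ {v | v ∈ w :: ws} := by
    rintro ((h | ⟨t, rfl⟩) | h)
    · exact hk h
    · exact hcols t (by simp)
    · exact hk h
  obtain ⟨C, sC, kC, hC⟩ := exists_polynomial_of_reflection hP k w ws hws U _ sU hkS _ _ kU hUU
    (coordOn n a b cols) (by
      intro y hy x hx
      rw [hU y hy x hx]
      congr 2
      rw [← sum_coordWeight_coordSign hn a b hlen cols y,
        ← List.length_cons (a := w), ← sum_agree_numOn _ hws' y]
      refine Finset.sum_congr rfl fun z _ => ?_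
      split_ifs with hz
      · congr 1
        simp only [coordSign, hz _ (hcols' _)]
      · rfl)
  refine ⟨C, sC.mono ?_, kC.mono (le_of_eq ?_) (le_of_eq ?_), hC⟩
  · rintro v (((h | h) | h) | h)
    · exact Or.inl (List.mem_cons_of_mem _ h)
    · exact Or.inr h
    · exact Or.inl (List.mem_cons_of_mem _ h)
    · exact Or.inl h
  · simp only [List.length_cons, pow_succ]; ring
  · simp only [List.length_cons, pow_succ]; ring

/-- The coordinate-polynomial oracle as a multiplexed rotation. -/
theorem exists_coord_oracle_direct {P : ℝ[X]} {q : ℕ} (hP : IsCoordPoly P q) {n : ℕ}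
    (hn : 1 ≤ n) {a b : ℝ} (ha : -1 ≤ a) (hab : a < b) (hb : b ≤ 1) (k : ι)
    (cols : Fin n → ι) (hcols : (k :: List.ofFn cols).Nodup) :
    ∃ C : Circuit ι, ActsOn C ({k} ∪ Set.range cols) ∧
      Costs C (2 ^ (n + 1) + 2) (2 ^ (n + 2)) ∧
      ∀ y, y k = false → ∃ bot : State ι, (∀ x, x k = false → bot x = 0) ∧
        circuitOp C *ᵥ ket y = ((P.eval (coordOn n a b cols y) : ℝ) : ℂ) • ket y + bot := by
  obtain ⟨C, β, sC, kC, hC⟩ := exists_amplitude k (List.ofFn cols) hcols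
    (fun y => ((P.eval (coordOn n a b cols y) : ℝ) : ℂ))
    (fun x y h => by simp only [dependsOn_coordOn n a b cols x y h])
    (fun x => by
      rw [Complex.norm_real]
      exact (hP.bound _ (coordOn_mem hn ha hab hb cols x)).le)
  rw [List.length_ofFn] at kC
  refine ⟨C, sC.mono ?_, kC, fun y hy => ⟨_, fun x hx => ?_, (hC y).2 hy⟩⟩
  · intro v hv
    rcases List.mem_cons.1 hv with rfl | hv
    · exact Or.inl rfl
    · exact Or.inr ((List.mem_ofFn' cols v).1 hv)
  · have : x ≠ Function.update y k true := by
      rintro rfl; simp at hx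
    simp [ket_apply, this]

end Coordinate

/-! ### The first claim: composed oracles are auxiliaries. -/

/-! ### Powers of the momentum matrix -/

section Momentum

theorem pHat_pow_add (n m : ℕ) (a b : ℝ) (i j c : Fin (2 ^ n)) :
    (pHat n a b ^ m) (i + c) (j + c) = (pHat n a b ^ m) i j := by
  induction m generalizing i j with
  | zero => simp [Matrix.one_apply]
  | succ m ih =>
    rw [pow_succ, Matrix.mul_apply, Matrix.mul_apply, ← Equiv.sum_comp (Equiv.addRight c)]
    refine Finset.sum_congr rfl fun t _ => ?_
    rw [Equiv.coe_addRight, ih]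
    have h1 : j + c = t + c + 1 ↔ j = t + 1 := by rw [add_right_comm, add_left_inj]
    have h2 : t + c = j + c + 1 ↔ t = j + 1 := by rw [add_right_comm, add_left_inj]
    simp only [pHat, Matrix.of_apply, h1, h2]

theorem pHat_pow_transpose (n m : ℕ) (a b : ℝ) :
    (pHat n a b ^ m).transpose = (-1 : ℂ) ^ m • pHat n a b ^ m := by
  have h : (pHat n a b).transpose = (-1 : ℂ) • pHat n a b := by
    ext i j
    simp only [pHat, Matrix.transpose_apply, Matrix.of_apply, Matrix.smul_apply, smul_eq_mul]
    ring
  rw [Matrix.transpose_pow, h, smul_pow]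

/-- Translation invariance combined with the behaviour under transposition. The oracles read the
first row at $i-j$, so the sign here is the one that `IsAuxiliary` carries. -/
theorem pHat_pow_apply (n m : ℕ) (a b : ℝ) (i j : Fin (2 ^ n)) :
    (pHat n a b ^ m) i j = (-1) ^ m * (pHat n a b ^ m) 0 (i - j) := by
  have h1 := congrFun (congrFun (pHat_pow_transpose n m a b) j) i
  have h2 := pHat_pow_add n m a b 0 (i - j) j
  rw [zero_add, sub_add_cancel] at h2
  rw [Matrix.transpose_apply, Matrix.smul_apply, h2, smul_eq_mul] at h1
  exact h1

/-- Each factor moves the index by $\pm1$ modulo $2^n$, and `k` counts the upward moves. The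
congruence is written without subtraction of naturals. -/
theorem pHat_pow_support {n m : ℕ} {a b : ℝ} {i j : Fin (2 ^ n)} (h : (pHat n a b ^ m) i j ≠ 0) :
    ∃ k ≤ m, (j : ℕ) + m ≡ i + 2 * k [MOD 2 ^ n] := by
  induction m generalizing j with
  | zero =>
    refine ⟨0, le_rfl, ?_⟩
    by_cases hij : i = j
    · subst hij; rfl
    · simp [hij] at h
  | succ m ih =>
    rw [pow_succ, Matrix.mul_apply] at h
    obtain ⟨t, _, ht⟩ := Finset.exists_ne_zero_of_sum_ne_zero h
    obtain ⟨k, hk, hkt⟩ := ih (left_ne_zero_of_mul ht)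
    have hsucc : ∀ u v : Fin (2 ^ n), u = v + 1 → (u : ℕ) ≡ v + 1 [MOD 2 ^ n] := by
      rintro u v rfl
      rw [Fin.val_add, Fin.val_one']
      exact (Nat.mod_modEq _ _).trans ((Nat.mod_modEq _ _).add_left _)
    have hp := right_ne_zero_of_mul ht
    by_cases h1 : j = t + 1
    · refine ⟨k + 1, by omega, ?_⟩
      have e1 := (hsucc j t h1).add_right (m + 1)
      have e2 := hkt.add_right 2
      refine e1.trans ?_
      have e3 : (t : ℕ) + 1 + (m + 1) = t + m + 2 := by ring
      have e4 : (i : ℕ) + 2 * (k + 1) = i + 2 * k + 2 := by ring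
      rw [e3, e4]
      exact e2
    · by_cases h2 : t = j + 1
      · refine ⟨k, by omega, ?_⟩
        have e1 := (hsucc t j h2).add_right m
        have e3 : (j : ℕ) + (m + 1) = j + 1 + m := by ring
        rw [e3]
        exact e1.symm.trans hkt
      · simp [pHat, h1, h2] at hp

theorem ncard_pHat_pow_support (n m : ℕ) (a b : ℝ) :
    {c : Fin (2 ^ n) | (pHat n a b ^ m) 0 c ≠ 0}.ncard ≤ m + 1 := by
  classical
  have hex : ∀ c : Fin (2 ^ n), ∃ k : ℕ, (pHat n a b ^ m) 0 c ≠ 0 →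
      k ≤ m ∧ (c : ℕ) + m ≡ 2 * k [MOD 2 ^ n] := by
    intro c
    by_cases h : (pHat n a b ^ m) 0 c ≠ 0
    · obtain ⟨k, hk, hc⟩ := pHat_pow_support h
      exact ⟨k, fun _ => ⟨hk, by simpa using hc⟩⟩
    · exact ⟨0, fun h' => absurd h' h⟩
  choose κ hκ using hex
  have h := Set.ncard_le_ncard_of_injOn (s := {c : Fin (2 ^ n) | (pHat n a b ^ m) 0 c ≠ 0})
    (t := (Finset.range (m + 1) : Set ℕ)) κ (fun c hc => by
      simpa [Nat.lt_succ_iff] using (hκ c hc).1) (by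
      intro c hc d hd e
      have h1 := (hκ c hc).2
      have h2 := (hκ d hd).2
      rw [e] at h1
      have h3 := Nat.ModEq.add_right_cancel' m (h1.trans h2.symm)
      have h4 : (c : ℕ) = d := by
        have := h3
        rwa [Nat.ModEq, Nat.mod_eq_of_lt c.2, Nat.mod_eq_of_lt d.2] at this
      exact Fin.ext h4) (Finset.finite_toSet _)
  rwa [Set.ncard_coe_finset, Finset.card_range] at h

theorem aeval_xHat (n : ℕ) (a b : ℝ) (P : ℝ[X]) :
    Polynomial.aeval (xHat n a b) P =
      Matrix.diagonal fun i => ((P.eval (gridPoint n a b i) : ℝ) : ℂ) := by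
  have h1 : xHat n a b = Matrix.diagonalAlgHom ℝ (fun i => (gridPoint n a b i : ℂ)) := rfl
  rw [h1, Polynomial.aeval_algHom_apply]
  change Matrix.diagonal _ = _
  congr 1
  ext i
  have h2 := Polynomial.aeval_algHom_apply (Pi.evalAlgHom ℝ (fun _ : Fin (2 ^ n) => ℂ) i)
    (fun i => (gridPoint n a b i : ℂ)) P
  change Polynomial.aeval ((gridPoint n a b i : ℝ) : ℂ) P = _ at h2
  refine h2.symm.trans ?_
  exact Polynomial.aeval_algebraMap_apply ℂ (gridPoint n a b i) P

end Momentum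

/-! ### Binary digits and a criterion for auxiliaries -/

section Bits

theorem bits_injective (n : ℕ) : Function.Injective fun i : Fin (2 ^ n) => bits n i := by
  intro i j h
  refine Fin.ext (Nat.eq_of_testBit_eq fun t => ?_)
  by_cases ht : t < n
  · exact congrFun h ⟨t, ht⟩
  · have h2 : ∀ k : Fin (2 ^ n), (k : ℕ).testBit t = false := fun k =>
      Nat.testBit_lt_two_pow (k.2.trans_le (Nat.pow_le_pow_right (by norm_num) (by omega)))
    rw [h2, h2]

theorem bits_bijective (n : ℕ) : Function.Bijective fun i : Fin (2 ^ n) => bits n i := by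
  rw [Fintype.bijective_iff_injective_and_card]
  exact ⟨bits_injective n, by simp⟩

/-- Numbers below `2 ^ n` as bit strings. -/
def bitsEquiv (n : ℕ) : Fin (2 ^ n) ≃ Bits (Fin n) := Equiv.ofBijective _ (bits_bijective n)

theorem bitsEquiv_apply (n : ℕ) (i : Fin (2 ^ n)) : bitsEquiv n i = bits n i := rfl

theorem bits_inj {n : ℕ} {i j : Fin (2 ^ n)} : bits n i = bits n j ↔ i = j :=
  (bits_injective n).eq_iff

theorem bits_zero (n : ℕ) : bits n 0 = zeroBits (Fin n) := by
  ext t; simp [bits, zeroBits]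

theorem sum_elim_inj {α β γ : Type*} {f f' : α → γ} {g g' : β → γ} :
    Sum.elim f g = Sum.elim f' g' ↔ f = f' ∧ g = g' := by
  constructor
  · intro h
    exact ⟨funext fun x => congrFun h (Sum.inl x), funext fun x => congrFun h (Sum.inr x)⟩
  · rintro ⟨rfl, rfl⟩; rfl

/-- The orthogonal remainder is taken to be the difference of the two sides, so only amplitudes on
flag-zero strings have to be compared. `hB` makes the restriction of the sum to the support of $\hat
p^m$ harmless. -/
theorem isAuxiliary_of_entries {n m l : ℕ} {a b N : ℝ} {B : Matrix (Fin (2 ^ n)) (Fin (2 ^ n)) ℂ}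
    {U : Op (Wires n)} (hU : U ∈ Matrix.unitaryGroup (Bits (Wires n)) ℂ)
    (hB : ∀ i j, (pHat n a b ^ m) i j = 0 → B i j = 0)
    (h : ∀ i c j : Fin (2 ^ n), (U *ᵥ flagKet n 0 j)
      (Sum.elim (zeroBits _) (Sum.elim (bits n i) (bits n c))) =
        if c = j then ((-1) ^ m / (Real.sqrt (2 ^ l * N) : ℂ)) * B i j else 0) :
    IsAuxiliary n m l a b N B U := by
  classical
  refine ⟨hU, fun σ => ⟨_, ?_, (add_sub_cancel _ _).symm⟩⟩
  intro κ
  obtain ⟨ρ, γ, rfl⟩ : ∃ ρ γ : Bits (Fin n), κ = Sum.elim ρ γ :=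
    ⟨fun t => κ (Sum.inl t), fun t => κ (Sum.inr t), by ext (t | t) <;> rfl⟩
  obtain ⟨i, rfl⟩ := (bitsEquiv n).surjective ρ
  obtain ⟨c, rfl⟩ := (bitsEquiv n).surjective γ
  simp only [bitsEquiv_apply]
  rw [Pi.sub_apply, sub_eq_zero, Matrix.mulVec_sum, Finset.sum_apply]
  simp only [Matrix.mulVec_smul, Pi.smul_apply, h, smul_eq_mul, mul_ite, mul_zero,
    Finset.sum_ite_eq, Finset.mem_univ, if_true, Finset.sum_apply]
  have hk : ∀ i' j : Fin (2 ^ n), (flagKet n i' j : State (Wires n))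
      (Sum.elim (zeroBits _) (Sum.elim (bits n i) (bits n c))) =
        if c = j then (if i = i' then 1 else 0) else 0 := by
    intro i' j
    rw [flagKet, ket_apply]
    simp only [sum_elim_inj, bits_inj, true_and]
    by_cases h1 : i = i' <;> by_cases h2 : c = j <;> simp [h1, h2]
  have hs : ∀ j : Fin (2 ^ n), (∑ i' with (pHat n a b ^ m) i' j ≠ 0, B i' j * σ j *
      (flagKet n i' j : State (Wires n))
        (Sum.elim (zeroBits _) (Sum.elim (bits n i) (bits n c)))) =
      if c = j then B i j * σ j else 0 := by
    intro j
    simp only [hk]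
    split_ifs with hcj
    · simp only [mul_ite, mul_one, mul_zero, Finset.sum_ite_eq, Finset.mem_filter,
        Finset.mem_univ, true_and]
      split_ifs with hij
      · rfl
      · rw [hB i j (not_not.1 hij), zero_mul]
    · simp
  simp only [hs, Finset.sum_ite_eq, Finset.mem_univ, if_true]
  ring

end Bits

/-! ### Operators on selected qubits -/

section OnWires

variable {κ ι : Type} [Fintype κ] [Fintype ι] [DecidableEq κ] [DecidableEq ι]

/-- The state `φ` on the qubits selected by `e`, the bit string `y` elsewhere. -/
def embedState (e : κ ↪ ι) (y : Bits ι) (φ : State κ) : State ι := fun x =>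
  if ∀ i, (∀ k, e k ≠ i) → x i = y i then φ (fun k => x (e k)) else 0

theorem onWires_mulVec_ket (e : κ ↪ ι) (U : Op κ) (y : Bits ι) :
    onWires e U *ᵥ ket y = embedState e y (U *ᵥ ket fun k => y (e k)) := by
  rw [mulVec_ket, mulVec_ket]; rfl

omit [DecidableEq κ] in
theorem embedState_add (e : κ ↪ ι) (y : Bits ι) (φ φ' : State κ) :
    embedState e y (φ + φ') = embedState e y φ + embedState e y φ' := by
  ext x; simp only [embedState, Pi.add_apply]; split_ifs <;> simp

omit [DecidableEq κ] in
theorem embedState_smul (e : κ ↪ ι) (y : Bits ι) (c : ℂ) (φ : State κ) :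
    embedState e y (c • φ) = c • embedState e y φ := by
  ext x; simp only [embedState, Pi.smul_apply]; split_ifs <;> simp

omit [Fintype κ] [Fintype ι] [DecidableEq κ] [DecidableEq ι] in
theorem eq_extend_iff (e : κ ↪ ι) (x y : Bits ι) (z : Bits κ) :
    x = Function.extend e z y ↔ (∀ i, (∀ k, e k ≠ i) → x i = y i) ∧ (fun k => x (e k)) = z := by
  constructor
  · rintro rfl
    refine ⟨fun i hi => Function.extend_apply' _ _ _ fun ⟨k, hk⟩ => hi k hk, ?_⟩
    ext k; exact e.injective.extend_apply _ _ _
  · rintro ⟨h1, rfl⟩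
    ext i
    by_cases hi : ∃ k, e k = i
    · obtain ⟨k, rfl⟩ := hi
      exact (e.injective.extend_apply (fun k => x (e k)) y k).symm
    · rw [Function.extend_apply' _ _ _ hi]
      exact h1 i fun k hk => hi ⟨k, hk⟩

theorem embedState_ket (e : κ ↪ ι) (y : Bits ι) (z : Bits κ) :
    embedState e y (ket z) = ket (Function.extend e z y) := by
  ext x
  simp only [embedState, ket_apply, eq_extend_iff]
  by_cases h1 : ∀ i, (∀ k, e k ≠ i) → x i = y i
  · rw [if_pos h1]
    exact if_congr ⟨fun h => ⟨h1, h⟩, fun h => h.2⟩ rfl rfl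
  · rw [if_neg h1, if_neg fun h => h1 h.1]

theorem onWires_mulVec_apply (e : κ ↪ ι) (U : Op κ) (ψ : State ι) (x : Bits ι) :
    (onWires e U *ᵥ ψ) x = ∑ z, U (fun k => x (e k)) z * ψ (Function.extend e z x) := by
  have h : ∀ y, onWires e U x y * ψ y =
      ∑ z, if y = Function.extend e z x then U (fun k => x (e k)) z * ψ y else 0 := by
    intro y
    simp only [onWires, Matrix.of_apply, eq_extend_iff]
    by_cases h1 : ∀ i, (∀ k, e k ≠ i) → x i = y i
    · have h2 : ∀ i, (∀ k, e k ≠ i) → y i = x i := fun i hi => (h1 i hi).symm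
      rw [if_pos h1, Finset.sum_eq_single fun k => y (e k), if_pos ⟨h2, rfl⟩]
      · intro z _ hz
        rw [if_neg fun h => hz h.2.symm]
      · intro h
        exact absurd (Finset.mem_univ _) h
    · have h2 : ¬ ∀ i, (∀ k, e k ≠ i) → y i = x i := fun h => h1 fun i hi => (h i hi).symm
      rw [if_neg h1, zero_mul]
      refine (Finset.sum_eq_zero fun z _ => ?_).symm
      rw [if_neg fun h => h2 h.1]
  rw [Matrix.mulVec, dotProduct]
  simp only [h]
  rw [Finset.sum_comm]
  refine Finset.sum_congr rfl fun z _ => ?_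
  simp

theorem onWires_mul (e : κ ↪ ι) (U V : Op κ) :
    onWires e U * onWires e V = onWires e (U * V) := by
  apply op_ext_ket
  intro y
  rw [← Matrix.mulVec_mulVec]
  ext x
  rw [onWires_mulVec_apply, onWires_mulVec_apply]
  simp only [onWires_mulVec_apply, Matrix.mul_apply, Finset.mul_sum, Finset.sum_mul]
  rw [Finset.sum_comm]
  refine Finset.sum_congr rfl fun z _ => Finset.sum_congr rfl fun z' _ => ?_
  have h1 : (fun k => Function.extend e z' x (e k)) = z' := by
    ext k; exact e.injective.extend_apply _ _ _
  have h2 : Function.extend e z (Function.extend e z' x) = Function.extend e z x := by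
    rw [eq_extend_iff]
    refine ⟨fun i hi => ?_, by ext k; exact e.injective.extend_apply _ _ _⟩
    rw [Function.extend_apply' _ _ _ fun ⟨k, hk⟩ => hi k hk,
      Function.extend_apply' _ _ _ fun ⟨k, hk⟩ => hi k hk]
  rw [h1, h2, mul_assoc]

theorem onWires_one (e : κ ↪ ι) : onWires e (1 : Op κ) = 1 := by
  apply op_ext_ket
  intro y
  rw [onWires_mulVec_ket, Matrix.one_mulVec, Matrix.one_mulVec, embedState_ket]
  congr 1
  exact ((eq_extend_iff e y y _).2 ⟨fun _ _ => rfl, rfl⟩).symm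

theorem onWires_star (e : κ ↪ ι) (U : Op κ) : onWires e (star U) = star (onWires e U) := by
  ext x y
  simp only [onWires, Matrix.of_apply, Matrix.star_apply]
  have : (∀ i, (∀ k, e k ≠ i) → x i = y i) ↔ (∀ i, (∀ k, e k ≠ i) → y i = x i) := by
    simp only [eq_comm]
  simp only [this, apply_ite star, star_zero]

theorem onWires_mem_unitary (e : κ ↪ ι) {U : Op κ}
    (hU : U ∈ Matrix.unitaryGroup (Bits κ) ℂ) :
    onWires e U ∈ Matrix.unitaryGroup (Bits ι) ℂ := by
  rw [Matrix.mem_unitaryGroup_iff, ← onWires_star, onWires_mul,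
    Matrix.mem_unitaryGroup_iff.1 hU, onWires_one]

/-- States without component on the zero state of the flags `F`. -/
def Flagged (F : Set ι) (ψ : State ι) : Prop := ∀ x, (∀ w ∈ F, x w = false) → ψ x = 0

omit [Fintype ι] [DecidableEq ι] in
theorem Flagged.add {F : Set ι} {ψ φ : State ι} (h : Flagged F ψ) (h' : Flagged F φ) :
    Flagged F (ψ + φ) := fun x hx => by rw [Pi.add_apply, h x hx, h' x hx, add_zero]

omit [Fintype ι] [DecidableEq ι] in
theorem Flagged.smul {F : Set ι} {ψ : State ι} (h : Flagged F ψ) (c : ℂ) :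
    Flagged F (c • ψ) := fun x hx => by rw [Pi.smul_apply, h x hx, smul_zero]

omit [Fintype ι] [DecidableEq ι] in
theorem Flagged.sum {σ : Type*} (s : Finset σ) {F : Set ι} {ψ : σ → State ι}
    (h : ∀ i ∈ s, Flagged F (ψ i)) : Flagged F (∑ i ∈ s, ψ i) := fun x hx => by
  rw [Finset.sum_apply]
  exact Finset.sum_eq_zero fun i hi => h i hi x hx

/-- An operator away from the flags has entries only between strings with equal flags, so it cannot
return a failing branch to the zero flags. -/
theorem Flagged.onWires {F : Set ι} {ψ : State ι} (h : Flagged F ψ) (e : κ ↪ ι) (U : Op κ)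
    (hF : ∀ k, e k ∉ F) : Flagged F (onWires e U *ᵥ ψ) := fun x hx => by
  rw [onWires_mulVec_apply]
  refine Finset.sum_eq_zero fun z _ => ?_
  rw [h, mul_zero]
  intro w hw
  rw [Function.extend_apply' _ _ _ fun ⟨k, hk⟩ => hF k (hk ▸ hw)]
  exact hx w hw

omit [Fintype ι] [DecidableEq ι] in
theorem Flagged.mono {F F' : Set ι} {ψ : State ι} (h : Flagged F ψ) (hF : F ⊆ F') :
    Flagged F' ψ := fun x hx => h x fun w hw => hx w (hF hw)

theorem flagged_ket {F : Set ι} {y : Bits ι} {w : ι} (hw : w ∈ F) (h : y w = true) :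
    Flagged F (ket y) := fun x hx => by
  rw [ket_apply, if_neg]
  rintro rfl
  rw [hx w hw] at h
  exact absurd h (by simp)

end OnWires

/-! ### The circuits of oracles -/

section Oracles

/-- The bit string `|0⟩³|r⟩ⁿ|c⟩ⁿ`. -/
def flagBits (n r c : ℕ) : Bits (Wires n) :=
  Sum.elim (zeroBits _) (Sum.elim (bits n r) (bits n c))

theorem flagBits_inj {n : ℕ} {i c i' c' : Fin (2 ^ n)} :
    flagBits n i c = flagBits n i' c' ↔ i = i' ∧ c = c' := by
  simp only [flagBits, sum_elim_inj, bits_inj, true_and]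

theorem flagKet_apply {n : ℕ} (i c i' c' : Fin (2 ^ n)) :
    flagKet n i' c' (flagBits n i c) = if i = i' ∧ c = c' then 1 else 0 := by
  rw [flagKet, ket_apply]
  congr 1
  exact propext flagBits_inj

theorem two_pow_le {n l : ℕ} (h : l ≤ n) : 2 ^ l ≤ 2 ^ n := Nat.pow_le_pow_right (by norm_num) h

theorem hadamardLayer_mulVec {n l : ℕ} (h : l ≤ n) (j : ℕ) :
    circuitOp (hadamardLayer h) *ᵥ flagKet n 0 j =
      ((((Real.sqrt 2)⁻¹ : ℝ) : ℂ) ^ l) • ∑ s : Fin (2 ^ l), flagKet n s j := by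
  set ws : List (Wires n) := List.ofFn fun t : Fin l => Sum.inr (Sum.inl (Fin.castLE h t)) with hws
  have h1 : hadamardLayer h = ws.map hGate := by
    rw [hws, List.map_ofFn]; rfl
  have hinj : Function.Injective fun t : Fin l =>
      (Sum.inr (Sum.inl (Fin.castLE h t)) : Wires n) := fun t t' e => by simpa using e
  have hmem : ∀ i, i ∈ ws ↔ ∃ t : Fin l, Sum.inr (Sum.inl (Fin.castLE h t)) = i := fun i => by
    rw [hws, List.mem_ofFn']; rfl
  rw [h1, flagKet, hadamards_mulVec_ket ws (List.nodup_ofFn.2 hinj)]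
  · ext x
    rw [Pi.smul_apply, Finset.sum_apply, smul_eq_mul]
    simp only [flagKet, ket_apply]
    have hlen : ws.length = l := by rw [hws, List.length_ofFn]
    rw [hlen]
    by_cases hx : ∀ i, i ∉ ws → x i = Sum.elim (zeroBits (Fin 3))
        (Sum.elim (bits n 0) (bits n j)) i
    · rw [if_pos hx]
      obtain ⟨s, hs⟩ := (bitsEquiv l).surjective
        (fun t => x (Sum.inr (Sum.inl (Fin.castLE h t))))
      have hxs : x = Sum.elim (zeroBits (Fin 3)) (Sum.elim (bits n s) (bits n j)) := by
        ext i
        by_cases hi : i ∈ ws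
        · obtain ⟨t, rfl⟩ := (hmem i).1 hi
          exact (congrFun hs t).symm
        · rw [hx i hi]
          rcases i with i | i | i
          · rfl
          · have hil : l ≤ i := by
              by_contra hlt
              exact hi ((hmem _).2 ⟨⟨i, by omega⟩, rfl⟩)
            simp only [Sum.elim_inr, Sum.elim_inl, bits, Nat.zero_testBit]
            exact (Nat.testBit_lt_two_pow (s.2.trans_le (two_pow_le hil))).symm
          · rfl
      rw [Finset.sum_eq_single s, if_pos hxs, mul_one]
      · intro s' _ hs'
        rw [if_neg]
        intro e
        rw [hxs] at e
        have e2 := (sum_elim_inj.1 (sum_elim_inj.1 e).2).1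
        have e3 := bits_injective n
          (a₁ := ⟨s, s.2.trans_le (two_pow_le h)⟩) (a₂ := ⟨s', s'.2.trans_le (two_pow_le h)⟩) e2
        exact hs' (Fin.ext (congrArg Fin.val e3).symm)
      · simp
    · rw [if_neg hx, Finset.sum_eq_zero, mul_zero]
      intro s _
      rw [if_neg]
      rintro rfl
      apply hx
      intro i hi
      rcases i with i | i | i
      · rfl
      · have hil : l ≤ i := by
          by_contra hlt
          exact hi ((hmem _).2 ⟨⟨i, by omega⟩, rfl⟩)
        simp only [Sum.elim_inr, Sum.elim_inl, bits, Nat.zero_testBit]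
        exact Nat.testBit_lt_two_pow (s.2.trans_le (two_pow_le hil))
      · rfl
  · intro w hw
    obtain ⟨t, rfl⟩ := (hmem w).1 hw
    simp [bits]

/-- A non-zero entry has fewer than $2^l$ non-zero entries to its left by `hA`, so exactly one `s`
reaches it. -/
theorem sum_isNthNonzero {n l : ℕ} (A : Matrix (Fin (2 ^ n)) (Fin (2 ^ n)) ℂ)
    (hA : {c | A 0 c ≠ 0}.ncard ≤ 2 ^ l) (c : Fin (2 ^ n)) (z : ℂ) :
    open Classical in (∑ s : Fin (2 ^ l), if IsNthNonzero A s c then A 0 c * z else 0) =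
      A 0 c * z := by
  classical
  by_cases hc : A 0 c = 0
  · simp [hc]
  · have hlt : {d : Fin (2 ^ n) | d < c ∧ A 0 d ≠ 0}.ncard < 2 ^ l := by
      refine lt_of_lt_of_le (Set.ncard_lt_ncard ?_ (Set.toFinite _)) hA
      refine ⟨fun d hd => hd.2, fun h => ?_⟩
      exact lt_irrefl _ (h (show c ∈ {c | A 0 c ≠ 0} from hc)).1
    rw [Finset.sum_eq_single ⟨_, hlt⟩]
    · rw [if_pos ⟨hc, rfl⟩]
    · intro s _ hs
      rw [if_neg]
      rintro ⟨_, h⟩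
      exact hs (Fin.ext h.symm)
    · simp

variable {n l : ℕ}

theorem sparseAmplitude_mulVec (h : l ≤ n) {A : Matrix (Fin (2 ^ n)) (Fin (2 ^ n)) ℂ} {N : ℝ}
    {OS : Op (Fin 1 ⊕ Fin l)} (hOS : IsSparseAmplitudeOracle l A N OS) (s : Fin (2 ^ l)) (j : ℕ) :
    ∃ bad, Flagged {Sum.inl 0} bad ∧ onWires (wiresS h) OS *ᵥ flagKet n s j =
      (bandedEntry A s / (Real.sqrt N : ℂ)) • flagKet n s j + bad := by
  have hy : (fun k => Sum.elim (zeroBits (Fin 3)) (Sum.elim (bits n s) (bits n j))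
      (wiresS h k)) = Sum.elim (fun _ => false) (bits l s) := by
    ext (k | k) <;> rfl
  have hself : Function.extend (wiresS h) (Sum.elim (fun _ => false) (bits l s))
      (Sum.elim (zeroBits (Fin 3)) (Sum.elim (bits n s) (bits n j))) =
        Sum.elim (zeroBits (Fin 3)) (Sum.elim (bits n s) (bits n j)) :=
    ((eq_extend_iff _ _ _ _).2 ⟨fun _ _ => rfl, hy⟩).symm
  rw [flagKet, onWires_mulVec_ket, hy, hOS.2 s s.2, embedState_add, embedState_smul,
    embedState_smul, embedState_ket, embedState_ket, hself]
  refine ⟨_, Flagged.smul (flagged_ket (F := {Sum.inl 0}) (w := Sum.inl 0) (Set.mem_singleton _) ?_) _,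
    rfl⟩
  exact (wiresS h).injective.extend_apply _ _ (Sum.inl 0)

theorem bandedAccess_mulVec {A : Matrix (Fin (2 ^ n)) (Fin (2 ^ n)) ℂ}
    {OBS : Op (Fin n ⊕ Fin n)} (hOBS : IsBandedSparseAccess l A OBS) (s : Fin (2 ^ l))
    (r j : Fin (2 ^ n)) (hr : IsNthNonzero A s r) :
    onWires (wiresBS n) OBS *ᵥ flagKet n s j = flagKet n (r + j : Fin (2 ^ n)) j := by
  have hy : (fun k => Sum.elim (zeroBits (Fin 3)) (Sum.elim (bits n s) (bits n j))
      (wiresBS n k)) = Sum.elim (bits n s) (bits n j) := by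
    ext (k | k) <;> rfl
  rw [flagKet, onWires_mulVec_ket, hy, hOBS.2 s s.2 r hr j, embedState_ket, flagKet]
  congr 1
  symm
  rw [eq_extend_iff]
  refine ⟨fun i hi => ?_, rfl⟩
  rcases i with i | i
  · rfl
  · exact absurd rfl (hi i)

theorem coordPoly_row_mulVec {a b : ℝ} {P : ℝ[X]} {OP : Op (Fin 2 ⊕ Fin n)}
    (hOP : IsCoordPolyOracle n a b P OP) (i j : Fin (2 ^ n)) :
    ∃ bad, Flagged {Sum.inl 1, Sum.inl 2} bad ∧ onWires (wiresRow n) OP *ᵥ flagKet n i j =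
      ((P.eval (gridPoint n a b i) : ℝ) : ℂ) • flagKet n i j + bad := by
  obtain ⟨bot, hbot, h⟩ := hOP.2 i
  have hy : (fun k => Sum.elim (zeroBits (Fin 3)) (Sum.elim (bits n i) (bits n j))
      (wiresRow n k)) = Sum.elim (zeroBits _) (bits n i) := by
    ext (k | k) <;> rfl
  have hself : Function.extend (wiresRow n) (Sum.elim (zeroBits _) (bits n i))
      (Sum.elim (zeroBits (Fin 3)) (Sum.elim (bits n i) (bits n j))) =
        Sum.elim (zeroBits (Fin 3)) (Sum.elim (bits n i) (bits n j)) :=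
    ((eq_extend_iff _ _ _ _).2 ⟨fun _ _ => rfl, hy⟩).symm
  rw [flagKet, onWires_mulVec_ket, hy, h, embedState_add, embedState_smul, embedState_ket, hself]
  refine ⟨_, fun x hx => ?_, rfl⟩
  have hz : (fun k => x (wiresRow n k)) =
      Sum.elim (zeroBits _) fun t => x (Sum.inr (Sum.inl t)) := by
    ext (k | k)
    · fin_cases k
      · exact hx (Sum.inl 1) (by simp)
      · exact hx (Sum.inl 2) (by simp)
    · rfl
  simp only [embedState]
  rw [hz, hbot, ite_self]

theorem coordPoly_col_mulVec {a b : ℝ} {P : ℝ[X]} {OP : Op (Fin 2 ⊕ Fin n)}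
    (hOP : IsCoordPolyOracle n a b P OP) (i : ℕ) (j : Fin (2 ^ n)) :
    ∃ bad, Flagged {Sum.inl 1, Sum.inl 2} bad ∧ onWires (wiresCol n) OP *ᵥ flagKet n i j =
      ((P.eval (gridPoint n a b j) : ℝ) : ℂ) • flagKet n i j + bad := by
  obtain ⟨bot, hbot, h⟩ := hOP.2 j
  have hy : (fun k => Sum.elim (zeroBits (Fin 3)) (Sum.elim (bits n i) (bits n j))
      (wiresCol n k)) = Sum.elim (zeroBits _) (bits n j) := by
    ext (k | k) <;> rfl
  have hself : Function.extend (wiresCol n) (Sum.elim (zeroBits _) (bits n j))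
      (Sum.elim (zeroBits (Fin 3)) (Sum.elim (bits n i) (bits n j))) =
        Sum.elim (zeroBits (Fin 3)) (Sum.elim (bits n i) (bits n j)) :=
    ((eq_extend_iff _ _ _ _).2 ⟨fun _ _ => rfl, hy⟩).symm
  rw [flagKet, onWires_mulVec_ket, hy, h, embedState_add, embedState_smul, embedState_ket, hself]
  refine ⟨_, fun x hx => ?_, rfl⟩
  have hz : (fun k => x (wiresCol n k)) =
      Sum.elim (zeroBits _) fun t => x (Sum.inr (Sum.inr t)) := by
    ext (k | k)
    · fin_cases k
      · exact hx (Sum.inl 1) (by simp)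
      · exact hx (Sum.inl 2) (by simp)
    · rfl
  simp only [embedState]
  rw [hz, hbot, ite_self]

/-- Amplitude oracle followed by banded-sparse-access. -/
theorem banded_mulVec (h : l ≤ n) {A : Matrix (Fin (2 ^ n)) (Fin (2 ^ n)) ℂ} {N : ℝ}
    (hA : {c | A 0 c ≠ 0}.ncard ≤ 2 ^ l)
    {OS : Op (Fin 1 ⊕ Fin l)} (hOS : IsSparseAmplitudeOracle l A N OS)
    {OBS : Op (Fin n ⊕ Fin n)} (hOBS : IsBandedSparseAccess l A OBS) (j : Fin (2 ^ n)) :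
    ∃ bad, Flagged {Sum.inl 0} bad ∧
      onWires (wiresBS n) OBS *ᵥ (onWires (wiresS h) OS *ᵥ ∑ s : Fin (2 ^ l), flagKet n s j) =
        ∑ i : Fin (2 ^ n), (A 0 (i - j) / (Real.sqrt N : ℂ)) • flagKet n i j + bad := by
  classical
  choose bad hbad hS using fun s : Fin (2 ^ l) => sparseAmplitude_mulVec h hOS s j
  refine ⟨∑ s, onWires (wiresBS n) OBS *ᵥ bad s, Flagged.sum _ fun s _ =>
    (hbad s).onWires _ _ fun k => by simp [wiresBS], ?_⟩
  rw [Matrix.mulVec_sum]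
  simp only [hS]
  rw [Finset.sum_add_distrib, Matrix.mulVec_add, Matrix.mulVec_sum, Matrix.mulVec_sum]
  congr 1
  have h1 : ∀ s : Fin (2 ^ l), onWires (wiresBS n) OBS *ᵥ
      ((bandedEntry A s / (Real.sqrt N : ℂ)) • flagKet n s j) =
      ∑ r, (if IsNthNonzero A s r then A 0 r * (Real.sqrt N : ℂ)⁻¹ else 0) •
        flagKet n (r + j : Fin (2 ^ n)) j := by
    intro s
    -- If $r_s$ does not exist, every summand of `bandedEntry` is zero, so the unspecified action of
    -- the access oracle on such `s` plays no role.
    rw [Matrix.mulVec_smul, bandedEntry, Finset.sum_div, Finset.sum_smul]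
    refine Finset.sum_congr rfl fun r _ => ?_
    split_ifs with hr
    · rw [bandedAccess_mulVec hOBS s r j hr, div_eq_mul_inv]
    · simp
  simp only [h1]
  rw [Finset.sum_comm]
  simp only [← Finset.sum_smul, sum_isNthNonzero A hA]
  rw [← Equiv.sum_comp (Equiv.addRight j) fun i : Fin (2 ^ n) =>
    (A 0 (i - j) / (Real.sqrt N : ℂ)) • (flagKet n i j : State (Wires n))]
  refine Finset.sum_congr rfl fun r _ => ?_
  change _ = (A 0 (r + j - j) / (Real.sqrt N : ℂ)) • flagKet n (r + j : Fin (2 ^ n)) j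
  rw [add_sub_cancel_right, div_eq_mul_inv]

theorem norm_const_eq (l : ℕ) (N : ℝ) :
    (((Real.sqrt 2)⁻¹ : ℝ) : ℂ) ^ l / (Real.sqrt N : ℂ) = 1 / (Real.sqrt (2 ^ l * N) : ℂ) := by
  rw [← Complex.ofReal_pow, ← Complex.ofReal_div, ← Complex.ofReal_one, ← Complex.ofReal_div]
  congr 1
  have h1 : Real.sqrt (2 ^ l) = Real.sqrt 2 ^ l := by
    rw [Real.sqrt_eq_iff_mul_self_eq (by positivity) (by positivity), ← mul_pow,
      Real.mul_self_sqrt (by norm_num)]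
  rw [Real.sqrt_mul (by positivity), h1, inv_pow, div_eq_mul_inv, one_div, mul_inv]

variable {m : ℕ} {a b : ℝ} {P : ℝ[X]} {N : ℝ}

theorem flagged_entry (j i c : Fin (2 ^ n)) (z : ℂ) (α : Fin (2 ^ n) → ℂ)
    {bad : State (Wires n)} (hbad : Flagged (Set.range Sum.inl) bad) :
    (z • (∑ i' : Fin (2 ^ n), α i' • (flagKet n i' j : State (Wires n)) + bad))
      (flagBits n i c) = if c = j then z * α i else 0 := by
  rw [Pi.smul_apply, Pi.add_apply, Finset.sum_apply, hbad _ (by rintro _ ⟨f, rfl⟩; rfl), add_zero]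
  simp only [Pi.smul_apply, flagKet_apply, smul_eq_mul]
  by_cases h : c = j <;> simp [h]

theorem coefficient_eq (i j : Fin (2 ^ n)) (z : ℂ) :
    (((Real.sqrt 2)⁻¹ : ℝ) : ℂ) ^ l * ((pHat n a b ^ m) 0 (i - j) / (Real.sqrt N : ℂ) * z) =
      (-1) ^ m / (Real.sqrt (2 ^ l * N) : ℂ) * ((pHat n a b ^ m) i j * z) := by
  have h1 : ((-1 : ℂ) ^ m) * (-1) ^ m = 1 := by rw [← mul_pow]; simp
  have h2 := norm_const_eq l N
  rw [pHat_pow_apply n m a b i j]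
  calc _ = ((((Real.sqrt 2)⁻¹ : ℝ) : ℂ) ^ l / (Real.sqrt N : ℂ)) *
        ((pHat n a b ^ m) 0 (i - j) * z) := by ring
    _ = ((-1 : ℂ) ^ m * (-1) ^ m) * (1 / (Real.sqrt (2 ^ l * N) : ℂ)) *
        ((pHat n a b ^ m) 0 (i - j) * z) := by rw [h2, h1, one_mul]
    _ = _ := by ring

/-- The amplitude oracle fails into flag 0, which neither of the later oracles touches; the
polynomial oracle comes last and fails into flags 1 and 2. -/
theorem isAuxPp_composePp (h : l ≤ n) (hml : m + 1 = 2 ^ l)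
    {OP : Op (Fin 2 ⊕ Fin n)} {OS : Op (Fin 1 ⊕ Fin l)} {OBS : Op (Fin n ⊕ Fin n)}
    (hOP : IsCoordPolyOracle n a b P OP)
    (hOS : IsSparseAmplitudeOracle l (pHat n a b ^ m) N OS)
    (hOBS : IsBandedSparseAccess l (pHat n a b ^ m) OBS) :
    IsAuxPp n m l a b N P (composePp h OP OS OBS) := by
  refine isAuxiliary_of_entries ?_ ?_ ?_
  · exact mul_mem (mul_mem (mul_mem (onWires_mem_unitary _ hOP.1) (onWires_mem_unitary _ hOBS.1))
      (onWires_mem_unitary _ hOS.1)) (circuitOp_mem_unitary _)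
  · intro i j hij
    rw [aeval_xHat, Matrix.diagonal_mul, hij, mul_zero]
  · intro i c j
    obtain ⟨bad, hbad, hb⟩ := banded_mulVec h (hml ▸ ncard_pHat_pow_support n m a b) hOS hOBS j
    choose bad' hbad' hP' using fun i : Fin (2 ^ n) => coordPoly_row_mulVec hOP i j
    have hF : Flagged (Set.range Sum.inl) (∑ i' : Fin (2 ^ n),
        ((pHat n a b ^ m) 0 (i' - j) / (Real.sqrt N : ℂ)) • bad' i' +
          onWires (wiresRow n) OP *ᵥ bad) := by
      refine ((Flagged.sum _ fun i' _ => (hbad' i').smul _).mono ?_).add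
        ((hbad.onWires (wiresRow n) OP ?_).mono ?_)
      · rintro _ (rfl | rfl) <;> exact ⟨_, rfl⟩
      · rintro (k | k)
        · change (Sum.inl (Fin.succ k) : Wires n) ∉ ({Sum.inl 0} : Set (Wires n))
          simp
        · change (Sum.inr (Sum.inl k) : Wires n) ∉ ({Sum.inl 0} : Set (Wires n))
          simp
      · rintro _ rfl; exact ⟨_, rfl⟩
    have key : composePp h OP OS OBS *ᵥ flagKet n 0 j = ((((Real.sqrt 2)⁻¹ : ℝ) : ℂ) ^ l) •
        (∑ i' : Fin (2 ^ n), ((pHat n a b ^ m) 0 (i' - j) / (Real.sqrt N : ℂ) *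
          ((P.eval (gridPoint n a b i') : ℝ) : ℂ)) • (flagKet n i' j : State (Wires n)) +
        (∑ i' : Fin (2 ^ n), ((pHat n a b ^ m) 0 (i' - j) / (Real.sqrt N : ℂ)) • bad' i' +
          onWires (wiresRow n) OP *ᵥ bad)) := by
      rw [composePp, ← Matrix.mulVec_mulVec, hadamardLayer_mulVec, Matrix.mulVec_smul,
        ← Matrix.mulVec_mulVec, ← Matrix.mulVec_mulVec, hb, Matrix.mulVec_add, Matrix.mulVec_sum]
      simp only [Matrix.mulVec_smul, hP', smul_add, smul_smul]
      rw [Finset.sum_add_distrib, smul_add, add_assoc]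
    rw [key]
    refine (flagged_entry j i c _ _ hF).trans ?_
    rw [coefficient_eq, aeval_xHat, Matrix.diagonal_mul, mul_comm ((pHat n a b ^ m) i j)]

/-- The polynomial oracle now fails before the sparse oracles, which avoid flags 1 and 2. Its value
depends only on the column and passes through them as a scalar. -/
theorem isAuxpP_composepP (h : l ≤ n) (hml : m + 1 = 2 ^ l)
    {OP : Op (Fin 2 ⊕ Fin n)} {OS : Op (Fin 1 ⊕ Fin l)} {OBS : Op (Fin n ⊕ Fin n)}
    (hOP : IsCoordPolyOracle n a b P OP)
    (hOS : IsSparseAmplitudeOracle l (pHat n a b ^ m) N OS)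
    (hOBS : IsBandedSparseAccess l (pHat n a b ^ m) OBS) :
    IsAuxpP n m l a b N P (composepP h OP OS OBS) := by
  refine isAuxiliary_of_entries ?_ ?_ ?_
  · exact mul_mem (mul_mem (mul_mem (onWires_mem_unitary _ hOBS.1) (onWires_mem_unitary _ hOS.1))
      (onWires_mem_unitary _ hOP.1)) (circuitOp_mem_unitary _)
  · intro i j hij
    rw [aeval_xHat, Matrix.mul_diagonal, hij, zero_mul]
  · intro i c j
    obtain ⟨bad, hbad, hb⟩ := banded_mulVec h (hml ▸ ncard_pHat_pow_support n m a b) hOS hOBS j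
    choose bad' hbad' hP' using fun s : Fin (2 ^ l) => coordPoly_col_mulVec hOP s j
    set p : ℂ := ((P.eval (gridPoint n a b j) : ℝ) : ℂ) with hp
    have hF : Flagged (Set.range Sum.inl) (p • bad + onWires (wiresBS n) OBS *ᵥ
        (onWires (wiresS h) OS *ᵥ ∑ s, bad' s)) := by
      refine ((hbad.smul _).mono ?_).add ((((Flagged.sum _ fun s _ => hbad' s).onWires
        _ _ ?_).onWires _ _ ?_).mono ?_)
      · rintro _ rfl; exact ⟨_, rfl⟩
      · rintro (k | k)
        · change (Sum.inl 0 : Wires n) ∉ ({Sum.inl 1, Sum.inl 2} : Set (Wires n))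
          simp
        · change (Sum.inr (Sum.inl _) : Wires n) ∉ ({Sum.inl 1, Sum.inl 2} : Set (Wires n))
          simp
      · intro k; simp [wiresBS]
      · rintro _ (rfl | rfl) <;> exact ⟨_, rfl⟩
    have key : composepP h OP OS OBS *ᵥ flagKet n 0 j = ((((Real.sqrt 2)⁻¹ : ℝ) : ℂ) ^ l) •
        (∑ i' : Fin (2 ^ n), ((pHat n a b ^ m) 0 (i' - j) / (Real.sqrt N : ℂ) * p) •
          (flagKet n i' j : State (Wires n)) +
        (p • bad + onWires (wiresBS n) OBS *ᵥ (onWires (wiresS h) OS *ᵥ ∑ s, bad' s))) := by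
      rw [composepP, ← Matrix.mulVec_mulVec, hadamardLayer_mulVec, Matrix.mulVec_smul,
        ← Matrix.mulVec_mulVec, ← Matrix.mulVec_mulVec, Matrix.mulVec_sum]
      simp only [hP']
      rw [Finset.sum_add_distrib, ← Finset.smul_sum, Matrix.mulVec_add, Matrix.mulVec_add,
        Matrix.mulVec_smul, Matrix.mulVec_smul, hb, smul_add p, Finset.smul_sum, add_assoc]
      simp only [smul_smul, mul_comm p]
    rw [key]
    refine (flagged_entry j i c _ _ hF).trans ?_
    rw [coefficient_eq, aeval_xHat, Matrix.mul_diagonal]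

end Oracles

/-! ### The second claim: explicit circuits with pure ancillas. -/

/-! ### Clean ancillas -/

section Clean

variable {ι α : Type} [Fintype ι] [Fintype α] [DecidableEq ι] [DecidableEq α]

/-- `U` maps states with ancillas `α` in `|0…0⟩` to such states. -/
def Clean (U : Op (ι ⊕ α)) : Prop :=
  ∀ x y, (∀ k, y (Sum.inr k) = false) → ¬ (∀ k, x (Sum.inr k) = false) → U x y = 0

/-- The block of `U` with all ancillas in `|0…0⟩`. -/
def compress (U : Op (ι ⊕ α)) : Op ι :=
  Matrix.of fun x y => U (Sum.elim x (zeroBits α)) (Sum.elim y (zeroBits α))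

omit [DecidableEq ι] [DecidableEq α] [Fintype ι] [Fintype α] in
theorem eq_elim_zeroBits {x : Bits (ι ⊕ α)} (h : ∀ k, x (Sum.inr k) = false) :
    x = Sum.elim (fun i => x (Sum.inl i)) (zeroBits α) := by
  ext (i | k)
  · rfl
  · exact h k

theorem sum_bits_sum {β : Type*} [AddCommMonoid β] (f : Bits (ι ⊕ α) → β) :
    ∑ x, f x = ∑ x : Bits ι, f (Sum.elim x (zeroBits α)) +
      ∑ x with ¬ ∀ k, x (Sum.inr k) = false, f x := by
  rw [← Finset.sum_filter_add_sum_filter_not Finset.univ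
    (fun x : Bits (ι ⊕ α) => ∀ k, x (Sum.inr k) = false)]
  congr 1
  refine Finset.sum_nbij' (fun x i => x (Sum.inl i)) (fun x => Sum.elim x (zeroBits α)) ?_ ?_ ?_
    ?_ ?_
  · intro x _; exact Finset.mem_univ _
  · intro x _; simp [zeroBits]
  · intro x hx; exact (eq_elim_zeroBits (by simpa using hx)).symm
  · intro x _; rfl
  · intro x hx
    exact congrArg f (eq_elim_zeroBits (by simpa using hx))

theorem Clean.mul {U V : Op (ι ⊕ α)} (hU : Clean U) (hV : Clean V) : Clean (U * V) := by
  intro x y hy hx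
  rw [Matrix.mul_apply]
  refine Finset.sum_eq_zero fun z _ => ?_
  by_cases hz : ∀ k, z (Sum.inr k) = false
  · rw [hU x z hz hx, zero_mul]
  · rw [hV z y hy hz, mul_zero]

theorem Clean.star_compress_mul {U : Op (ι ⊕ α)} (hU : Clean U) (h : star U * U = 1) :
    star (compress U) * compress U = 1 := by
  ext x y
  have h1 := congrFun (congrFun h (Sum.elim x (zeroBits α))) (Sum.elim y (zeroBits α))
  rw [Matrix.mul_apply, sum_bits_sum, Finset.sum_eq_zero (s := Finset.univ.filter _), add_zero]
    at h1
  · rw [Matrix.mul_apply]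
    refine h1.trans ?_
    simp only [Matrix.one_apply, sum_elim_inj, and_true]
  · intro z hz
    rw [hU z _ (fun k => rfl) (by simpa using hz), mul_zero]

theorem Clean.compress_mem_unitary {U : Op (ι ⊕ α)} (hU : Clean U) (h : star U * U = 1) :
    compress U ∈ Matrix.unitaryGroup (Bits ι) ℂ :=
  Matrix.mem_unitaryGroup_iff'.2 (hU.star_compress_mul h)

/-- In finite dimension a unitary restricts to a unitary on an invariant subspace. A row with zero
ancillas thus has total weight 1 already inside the block, and its remaining entries vanish. This
allows clean circuits to be inverted. -/
theorem Clean.star {U : Op (ι ⊕ α)} (hU : Clean U) (h : star U * U = 1) :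
    Clean (star U) := by
  intro x y hy hx
  have h1 : compress U * Star.star (compress U) = 1 :=
    mul_eq_one_comm.1 (hU.star_compress_mul h)
  have h2 : U * Star.star U = 1 := mul_eq_one_comm.1 h
  have e1 := congrFun (congrFun h1 fun i => y (Sum.inl i)) fun i => y (Sum.inl i)
  have e2 := congrFun (congrFun h2 y) y
  rw [Matrix.mul_apply, Matrix.one_apply_eq] at e1 e2
  rw [sum_bits_sum] at e2
  have e3 : ∑ z : Bits ι, U y (Sum.elim z (zeroBits α)) *
      Star.star U (Sum.elim z (zeroBits α)) y = 1 := by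
    refine Eq.trans ?_ e1
    refine Finset.sum_congr rfl fun z _ => ?_
    conv_lhs => rw [eq_elim_zeroBits hy]
    rfl
  rw [e3, add_eq_left] at e2
  have e4 : ∀ z, U y z * Star.star U z y = ((‖U y z‖ ^ 2 : ℝ) : ℂ) := fun z => by
    rw [Matrix.star_apply, Complex.star_def, Complex.mul_conj, Complex.normSq_eq_norm_sq]
  simp only [e4] at e2
  rw [← Complex.ofReal_sum, Complex.ofReal_eq_zero, Finset.sum_eq_zero_iff_of_nonneg
    fun _ _ => by positivity] at e2
  have e5 := e2 x (by simpa using hx)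
  rw [sq_eq_zero_iff, norm_eq_zero] at e5
  rw [Matrix.star_apply, e5, star_zero]

theorem clean_of_actsOn {C : Circuit (ι ⊕ α)} (h : ActsOn C (Set.range Sum.inl)) :
    Clean (circuitOp C) := by
  intro x y hy hx
  push Not at hx
  obtain ⟨k, hk⟩ := hx
  exact h.apply_eq_zero (w := Sum.inr k) (by simp) (by rw [hy k]; exact hk)

theorem clean_of_ket {U : Op (ι ⊕ α)} (h : ∀ y, (∀ k, y (Sum.inr k) = false) →
    ∃ y', U *ᵥ ket y = ket y' ∧ ∀ k, y' (Sum.inr k) = false) : Clean U := by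
  intro x y hy hx
  obtain ⟨y', h1, h2⟩ := h y hy
  rw [mulVec_ket] at h1
  rw [show U x y = (fun x => U x y) x from rfl, h1, ket_apply, if_neg]
  rintro rfl
  exact hx h2

theorem Clean.append {C D : Circuit (ι ⊕ α)} (hC : Clean (circuitOp C))
    (hD : Clean (circuitOp D)) : Clean (circuitOp (C ++ D)) := by
  rw [circuitOp_append]; exact hD.mul hC

theorem Clean.inv {C : Circuit (ι ⊕ α)} (hC : Clean (circuitOp C)) :
    Clean (circuitOp (circuitInv C)) := by
  rw [circuitOp_inv]; exact hC.star (star_circuitOp_mul C)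

theorem Clean.implements {C : Circuit (ι ⊕ α)} (hC : Clean (circuitOp C)) :
    Implements C (compress (circuitOp C)) := by
  intro ψ
  ext x
  rw [Matrix.mulVec, dotProduct, sum_bits_sum,
    Finset.sum_eq_zero (s := Finset.univ.filter _), add_zero]
  · have h1 : ∀ z : Bits ι, withZeros (α := α) ψ (Sum.elim z (zeroBits α)) = ψ z := fun z => by
      simp [withZeros, zeroBits]
    simp only [h1]
    by_cases hx : ∀ k, x (Sum.inr k) = false
    · rw [withZeros, if_pos hx]
      conv_lhs => rw [eq_elim_zeroBits hx]
      rfl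
    · rw [withZeros, if_neg hx]
      exact Finset.sum_eq_zero fun z _ => by rw [hC x _ (fun k => rfl) hx, zero_mul]
  · intro z hz
    rw [withZeros, if_neg (by simpa using hz), mul_zero]

theorem compress_mulVec_ket (U : Op (ι ⊕ α)) (x y : Bits ι) :
    (compress U *ᵥ ket y) x = (U *ᵥ ket (Sum.elim y (zeroBits α))) (Sum.elim x (zeroBits α)) := by
  rw [mulVec_ket, mulVec_ket]; rfl

end Clean

/-! ### Flagged states and fan-out -/

section Fanout

variable {ι : Type} [Fintype ι] [DecidableEq ι]

theorem Flagged.circuit {F : Set ι} {ψ : State ι} (h : Flagged F ψ) {C : Circuit ι} {S : Set ι}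
    (hC : ActsOn C S) (hF : ∀ w ∈ F, w ∉ S) : Flagged F (circuitOp C *ᵥ ψ) := by
  intro x hx
  refine Finset.sum_eq_zero fun y _ => ?_
  change circuitOp C x y * ψ y = 0
  by_cases hy : ∀ w ∈ F, y w = false
  · rw [h y hy, mul_zero]
  · push Not at hy
    obtain ⟨w, hw, hyw⟩ := hy
    rw [hC.apply_eq_zero (hF w hw) (by rw [hx w hw]; exact fun e => hyw e.symm), zero_mul]

theorem exists_fanout (c : ι) (ts : List ι) (hts : (c :: ts).Nodup) :
    ∃ C : Circuit ι, ActsOn C {w | w ∈ c :: ts} ∧ Costs C 0 ts.length ∧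
      ∀ y, circuitOp C *ᵥ ket y = ket fun i => if i ∈ ts then xor (y i) (y c) else y i := by
  induction ts with
  | nil => exact ⟨[], actsOn_nil _, costs_nil, fun y => by simp [circuitOp]⟩
  | cons t ts ih =>
    obtain ⟨hc, ht⟩ := List.nodup_cons.1 hts
    have hct : c ≠ t := fun h => hc (h ▸ List.mem_cons_self)
    have hcts : c ∉ ts := fun h => hc (List.mem_cons_of_mem _ h)
    have htts := (List.nodup_cons.1 ht).1
    obtain ⟨C, h1, h2, h3⟩ := ih (List.nodup_cons.2 ⟨hcts, (List.nodup_cons.1 ht).2⟩)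
    refine ⟨Gate.cnot c t hct :: C, ?_, ?_, fun y => ?_⟩
    · exact (actsOn_cnot hct (by simp) (by simp)).append (h1.mono fun w hw => by
        rcases List.mem_cons.1 hw with rfl | hw
        · simp
        · exact List.mem_cons_of_mem _ (List.mem_cons_of_mem _ hw))
    · exact ((costs_cnot c t hct).append h2).mono le_rfl (by simp [add_comm])
    · rw [circuitOp, ← Matrix.mulVec_mulVec, cnot_op_mulVec_ket, h3]
      congr 1
      ext i
      rw [Function.update_of_ne hct]
      by_cases hit : i = t
      · subst hit; simp [htts]
      · simp [hit]

end Fanout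

/-! ### Index arithmetic on the registers -/

section Registers

/-- The `2 n + 3` qubits and `2 n - 1` ancillas. -/
abbrev AllWires (n : ℕ) : Type := Wires n ⊕ Fin (2 * n - 1)

abbrev rowWire {n : ℕ} (t : Fin n) : AllWires n := Sum.inl (Sum.inr (Sum.inl t))

abbrev colWire {n : ℕ} (t : Fin n) : AllWires n := Sum.inl (Sum.inr (Sum.inr t))

abbrev flagWire (n : ℕ) (f : Fin 3) : AllWires n := Sum.inl (Sum.inl f)

/-- `|0⟩³|i⟩ⁿ|c⟩ⁿ` with ancillas in `|0…0⟩`. -/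
def allBits (n i c : ℕ) : Bits (AllWires n) := Sum.elim (flagBits n i c) (zeroBits _)

theorem eq_allBits {n i c : ℕ} {y : Bits (AllWires n)} (hf : ∀ f, y (flagWire n f) = false)
    (hr : ∀ t, y (rowWire t) = bits n i t) (hc : ∀ t, y (colWire t) = bits n c t)
    (ha : ∀ k, y (Sum.inr k) = false) : y = allBits n i c := by
  ext ((f | t | t) | k)
  · exact hf f
  · exact hr t
  · exact hc t
  · exact ha k

theorem allBits_inj {n : ℕ} {i c i' c' : Fin (2 ^ n)} :
    allBits n i c = allBits n i' c' ↔ i = i' ∧ c = c' := by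
  rw [allBits, allBits, sum_elim_inj, flagBits_inj, and_iff_left rfl]

theorem bits_numOn {ι : Type} (y : Bits ι) {n : ℕ} (w : Fin n → ι) (t : Fin n) :
    bits n (numOn y (List.ofFn w)) t = y (w t) := by
  rw [bits, testBit_numOn _ _ _ (by simp)]
  simp

theorem numOn_eq_of_bits {ι : Type} (y : Bits ι) {n : ℕ} (w : Fin n → ι) (i : Fin (2 ^ n))
    (h : ∀ t, y (w t) = bits n i t) : numOn y (List.ofFn w) = i := by
  have hlt := numOn_lt y (List.ofFn w)
  rw [List.length_ofFn] at hlt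
  have : (⟨numOn y (List.ofFn w), hlt⟩ : Fin (2 ^ n)) = i :=
    bits_injective n (funext fun t => (bits_numOn y w t).trans (h t))
  exact congrArg Fin.val this

theorem nodup_interleave {ι : Type} {n : ℕ} {x y z : Fin n → ι} {c : ι}
    (hx : Function.Injective x) (hy : Function.Injective y) (hz : Function.Injective z)
    (hxy : ∀ s t, x s ≠ y t) (hxz : ∀ s t, x s ≠ z t) (hyz : ∀ s t, y s ≠ z t)
    (hcx : ∀ t, c ≠ x t) (hcy : ∀ t, c ≠ y t) (hcz : ∀ t, c ≠ z t) :
    (c :: (List.ofFn fun t => (x t, y t, z t)).flatMap fun p => [p.1, p.2.1, p.2.2]).Nodup := by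
  rw [List.nodup_cons, List.nodup_flatMap]
  refine ⟨?_, ?_, ?_⟩
  · simp only [List.mem_flatMap, List.mem_ofFn', not_exists, not_and]
    rintro _ ⟨t, rfl⟩
    simp [hcx, hcy, hcz]
  · intro p hp
    obtain ⟨t, rfl⟩ := (List.mem_ofFn' _ _).1 hp
    simp [hxy, hxz, hyz]
  · rw [List.pairwise_ofFn]
    intro s t hst
    have h := hst.ne
    simp [Function.onFun, hx.ne h.symm, hy.ne h.symm, hz.ne h.symm,
      hxy, hxz, hyz, fun s t => (hxy s t).symm, fun s t => (hxz s t).symm,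
      fun s t => (hyz s t).symm]

variable {n : ℕ}

/-- The wires other than the flags `0` and `1`. -/
def unflagged (n : ℕ) : Set (AllWires n) := {w | w ≠ flagWire n 0 ∧ w ≠ flagWire n 1}

/-- The carries occupy `n` of the $2n-1$ ancillas, and flag 2 serves as carry-in, zero on the
strings of interest. Cleanness holds for either value of flag 2, since the adder restores its carry
qubits whatever the carry-in. -/
theorem exists_register_adder (hn : 1 ≤ n) (x y : Fin n → AllWires n)
    (hx : Function.Injective x) (hy : Function.Injective y) (hxy : ∀ s t, x s ≠ y t)
    (hxr : ∀ t, ∃ r, x t = Sum.inl (Sum.inr r)) (hyr : ∀ t, ∃ r, y t = Sum.inl (Sum.inr r)) :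
    ∃ C : Circuit (AllWires n), Clean (circuitOp C) ∧ ActsOn C (unflagged n) ∧
      Costs C (36 * n) (66 * n) ∧
      ∀ b, (∀ k, b (Sum.inr k) = false) → b (flagWire n 2) = false →
        ∃ b', circuitOp C *ᵥ ket b = ket b' ∧ (∀ w, w ∉ List.ofFn y → b' w = b w) ∧
          numOn b' (List.ofFn y) = (numOn b (List.ofFn x) + numOn b (List.ofFn y)) % 2 ^ n := by
  set z : Fin n → AllWires n := fun t => Sum.inr ⟨t, by omega⟩ with hz
  have hzi : Function.Injective z := fun s t h => by
    simp only [hz, Sum.inr.injEq, Fin.mk.injEq] at h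
    exact Fin.ext h
  have hxz : ∀ s t, x s ≠ z t := fun s t h => by
    obtain ⟨r, hr⟩ := hxr s
    rw [hr] at h; simp [hz] at h
  have hyz : ∀ s t, y s ≠ z t := fun s t h => by
    obtain ⟨r, hr⟩ := hyr s
    rw [hr] at h; simp [hz] at h
  have hcx : ∀ t f, flagWire n f ≠ x t := fun t f h => by
    obtain ⟨r, hr⟩ := hxr t
    rw [hr] at h; simp at h
  have hcy : ∀ t f, flagWire n f ≠ y t := fun t f h => by
    obtain ⟨r, hr⟩ := hyr t
    rw [hr] at h; simp at h
  have hcz : ∀ t f, flagWire n f ≠ z t := fun t f h => by simp [hz] at h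
  obtain ⟨C, h1, h2, h3⟩ := exists_adder (List.ofFn fun t => (x t, y t, z t)) (flagWire n 2)
    (nodup_interleave hx hy hzi hxy hxz hyz (hcx · 2) (hcy · 2) (hcz · 2))
  have e1 : (List.ofFn fun t => (x t, y t, z t)).map (fun p => p.1) = List.ofFn x := by
    rw [List.map_ofFn]; rfl
  have e2 : (List.ofFn fun t => (x t, y t, z t)).map (fun p => p.2.1) = List.ofFn y := by
    rw [List.map_ofFn]; rfl
  rw [e1, e2, List.length_ofFn] at h3
  rw [List.length_ofFn] at h2
  have h4 : ∀ b : Bits (AllWires n), (∀ k, b (Sum.inr k) = false) →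
      ∀ p ∈ List.ofFn fun t => (x t, y t, z t), b p.2.2 = false := fun b hb p hp => by
    obtain ⟨t, rfl⟩ := (List.mem_ofFn' _ _).1 hp
    exact hb _
  refine ⟨C, clean_of_ket fun b hb => ?_, h1.mono ?_, h2, fun b hb hb2 => ?_⟩
  · obtain ⟨b', h5, h6, _⟩ := h3 b (h4 b hb)
    refine ⟨b', h5, fun k => (h6 _ ?_).trans (hb k)⟩
    rw [List.mem_ofFn']
    rintro ⟨t, ht⟩
    obtain ⟨r, hr⟩ := hyr t
    rw [hr] at ht; simp at ht
  · intro w hw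
    have : ∀ f, f ≠ 2 → w ≠ flagWire n f := by
      rintro f hf rfl
      simp only [Set.mem_ofPred_eq, List.mem_cons, List.mem_flatMap, List.mem_ofFn',
        Set.mem_range] at hw
      rcases hw with hw | ⟨_, ⟨t, rfl⟩, hw⟩
      · exact hf (by simpa using hw)
      · simp [hcx, hcy, hcz] at hw
    exact ⟨this 0 (by decide), this 1 (by decide)⟩
  · obtain ⟨b', h5, h6, h7⟩ := h3 b (h4 b hb)
    refine ⟨b', h5, h6, ?_⟩
    rw [h7, hb2]; rfl

theorem exists_add_row (hn : 1 ≤ n) : ∃ C : Circuit (AllWires n), Clean (circuitOp C) ∧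
    ActsOn C (unflagged n) ∧ Costs C (36 * n) (66 * n) ∧
    ∀ i c : Fin (2 ^ n), circuitOp C *ᵥ ket (allBits n i c) =
      ket (allBits n (i + c : Fin (2 ^ n)) c) := by
  obtain ⟨C, h1, h2, h3, h4⟩ := exists_register_adder hn (fun t : Fin n => colWire t)
    (fun t : Fin n => rowWire t) (fun s t h => by simpa using h) (fun s t h => by simpa using h)
    (fun s t h => by simp at h) (fun t => ⟨_, rfl⟩) (fun t => ⟨_, rfl⟩)
  refine ⟨C, h1, h2, h3, fun i c => ?_⟩
  obtain ⟨b', h5, h6, h7⟩ := h4 (allBits n i c) (fun _ => rfl) rfl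
  rw [h5]
  congr 1
  refine eq_allBits (fun f => h6 _ (by simp [List.mem_ofFn'])) (fun t => ?_)
    (fun t => h6 _ (by simp [List.mem_ofFn'])) (fun k => h6 _ (by simp [List.mem_ofFn']))
  rw [← bits_numOn b' (fun t : Fin n => rowWire t), h7,
    numOn_eq_of_bits _ (fun t : Fin n => rowWire t) i fun _ => rfl,
    numOn_eq_of_bits _ (fun t : Fin n => colWire t) c fun _ => rfl, Fin.val_add, add_comm]

theorem exists_add_col (hn : 1 ≤ n) : ∃ C : Circuit (AllWires n), Clean (circuitOp C) ∧
    ActsOn C (unflagged n) ∧ Costs C (36 * n) (66 * n) ∧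
    ∀ i c : Fin (2 ^ n), circuitOp C *ᵥ ket (allBits n i c) =
      ket (allBits n i (i + c : Fin (2 ^ n))) := by
  obtain ⟨C, h1, h2, h3, h4⟩ := exists_register_adder hn (fun t : Fin n => rowWire t)
    (fun t : Fin n => colWire t) (fun s t h => by simpa using h) (fun s t h => by simpa using h)
    (fun s t h => by simp at h) (fun t => ⟨_, rfl⟩) (fun t => ⟨_, rfl⟩)
  refine ⟨C, h1, h2, h3, fun i c => ?_⟩
  obtain ⟨b', h5, h6, h7⟩ := h4 (allBits n i c) (fun _ => rfl) rfl
  rw [h5]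
  congr 1
  refine eq_allBits (fun f => h6 _ (by simp [List.mem_ofFn']))
    (fun t => h6 _ (by simp [List.mem_ofFn'])) (fun t => ?_)
    (fun k => h6 _ (by simp [List.mem_ofFn']))
  rw [← bits_numOn b' (fun t : Fin n => colWire t), h7,
    numOn_eq_of_bits _ (fun t : Fin n => rowWire t) i fun _ => rfl,
    numOn_eq_of_bits _ (fun t : Fin n => colWire t) c fun _ => rfl, Fin.val_add]

theorem exists_sub_col (hn : 1 ≤ n) : ∃ C : Circuit (AllWires n), Clean (circuitOp C) ∧
    ActsOn C (unflagged n) ∧ Costs C (36 * n) (66 * n) ∧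
    ∀ i c : Fin (2 ^ n), circuitOp C *ᵥ ket (allBits n i (i + c : Fin (2 ^ n))) =
      ket (allBits n i c) := by
  obtain ⟨C, h1, h2, h3, h4⟩ := exists_add_col hn
  refine ⟨circuitInv C, h1.inv, h2.inv, h3.inv, fun i c => ?_⟩
  rw [← h4, Matrix.mulVec_mulVec, circuitOp_inv, star_circuitOp_mul, Matrix.one_mulVec]

/-! ### Sign folding -/

/-- Flips digit `0` if `l ≠ 0`, and the digits above `l` if digit `l` is set. -/
def foldMask (l t : ℕ) (y : ℕ → Bool) : Bool := xor (decide (t = 0 ∧ l ≠ 0)) (decide (l < t) && y l)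

/-- The involution on `n`-digit numbers which folds the integers `r ≡ m mod 2`, `|r| ≤ m = 2 ^ l - 1`
(modulo `2 ^ n`) onto the digits `1, …, l`. -/
def signFold (n l : ℕ) (i : Fin (2 ^ n)) : Fin (2 ^ n) :=
  (bitsEquiv n).symm fun t => xor (bits n i t) (foldMask l t (i : ℕ).testBit)

theorem bits_signFold (l : ℕ) (i : Fin (2 ^ n)) (t : Fin n) :
    bits n (signFold n l i) t = xor (bits n i t) (foldMask l t (i : ℕ).testBit) := by
  have := (bitsEquiv n).apply_symm_apply
    fun t => xor (bits n i t) (foldMask l t (i : ℕ).testBit)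
  exact congrFun this t

/-- The mask depends on digit `l` only, and never changes that digit. -/
theorem signFold_signFold (l : ℕ) (i : Fin (2 ^ n)) : signFold n l (signFold n l i) = i := by
  refine bits_injective n (funext fun t => ?_)
  simp only [bits_signFold]
  have h : foldMask l t (signFold n l i : ℕ).testBit = foldMask l t (i : ℕ).testBit := by
    unfold foldMask
    by_cases hl : l < t
    · have := bits_signFold l i ⟨l, hl.trans t.2⟩
      simp only [bits, foldMask, lt_irrefl, decide_false, Bool.false_and, Bool.xor_false] at this
      rw [this]
      have h0 : ¬ (l = 0 ∧ l ≠ 0) := fun h => h.2 h.1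
      simp [h0]
    · simp [hl]
  rw [h, Bool.xor_assoc, Bool.xor_self, Bool.xor_false]

/-- Only the digits `1, …, l` of `v` may be set. -/
def Folded (n l : ℕ) (v : Fin (2 ^ n)) : Prop :=
  ∀ t : Fin n, (t : ℕ) = 0 ∨ l < t → bits n v t = false

theorem eq_or_eq_add_of_modEq {Q r m k : ℕ} (h : r + m ≡ 2 * k [MOD Q]) (hr : r < Q) (hm : m < Q)
    (hk : k ≤ m) : r + m = 2 * k ∨ r + m = 2 * k + Q := by
  rw [Nat.ModEq] at h
  rcases lt_or_ge (2 * k) Q with h2 | h2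
  · rw [Nat.mod_eq_of_lt h2] at h
    rcases lt_or_ge (r + m) Q with h3 | h3
    · rw [Nat.mod_eq_of_lt h3] at h; exact Or.inl h
    · rw [Nat.mod_eq_sub_mod h3, Nat.mod_eq_of_lt (by omega)] at h; omega
  · rw [Nat.mod_eq_sub_mod h2, Nat.mod_eq_of_lt (by omega : 2 * k - Q < Q)] at h
    rcases lt_or_ge (r + m) Q with h3 | h3
    · rw [Nat.mod_eq_of_lt h3] at h; omega
    · rw [Nat.mod_eq_sub_mod h3, Nat.mod_eq_of_lt (by omega)] at h; omega

/-- The support consists of the residues $2k-m$ with $k\le m=2^l-1$. For $l>0$ they are odd, so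
flipping digit 0 clears it. The digits from `l` upwards are all 0 or all 1 according to the sign of
the representative, so the XOR with digit `l` clears those above it, and digit `l` itself retains
the sign. -/
theorem folded_signFold {l m : ℕ} (hml : m + 1 = 2 ^ l) (hln : l ≤ n) {a b : ℝ}
    {r : Fin (2 ^ n)} (h : (pHat n a b ^ m) 0 r ≠ 0) : Folded n l (signFold n l r) := by
  obtain ⟨k, hk, hr⟩ := pHat_pow_support h
  have hL := two_pow_le hln
  have hrlt := r.2
  have hz : ((0 : Fin (2 ^ n)) : ℕ) = 0 := by simp
  rw [hz, zero_add] at hr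
  have hr' : (r : ℕ) + m = 2 * k ∨ (r : ℕ) + m = 2 * k + 2 ^ n :=
    eq_or_eq_add_of_modEq hr hrlt (by omega) hk
  intro t ht
  rw [bits_signFold]
  have hn := t.2
  rcases ht with ht | ht
  · simp only [foldMask, ht, Nat.not_lt_zero, decide_false, Bool.false_and, Bool.xor_false, bits,
      Nat.testBit_zero, true_and]
    by_cases hl : l = 0
    · subst hl
      have : m = 0 := by simpa using hml
      have : (r : ℕ) = 0 := by omega
      simp [this]
    · obtain ⟨l, rfl⟩ := Nat.exists_eq_succ_of_ne_zero hl
      obtain ⟨n', rfl⟩ := Nat.exists_eq_succ_of_ne_zero (by omega : n ≠ 0)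
      rw [pow_succ] at hml
      have : (r : ℕ) % 2 = 1 := by
        have e := pow_succ 2 n'
        simp only [Nat.succ_eq_add_one] at hr'
        omega
      simp [this]
  · have h0 : (t : ℕ) ≠ 0 := by omega
    simp only [foldMask, h0, false_and, decide_false, Bool.false_xor, ht, decide_true,
      Bool.true_and, bits]
    have hcase : (∀ s, l ≤ s → s < n → (r : ℕ).testBit s = false) ∨
        (∀ s, l ≤ s → s < n → (r : ℕ).testBit s = true) := by
      rcases lt_or_ge (r : ℕ) (2 ^ l) with h1 | h1
      · left
        exact fun s hs _ => Nat.testBit_lt_two_pow (h1.trans_le (two_pow_le hs))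
      · right
        have h2 : (r : ℕ) / 2 ^ l = 2 ^ (n - l) - 1 := by
          have e : 2 ^ n = 2 ^ (n - l) * 2 ^ l := by rw [← pow_add]; congr 1; omega
          have h3 : (r : ℕ) ≥ 2 ^ n - 2 ^ l + 1 := by omega
          have h4 : 1 ≤ 2 ^ (n - l) := Nat.one_le_two_pow
          rw [Nat.div_eq_iff (by positivity), Nat.sub_mul, ← e]
          omega
        intro s hs hsn
        have h3 : (r : ℕ).testBit s = ((r : ℕ) / 2 ^ l).testBit (s - l) := by
          rw [Nat.testBit_div_two_pow]; congr 1; omega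
        rw [h3, h2, Nat.testBit_two_pow_sub_one]
        simp; omega
    rcases hcase with hc | hc <;> rw [hc t ht.le hn, hc l le_rfl (ht.trans hn)] <;> rfl

theorem exists_sign_fold (l : ℕ) : ∃ C : Circuit (AllWires n), ActsOn C (Set.range rowWire) ∧
    Costs C 4 (n + 4) ∧ ∀ i c : Fin (2 ^ n), circuitOp C *ᵥ ket (allBits n i c) =
      ket (allBits n (signFold n l i) c) := by
  obtain ⟨X, hX1, hX2, hX3⟩ : ∃ C : Circuit (AllWires n), ActsOn C (Set.range rowWire) ∧
      Costs C 4 4 ∧ ∀ y, circuitOp C *ᵥ ket y = ket fun w =>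
        xor (y w) (decide (∃ t : Fin n, w = rowWire t ∧ (t : ℕ) = 0 ∧ l ≠ 0)) := by
    by_cases h : 0 < n ∧ l ≠ 0
    · obtain ⟨C, h1, h2, h3⟩ := exists_xor (rowWire ⟨0, h.1⟩ : AllWires n) [] (by simp)
        (fun _ => true) (fun _ _ _ => rfl)
      refine ⟨C, h1.mono ?_, h2.mono (by simp) (by simp), fun y => ?_⟩
      · intro w hw
        simp only [List.mem_cons, List.not_mem_nil, or_false, Set.mem_ofPred_eq] at hw
        exact ⟨_, hw.symm⟩
      · rw [h3]
        congr 1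
        ext w
        by_cases hw : w = rowWire ⟨0, h.1⟩
        · subst hw
          have : ∃ t : Fin n, (rowWire ⟨0, h.1⟩ : AllWires n) = rowWire t ∧ (t : ℕ) = 0 ∧ l ≠ 0 :=
            ⟨_, rfl, rfl, h.2⟩
          rw [Function.update_self, decide_eq_true this]
        · rw [Function.update_of_ne hw, decide_eq_false, Bool.xor_false]
          rintro ⟨t, rfl, ht, _⟩
          exact hw (by congr; exact Fin.ext ht)
    · refine ⟨[], actsOn_nil _, costs_nil.mono (by simp) (by simp), fun y => ?_⟩
      rw [circuitOp, Matrix.one_mulVec]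
      congr 1
      ext w
      rw [decide_eq_false, Bool.xor_false]
      rintro ⟨t, rfl, ht, hl⟩
      exact h ⟨by omega, hl⟩
  obtain ⟨Y, hY1, hY2, hY3⟩ : ∃ C : Circuit (AllWires n), ActsOn C (Set.range rowWire) ∧
      Costs C 0 n ∧ ∀ y, circuitOp C *ᵥ ket y = ket fun w =>
        xor (y w) (decide (∃ t : Fin n, w = rowWire t ∧ l < t ∧
          ∃ s : Fin n, (s : ℕ) = l ∧ y (rowWire s) = true)) := by
    by_cases h : l < n
    · obtain ⟨C, h1, h2, h3⟩ := exists_fanout (rowWire ⟨l, h⟩ : AllWires n)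
        (((List.finRange n).filter fun t : Fin n => l < (t : ℕ)).map fun t => rowWire t) (by
          rw [List.nodup_cons]
          refine ⟨by simp, ((List.nodup_finRange n).filter _).map fun s t h => by simpa using h⟩)
      refine ⟨C, h1.mono ?_, h2.mono le_rfl ?_, fun y => ?_⟩
      · intro w hw
        rcases List.mem_cons.1 hw with rfl | hw
        · exact ⟨_, rfl⟩
        · obtain ⟨t, _, rfl⟩ := List.mem_map.1 hw
          exact ⟨_, rfl⟩
      · rw [List.length_map]
        exact (List.length_filter_le _ _).trans (by simp)
      · rw [h3]
        congr 1
        ext w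
        by_cases hw : ∃ t : Fin n, w = rowWire t ∧ l < t
        · obtain ⟨t, rfl, ht⟩ := hw
          rw [if_pos (List.mem_map.2 ⟨t, by simpa using ht, rfl⟩)]
          congr 1
          rcases hy : y (rowWire ⟨l, h⟩) with _ | _
          · refine (decide_eq_false ?_).symm
            rintro ⟨_, _, _, s, hs, hs'⟩
            rw [show s = ⟨l, h⟩ from Fin.ext hs, hy] at hs'
            exact absurd hs' (by simp)
          · exact (decide_eq_true ⟨t, rfl, ht, _, rfl, hy⟩).symm
        · rw [if_neg, decide_eq_false, Bool.xor_false]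
          · rintro ⟨t, rfl, ht, _⟩
            exact hw ⟨t, rfl, ht⟩
          · intro hm
            obtain ⟨t, ht, rfl⟩ := List.mem_map.1 hm
            exact hw ⟨t, rfl, by simpa using ht⟩
    · refine ⟨[], actsOn_nil _, costs_nil.mono (by simp) (by simp), fun y => ?_⟩
      rw [circuitOp, Matrix.one_mulVec]
      congr 1
      ext w
      rw [decide_eq_false, Bool.xor_false]
      rintro ⟨t, rfl, ht, _⟩
      omega
  refine ⟨Y ++ X, hY1.append hX1, (hY2.append hX2).mono (by simp) le_rfl, fun i c => ?_⟩
  rw [circuitOp_append_mulVec, hY3, hX3]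
  congr 1
  refine eq_allBits (fun f => ?_) (fun t => ?_) (fun t => ?_) (fun k => ?_)
  · simp [allBits, flagBits, zeroBits]
  · rw [bits_signFold, Bool.xor_assoc]
    congr 1
    rw [foldMask, Bool.xor_comm]
    congr 1
    · refine decide_eq_decide.2 ⟨?_, fun h => ⟨t, rfl, h⟩⟩
      rintro ⟨t', h, h'⟩
      simp only [Sum.inl.injEq, Sum.inr.injEq] at h
      rwa [h]
    · refine Bool.eq_iff_iff.2 ?_
      rw [Bool.and_eq_true, decide_eq_true_eq, decide_eq_true_eq]
      constructor
      · rintro ⟨t', h, h', s, hs, hs'⟩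
        simp only [Sum.inl.injEq, Sum.inr.injEq] at h
        subst h hs
        exact ⟨h', hs'⟩
      · rintro ⟨h1, h2⟩
        exact ⟨t, rfl, h1, ⟨l, h1.trans t.2⟩, rfl, h2⟩
  · simp [allBits, flagBits]
  · simp [allBits, zeroBits]

end Registers

/-! ### Preparation of a row of the momentum power -/

section Prepare

variable {n l m : ℕ} {a b N : ℝ}

/-- The number whose digits `1, …, l` are those of the row register, all others being `0`. -/
def foldedIndex (n l : ℕ) (y : Bits (AllWires n)) : Fin (2 ^ n) :=
  (bitsEquiv n).symm fun t => decide (1 ≤ (t : ℕ) ∧ (t : ℕ) ≤ l) && y (rowWire t)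

theorem bits_foldedIndex (y : Bits (AllWires n)) (t : Fin n) :
    bits n (foldedIndex n l y) t = (decide (1 ≤ (t : ℕ) ∧ (t : ℕ) ≤ l) && y (rowWire t)) :=
  congrFun ((bitsEquiv n).apply_symm_apply _) t

/-- The wires of the digits `1, …, l` of the row register. -/
def foldedWires (n l : ℕ) : List (AllWires n) :=
  List.ofFn fun t : Fin (min l (n - 1)) => rowWire ⟨t + 1, by omega⟩

theorem mem_foldedWires {w : AllWires n} :
    w ∈ foldedWires n l ↔ ∃ t : Fin n, w = rowWire t ∧ 1 ≤ (t : ℕ) ∧ (t : ℕ) ≤ l := by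
  rw [foldedWires, List.mem_ofFn']
  constructor
  · rintro ⟨t, rfl⟩
    exact ⟨_, rfl, by simp, by have := t.2; simp only; omega⟩
  · rintro ⟨t, rfl, h1, h2⟩
    have := t.2
    refine ⟨⟨(t : ℕ) - 1, by omega⟩, ?_⟩
    exact congrArg (fun t : Fin n => (rowWire t : AllWires n)) (Fin.ext (Nat.sub_add_cancel h1))

theorem nodup_foldedWires : (foldedWires n l).Nodup :=
  List.nodup_ofFn.2 fun s t h => by
    simp only [Sum.inl.injEq, Sum.inr.injEq, Fin.mk.injEq, add_left_inj] at h
    exact Fin.ext h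

theorem folded_foldedIndex (y : Bits (AllWires n)) : Folded n l (foldedIndex n l y) := by
  intro t ht
  rw [bits_foldedIndex, decide_eq_false (by omega), Bool.false_and]

theorem agree_foldedWires_iff (x : Bits (AllWires n)) (j : ℕ) :
    (∀ w, w ∉ foldedWires n l → x w = allBits n 0 j w) ↔ x = allBits n (foldedIndex n l x) j := by
  constructor
  · intro h
    refine eq_allBits (fun f => h _ ?_) (fun t => ?_) (fun t => h _ ?_) (fun k => h _ ?_)
    · simp [mem_foldedWires]
    · rw [bits_foldedIndex]
      by_cases ht : 1 ≤ (t : ℕ) ∧ (t : ℕ) ≤ l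
      · rw [decide_eq_true ht, Bool.true_and]
      · rw [decide_eq_false ht, Bool.false_and, h _ (by simpa [mem_foldedWires] using ht)]
        exact congrFun (bits_zero n) t
    · simp [mem_foldedWires]
    · simp [mem_foldedWires]
  · intro h w hw
    rw [h]
    rcases w with (f | t | t) | k
    · rfl
    · have ht : ¬ (1 ≤ (t : ℕ) ∧ (t : ℕ) ≤ l) := by simpa [mem_foldedWires] using hw
      refine (folded_foldedIndex x t (by omega)).trans ?_
      exact (congrFun (bits_zero n) t).symm
    · rfl
    · rfl

theorem foldedIndex_allBits {v : Fin (2 ^ n)} (hv : Folded n l v) (j : ℕ) :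
    foldedIndex n l (allBits n v j) = v := by
  refine bits_injective n (funext fun t => ?_)
  simp only [bits_foldedIndex]
  by_cases ht : 1 ≤ (t : ℕ) ∧ (t : ℕ) ≤ l
  · rw [decide_eq_true ht, Bool.true_and]; rfl
  · rw [decide_eq_false ht, Bool.false_and, hv t (by omega)]

/-- For $l=n$ the digits $1,\dots,l$ number only $n-1$, so one Hadamard is missing; the extra square
root restores the required normalisation. -/
theorem rescale_eq (l' l : ℕ) (N : ℝ) :
    (((Real.sqrt 2)⁻¹ : ℝ) : ℂ) ^ l' *
        ((Real.sqrt (2 ^ l' / 2 ^ l) / Real.sqrt N : ℝ) : ℂ) =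
      1 / (Real.sqrt (2 ^ l * N) : ℂ) := by
  have h2 : Real.sqrt 2 ^ l' = Real.sqrt (2 ^ l') := by
    symm
    rw [Real.sqrt_eq_iff_mul_self_eq (by positivity) (by positivity), ← mul_pow,
      Real.mul_self_sqrt (by norm_num)]
  have h3 : Real.sqrt (2 ^ l') ≠ 0 := by positivity
  rw [← Complex.ofReal_pow, ← Complex.ofReal_mul, ← Complex.ofReal_one, ← Complex.ofReal_div]
  congr 1
  rw [Real.sqrt_div (by positivity), Real.sqrt_mul (by positivity), inv_pow, h2, one_div, mul_inv]
  field_simp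

/-- Hadamards on the folded digits, then an amplitude gadget with flag 0; `hNmax` makes its factor a
contraction. The superposition omits row numbers that are not folded, but there the matrix entry
vanishes by `folded_signFold`. -/
theorem exists_row_prepare (hml : m + 1 = 2 ^ l) (hln : l ≤ n) (hN : 0 < N)
    (hNmax : ∀ i j, ‖(pHat n a b ^ m) i j‖ ^ 2 ≤ N) :
    ∃ C : Circuit (AllWires n), ActsOn C (Set.range Sum.inl) ∧
      Costs C (n + 2 * 2 ^ l + 2) (4 * 2 ^ l) ∧
      ∀ j : Fin (2 ^ n), ∃ bad, Flagged {flagWire n 0} bad ∧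
        circuitOp C *ᵥ ket (allBits n 0 j) =
          ∑ v : Fin (2 ^ n), (1 / (Real.sqrt (2 ^ l * N) : ℂ) *
            (pHat n a b ^ m) 0 (signFold n l v)) • ket (allBits n v j) + bad := by
  set l' := min l (n - 1) with hl'
  have hlen : (foldedWires n l).length = l' := List.length_ofFn
  have hpow : (2 : ℕ) ^ l' ≤ 2 ^ l := two_pow_le (min_le_left _ _)
  have hpowR : (2 : ℝ) ^ l' ≤ 2 ^ l := pow_le_pow_right₀ (by norm_num) (min_le_left _ _)
  set ρ : ℝ := Real.sqrt (2 ^ l' / 2 ^ l) / Real.sqrt N with hρ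
  set α : Bits (AllWires n) → ℂ := fun y =>
    (pHat n a b ^ m) 0 (signFold n l (foldedIndex n l y)) * (ρ : ℂ) with hα
  have hflag : flagWire n 0 ∉ foldedWires n l := by simp [mem_foldedWires]
  obtain ⟨D, β, hD, sD, kD⟩ := exists_amplitude (flagWire n 0) (foldedWires n l)
    (List.nodup_cons.2 ⟨hflag, nodup_foldedWires⟩) α (by
      intro x y hxy
      have : foldedIndex n l x = foldedIndex n l y := by
        refine bits_injective n (funext fun t => ?_)
        simp only [bits_foldedIndex]
        by_cases ht : 1 ≤ (t : ℕ) ∧ (t : ℕ) ≤ l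
        · rw [hxy _ (mem_foldedWires.2 ⟨t, rfl, ht⟩)]
        · rw [decide_eq_false ht, Bool.false_and, Bool.false_and]
      simp only [hα, this]) (by
      intro x
      have h1 : ‖(pHat n a b ^ m) 0 (signFold n l (foldedIndex n l x))‖ ≤ Real.sqrt N :=
        Real.le_sqrt_of_sq_le (hNmax _ _)
      have h2 : Real.sqrt (2 ^ l' / 2 ^ l) ≤ 1 :=
        Real.sqrt_le_one.2 (div_le_one_of_le₀ hpowR (by positivity))
      have h3 : 0 < Real.sqrt N := Real.sqrt_pos.2 hN
      have h4 : ρ ≤ 1 / Real.sqrt N := by rw [hρ]; gcongr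
      rw [hα, norm_mul, Complex.norm_real, Real.norm_of_nonneg (by positivity)]
      calc _ ≤ Real.sqrt N * (1 / Real.sqrt N) := by gcongr
        _ = 1 := by field_simp)
  rw [hlen] at sD
  refine ⟨(foldedWires n l).map hGate ++ D, ?_, ?_, fun j => ?_⟩
  · refine ((actsOn_hadamards _).mono ?_).append (hD.mono ?_)
    · intro w hw
      obtain ⟨t, rfl, _⟩ := mem_foldedWires.1 hw
      exact ⟨_, rfl⟩
    · intro w hw
      rcases List.mem_cons.1 hw with rfl | hw
      · exact ⟨_, rfl⟩
      · obtain ⟨t, rfl, _⟩ := mem_foldedWires.1 hw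
        exact ⟨_, rfl⟩
  · refine ((costs_hadamards _).append sD).mono ?_ ?_
    · rw [hlen, pow_succ]
      have : l' ≤ n := (min_le_left _ _).trans hln
      omega
    · rw [pow_add]; omega
  · set κ : ℂ := (((Real.sqrt 2)⁻¹ : ℝ) : ℂ) ^ l' with hκ
    set A : Bits (AllWires n) → Prop := fun x =>
      ∀ w, w ∉ foldedWires n l → x w = allBits n 0 j w with hA
    classical
    refine ⟨∑ x, (if A x then κ * β x else 0) • ket (Function.update x (flagWire n 0) true),
      Flagged.sum _ fun x _ => (flagged_ket (Set.mem_singleton _) (by simp)).smul _, ?_⟩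
    have h1 : circuitOp ((foldedWires n l).map hGate) *ᵥ ket (allBits n 0 j) =
        ∑ x, (if A x then κ else 0) • (ket x : State (AllWires n)) := by
      rw [hadamards_mulVec_ket _ nodup_foldedWires, hlen]
      · ext x
        rw [Finset.sum_apply, Finset.sum_eq_single x]
        · by_cases hx : A x
          · rw [if_pos hx, if_pos hx, Pi.smul_apply, ket_apply, if_pos rfl, smul_eq_mul, mul_one]
          · rw [if_neg hx, if_neg hx, zero_smul, Pi.zero_apply]
        · intro z _ hz
          simp [ket_apply, hz.symm]
        · simp
      · intro w hw
        obtain ⟨t, rfl, _⟩ := mem_foldedWires.1 hw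
        exact congrFun (bits_zero n) t
    rw [circuitOp_append_mulVec, h1, Matrix.mulVec_sum]
    have h2 : ∀ x, circuitOp D *ᵥ ((if A x then κ else 0) • ket x) =
        (if A x then κ * α x else 0) • ket x +
          (if A x then κ * β x else 0) • ket (Function.update x (flagWire n 0) true) := by
      intro x
      by_cases hx : A x
      · rw [if_pos hx, if_pos hx, if_pos hx, Matrix.mulVec_smul,
          (kD x).2 (hx _ hflag), smul_add, smul_smul, smul_smul]
      · simp [hx]
    simp only [h2, Finset.sum_add_distrib]
    congr 1
    ext x
    rw [Finset.sum_apply, Finset.sum_apply, Finset.sum_eq_single x]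
    · simp only [Pi.smul_apply, ket_apply, smul_eq_mul, if_true, mul_one]
      by_cases hx : A x
      · have hx' := (agree_foldedWires_iff x j).1 hx
        rw [if_pos hx, Finset.sum_eq_single (foldedIndex n l x), if_pos hx', mul_one,
          ← rescale_eq l' l N, hα]
        · ring
        · intro v _ hv
          rw [if_neg, mul_zero]
          intro h
          rw [hx', allBits_inj] at h
          exact hv h.1.symm
        · simp
      · rw [if_neg hx]
        refine (Finset.sum_eq_zero fun v _ => ?_).symm
        by_cases hv : (pHat n a b ^ m) 0 (signFold n l v) = 0
        · rw [hv]; simp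
        · rw [if_neg, mul_zero]
          rintro rfl
          have hf := folded_signFold hml hln hv
          rw [signFold_signFold] at hf
          exact hx ((agree_foldedWires_iff _ _).2 (by rw [foldedIndex_allBits hf]))
    · intro z _ hz
      simp [ket_apply, hz.symm]
    · simp

end Prepare

/-! ### Coordinate oracle on the column register -/

section Column

variable {n l q : ℕ} {a b : ℝ} {P : ℝ[X]}

theorem coordOn_col (i c : Fin (2 ^ n)) :
    coordOn n a b (fun t : Fin n => colWire t) (allBits n i c) = gridPoint n a b c := by
  rw [coordOn, numOn_eq_of_bits _ (fun t : Fin n => colWire t) c fun _ => rfl, gridPoint]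

/-- The wires of the digits `l + 1, …, l + s` of the row register. -/
def upperWires {n l s : ℕ} (h : l + s < n) : List (AllWires n) :=
  List.ofFn fun t : Fin s => rowWire ⟨l + 1 + t, by omega⟩

/-- The selection register consists of digit 0 and the digits $l+1,\dots,l+s$ of the row register,
all zero on folded numbers. The ancillas would not do, because a failing branch may leave the
selection register non-zero. -/
theorem exists_col_oracle_of_select (hP : IsCoordPoly P q) (hn : 1 ≤ n) (ha : -1 ≤ a)
    (hab : a < b) (hb : b ≤ 1) {s : ℕ} (h : l + s < n) (hs : n + 2 ≤ 2 ^ (s + 1)) :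
    ∃ C : Circuit (AllWires n), ActsOn C (Set.range Sum.inl ∩ {w | w ≠ flagWire n 0}) ∧
      Costs C (q * ((n + 7) * 2 ^ (s + 2) + 1) + 1) (q * ((n + 5) * 2 ^ (s + 3))) ∧
      ∀ i c : Fin (2 ^ n), Folded n l i → ∃ bad, Flagged {flagWire n 1} bad ∧
        circuitOp C *ᵥ ket (allBits n i c) =
          ((P.eval (gridPoint n a b c) : ℝ) : ℂ) • ket (allBits n i c) + bad := by
  have hlen : (upperWires h).length = s := List.length_ofFn
  have hmem : ∀ w, w ∈ upperWires h ↔ ∃ t : Fin s,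
      (rowWire ⟨l + 1 + t, by omega⟩ : AllWires n) = w := fun w => by
    rw [upperWires, List.mem_ofFn']; rfl
  have hrow : ∀ w ∈ (rowWire ⟨0, hn⟩ : AllWires n) :: upperWires h, ∃ t : Fin n,
      w = rowWire t ∧ ((t : ℕ) = 0 ∨ l < t) := by
    intro w hw
    rcases List.mem_cons.1 hw with rfl | hw
    · exact ⟨_, rfl, Or.inl rfl⟩
    · obtain ⟨t, rfl⟩ := (hmem w).1 hw
      exact ⟨_, rfl, Or.inr (by change l < l + 1 + (t : ℕ); omega)⟩
  obtain ⟨C, h1, h2, h3⟩ := exists_coord_oracle_of_select hP hn ha hab hb (flagWire n 1)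
    (rowWire ⟨0, hn⟩) (upperWires h) (by
      refine List.nodup_cons.2 ⟨fun hw => ?_, List.nodup_cons.2 ⟨fun hw => ?_,
        List.nodup_ofFn.2 fun t t' e => ?_⟩⟩
      · obtain ⟨t, ht, _⟩ := hrow _ hw
        simp at ht
      · obtain ⟨t, ht⟩ := (hmem _).1 hw
        simp only [Sum.inl.injEq, Sum.inr.injEq, Fin.mk.injEq] at ht
        omega
      · simp only [Sum.inl.injEq, Sum.inr.injEq, Fin.mk.injEq] at e
        exact Fin.ext (by omega))
    (fun t : Fin n => colWire t) (by
      intro t hw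
      rcases List.mem_cons.1 hw with hw | hw
      · simp at hw
      · obtain ⟨t', ht', _⟩ := hrow _ hw
        simp at ht') (by rwa [hlen])
  rw [hlen] at h2
  refine ⟨C, h1.mono ?_, h2, fun i c hi => ?_⟩
  · rintro w (hw | ⟨t, rfl⟩)
    · rcases List.mem_cons.1 hw with rfl | hw
      · exact ⟨⟨_, rfl⟩, by simp⟩
      · obtain ⟨t, rfl, _⟩ := hrow w hw
        exact ⟨⟨_, rfl⟩, by simp⟩
    · exact ⟨⟨_, rfl⟩, by simp⟩
  · obtain ⟨bad, h4, h5⟩ := h3 (allBits n i c) rfl (fun v hv => by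
      obtain ⟨t, rfl, ht⟩ := hrow v hv
      exact hi t ht)
    rw [coordOn_col] at h5
    exact ⟨bad, fun x hx => h4 x (hx _ rfl), h5⟩

theorem exists_col_oracle_direct (hP : IsCoordPoly P q) (hn : 1 ≤ n) (ha : -1 ≤ a)
    (hab : a < b) (hb : b ≤ 1) :
    ∃ C : Circuit (AllWires n), ActsOn C (Set.range Sum.inl ∩ {w | w ≠ flagWire n 0}) ∧
      Costs C (2 ^ (n + 1) + 2) (2 ^ (n + 2)) ∧
      ∀ i c : Fin (2 ^ n), ∃ bad, Flagged {flagWire n 1} bad ∧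
        circuitOp C *ᵥ ket (allBits n i c) =
          ((P.eval (gridPoint n a b c) : ℝ) : ℂ) • ket (allBits n i c) + bad := by
  obtain ⟨C, h1, h2, h3⟩ := exists_coord_oracle_direct hP hn ha hab hb (flagWire n 1)
    (fun t : Fin n => colWire t) (by
      refine List.nodup_cons.2 ⟨fun hw => ?_, List.nodup_ofFn.2 fun t t' e => by simpa using e⟩
      obtain ⟨t, ht⟩ := (List.mem_ofFn' _ _).1 hw
      simp at ht)
  refine ⟨C, h1.mono ?_, h2, fun i c => ?_⟩
  · rintro w (rfl | ⟨t, rfl⟩)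
    · exact ⟨⟨_, rfl⟩, by simp⟩
    · exact ⟨⟨_, rfl⟩, by simp⟩
  · obtain ⟨bad, h4, h5⟩ := h3 (allBits n i c) rfl
    rw [coordOn_col] at h5
    exact ⟨bad, fun x hx => h4 x (hx _ rfl), h5⟩

/-- A number of gates that fits, with the remaining parts of the circuits, into the budgets. -/
def FitsBudget (n q l x y : ℕ) : Prop :=
  ((x + 2 * 2 ^ l + 109 * n + 14 : ℕ) : ℤ) ≤ 2304 * q * n ^ 2 - 1064 * q * n + 32 * 2 ^ l * n
    + 32 * n - 108 * q - 48 * 2 ^ l + 2 ^ l - 48 ∧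
  ((y + 4 * 2 ^ l + 201 * n + 12 : ℕ) : ℤ) ≤ 1864 * q * n ^ 2 - 860 * q * n + 25 * 2 ^ l * n
    + 32 * n - 92 * q - 17 * 2 ^ l - 48

/-- With $2^s\le n+1$ both counts are `q` times a quadratic in `n`, with leading coefficients 4 and
8 against 2304 and 1864. -/
theorem fitsBudget_select (hn : 2 ≤ n) (hq : 1 ≤ q) {s : ℕ} (hs : 2 ^ s ≤ n + 1) :
    FitsBudget n q l (q * ((n + 7) * 2 ^ (s + 2) + 1) + 1) (q * ((n + 5) * 2 ^ (s + 3))) := by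
  have e1 : q * ((n + 7) * 2 ^ (s + 2) + 1) + 1 ≤ q * (4 * ((n + 7) * (n + 1)) + 1) + 1 := by
    rw [pow_add]; nlinarith [Nat.mul_le_mul_left (q * (n + 7)) hs]
  have e2 : q * ((n + 5) * 2 ^ (s + 3)) ≤ q * (8 * ((n + 5) * (n + 1))) := by
    rw [pow_add]; nlinarith [Nat.mul_le_mul_left (q * (n + 5)) hs]
  have hL : 1 ≤ 2 ^ l := Nat.one_le_two_pow
  generalize q * ((n + 7) * 2 ^ (s + 2) + 1) + 1 = x at *
  generalize q * ((n + 5) * 2 ^ (s + 3)) = y at *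
  unfold FitsBudget
  push_cast
  have hL' : (1 : ℤ) ≤ 2 ^ l := by exact_mod_cast hL
  generalize (2 : ℤ) ^ l = L at *
  zify at e1 e2 hn hq
  have h1 : L * 49 ≤ L * (32 * n - 15) := mul_le_mul_of_nonneg_left (by linarith) (by linarith)
  have h2 : (0 : ℤ) ≤ (n - 2) * (n - 2) := mul_self_nonneg _
  -- The coefficient of `q` in budget minus cost: $4(n+7)(n+1)+1$ subtracted from
  -- $2304n^2-1064n-108$. It is non-negative, so `q = 1` is the worst case; `h4` does the same for
  -- C-NOTs.
  have h3 : (0 : ℤ) ≤ (q - 1) * (2300 * n ^ 2 - 1096 * n - 137) :=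
    mul_nonneg (by linarith) (by nlinarith)
  have h4 : (0 : ℤ) ≤ (q - 1) * (1856 * n ^ 2 - 908 * n - 132) :=
    mul_nonneg (by linarith) (by nlinarith)
  have h5 : L * 21 ≤ L * (25 * n - 21) := mul_le_mul_of_nonneg_left (by linarith) (by linarith)
  constructor <;> nlinarith

/-- For $n\ge2$ the exponential cost is at most a small multiple of $2^l(n+1)$, which the budget
terms $32\cdot2^ln$ and $25\cdot2^ln$ absorb. -/
theorem fitsBudget_direct (hn : 1 ≤ n) (hq : 1 ≤ q) (hln : l ≤ n)
    (h : 2 ^ n ≤ 2 ^ l * (n + 1)) : FitsBudget n q l (2 ^ (n + 1) + 2) (2 ^ (n + 2)) := by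
  have hL : 1 ≤ 2 ^ l := Nat.one_le_two_pow
  have hLn := two_pow_le hln
  have hL' : (1 : ℤ) ≤ 2 ^ l := by exact_mod_cast hL
  have h' : (2 : ℤ) ^ n ≤ 2 ^ l * (n + 1) := by exact_mod_cast h
  have hLn' : (2 : ℤ) ^ l ≤ 2 ^ n := by exact_mod_cast hLn
  have hq' : (1 : ℤ) ≤ q := by exact_mod_cast hq
  unfold FitsBudget
  push_cast
  rw [pow_succ, pow_add]
  rcases hn.eq_or_lt with rfl | hn2
  · generalize (2 : ℤ) ^ l = L at *
    norm_num at hLn' h' ⊢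
    constructor <;> linarith
  · generalize (2 : ℤ) ^ l = L at *
    generalize (2 : ℤ) ^ n = Q at *
    have hn' : (2 : ℤ) ≤ n := by exact_mod_cast hn2
    have h1 : 0 ≤ L * (30 * n - 51) := mul_nonneg (by linarith) (by linarith)
    have h5 : 0 ≤ L * (21 * n - 25) := mul_nonneg (by linarith) (by linarith)
    have h3 : (0 : ℤ) ≤ (q - 1) * (2304 * n ^ 2 - 1064 * n - 108) :=
      mul_nonneg (by linarith) (by nlinarith)
    have h4 : (0 : ℤ) ≤ (q - 1) * (1864 * n ^ 2 - 860 * n - 92) :=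
      mul_nonneg (by linarith) (by nlinarith)
    constructor <;> nlinarith

/-- The $n+2$ signs need $s+1=\lceil\log_2(n+2)\rceil$ selection qubits, so $2^s\le n+1$. Signal
processing is used if the zero digits of a folded row provide them, that is if $l+s<n$. Otherwise
$2^n\le2^{l+s}\le2^l(n+1)$, and the direct rotation is cheap enough. -/
theorem exists_col_oracle (hP : IsCoordPoly P q) (hn : 1 ≤ n) (hq : 1 ≤ q) (hln : l ≤ n)
    (ha : -1 ≤ a) (hab : a < b) (hb : b ≤ 1) :
    ∃ (C : Circuit (AllWires n)) (x y : ℕ),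
      ActsOn C (Set.range Sum.inl ∩ {w | w ≠ flagWire n 0}) ∧ Costs C x y ∧
      FitsBudget n q l x y ∧
      ∀ i c : Fin (2 ^ n), Folded n l i → ∃ bad, Flagged {flagWire n 1} bad ∧
        circuitOp C *ᵥ ket (allBits n i c) =
          ((P.eval (gridPoint n a b c) : ℝ) : ℂ) • ket (allBits n i c) + bad := by
  obtain ⟨s, hs⟩ : ∃ s, Nat.clog 2 (n + 2) = s + 1 :=
    Nat.exists_eq_succ_of_ne_zero (Nat.clog_pos (by norm_num) (by omega)).ne'
  have h1 : n + 2 ≤ 2 ^ (s + 1) := hs ▸ Nat.le_pow_clog (by norm_num) _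
  have h2 : 2 ^ s ≤ n + 1 := by
    have := Nat.pow_pred_clog_lt_self (b := 2) (by norm_num) (x := n + 2) (by omega)
    rw [hs] at this
    simp only [Nat.pred_eq_sub_one, Nat.add_sub_cancel] at this
    omega
  rcases lt_or_ge (l + s) n with h | h
  · obtain ⟨C, hC, sC, kC⟩ := exists_col_oracle_of_select hP hn ha hab hb h h1
    have hn2 : 2 ≤ n := by
      by_contra hlt
      obtain rfl : n = 1 := by omega
      obtain rfl : s = 0 := by omega
      norm_num at h1
    exact ⟨C, _, _, hC, sC, fitsBudget_select hn2 hq h2, kC⟩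
  · obtain ⟨C, hC, sC, kC⟩ := exists_col_oracle_direct (n := n) hP hn ha hab hb
    refine ⟨C, _, _, hC, sC, fitsBudget_direct hn hq hln ?_, fun i c _ => kC i c⟩
    calc 2 ^ n ≤ 2 ^ (l + s) := two_pow_le h
      _ = 2 ^ l * 2 ^ s := pow_add _ _ _
      _ ≤ _ := Nat.mul_le_mul_left _ h2

end Column

/-! ### Implementation of the auxiliaries -/

section Implementation

variable {n l m q : ℕ} {a b N : ℝ} {P : ℝ[X]}

/-- `D` has to unfold the offset, shift it by the column and multiply by `p`, but only for offsets
in the support; the others arrive with coefficient 0. Failures of `C` carry flag 0, which `D`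
avoids, and those of `D` carry flag 1. -/
theorem exists_auxiliary_of_block {C D : Circuit (AllWires n)} {p : Fin (2 ^ n) → Fin (2 ^ n) → ℂ}
    (hC : ∀ j : Fin (2 ^ n), ∃ bad, Flagged {flagWire n 0} bad ∧
        circuitOp C *ᵥ ket (allBits n 0 j) =
          ∑ v : Fin (2 ^ n), (1 / (Real.sqrt (2 ^ l * N) : ℂ) *
            (pHat n a b ^ m) 0 (signFold n l v)) • ket (allBits n v j) + bad)
    (hDa : ActsOn D {w | w ≠ flagWire n 0})
    (hD : ∀ r j : Fin (2 ^ n), (pHat n a b ^ m) 0 r ≠ 0 → ∃ bad, Flagged {flagWire n 1} bad ∧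
        circuitOp D *ᵥ ket (allBits n (signFold n l r) j) =
          p (r + j) j • ket (allBits n (r + j : Fin (2 ^ n)) j) + bad)
    (hclean : Clean (circuitOp (C ++ D))) :
    IsAuxiliary n m l a b N (Matrix.of fun i j => p i j * (pHat n a b ^ m) i j)
      (compress (circuitOp (C ++ D))) := by
  refine isAuxiliary_of_entries (hclean.compress_mem_unitary (star_circuitOp_mul _)) ?_ ?_
  · intro i j hij
    rw [Matrix.of_apply, hij, mul_zero]
  · intro i c j
    set κ : ℂ := 1 / (Real.sqrt (2 ^ l * N) : ℂ) with hκ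
    obtain ⟨bad, hbad, hCj⟩ := hC j
    have hv : ∀ r : Fin (2 ^ n), ∃ bad, Flagged {flagWire n 1} bad ∧
        (κ * (pHat n a b ^ m) 0 r) • (circuitOp D *ᵥ ket (allBits n (signFold n l r) j)) =
          (κ * (pHat n a b ^ m) 0 r * p (r + j) j) • ket (allBits n (r + j : Fin (2 ^ n)) j) +
            bad := by
      intro r
      by_cases hr : (pHat n a b ^ m) 0 r = 0
      · exact ⟨0, fun _ _ => rfl, by simp [hr]⟩
      · obtain ⟨bad, h1, h2⟩ := hD r j hr
        exact ⟨_, h1.smul (κ * (pHat n a b ^ m) 0 r), by rw [h2, smul_add, smul_smul]⟩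
    choose bad' hbad' hv' using hv
    have hsum : circuitOp (C ++ D) *ᵥ ket (allBits n 0 j) =
        ∑ r : Fin (2 ^ n), ((κ * (pHat n a b ^ m) 0 r * p (r + j) j) •
          ket (allBits n (r + j : Fin (2 ^ n)) j) + bad' r) + circuitOp D *ᵥ bad := by
      rw [circuitOp_append_mulVec, hCj, Matrix.mulVec_add, Matrix.mulVec_sum]
      congr 1
      -- Reindexing by the involution replaces folded row numbers by the offsets $r=i-j$ themselves.
      rw [← Equiv.sum_comp (Function.Involutive.toPerm (signFold n l) (signFold_signFold l))]
      refine Finset.sum_congr rfl fun r _ => ?_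
      rw [← hv', Matrix.mulVec_smul]
      change (κ * (pHat n a b ^ m) 0 (signFold n l (signFold n l r))) •
        (circuitOp D *ᵥ ket (allBits n (signFold n l r) j)) = _
      rw [signFold_signFold]
    have hz : ∀ f, allBits n i c (flagWire n f) = false := fun _ => rfl
    rw [flagKet, compress_mulVec_ket]
    change (circuitOp (C ++ D) *ᵥ ket (allBits n 0 j)) (allBits n i c) = _
    rw [hsum, Pi.add_apply, hbad.circuit hDa (by rintro w rfl; simp) _ (by rintro w rfl; exact hz 0),
      add_zero, Finset.sum_apply]
    have hterm : ∀ r : Fin (2 ^ n), ((κ * (pHat n a b ^ m) 0 r * p (r + j) j) •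
        (ket (allBits n (r + j : Fin (2 ^ n)) j) : State (AllWires n)) + bad' r) (allBits n i c) =
        if r = i - j then (if c = j then κ * (pHat n a b ^ m) 0 r * p (r + j) j else 0) else 0 := by
      intro r
      rw [Pi.add_apply, hbad' r _ (by rintro w rfl; exact hz 1), add_zero, Pi.smul_apply, ket_apply]
      have hiff : (r = i - j) ↔ i = r + j := ⟨fun h => by rw [h, sub_add_cancel],
        fun h => by rw [h, add_sub_cancel_right]⟩
      simp only [allBits_inj, hiff]
      by_cases h1 : i = r + j <;> by_cases h2 : c = j <;> simp [h1, h2]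
    simp only [hterm, Finset.sum_ite_eq', Finset.mem_univ, if_true, sub_add_cancel]
    have h1 : ((-1 : ℂ) ^ m) * (-1) ^ m = 1 := by rw [← mul_pow]; simp
    rw [Matrix.of_apply, pHat_pow_apply n m a b i j]
    congr 1
    calc _ = ((-1 : ℂ) ^ m * (-1) ^ m) * (κ * (pHat n a b ^ m) 0 (i - j) * p i j) := by
          rw [h1, one_mul]
      _ = _ := by rw [hκ]; ring

/-- The constants are those of the longer circuit, the one in `exists_auxPp`. One-qubit gates: row
preparation $n+2\cdot2^l+2$, three foldings of 4, three additions of $36n$. C-NOTs: $4\cdot2^l$,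
$3(n+4)$ and $3\cdot66n$. -/
theorem hasResources_of_costs {C : Circuit (AllWires n)} (hC : Clean (circuitOp C)) {x y : ℕ}
    (h : FitsBudget n q l x y)
    (hs : Costs C (x + 2 * 2 ^ l + 109 * n + 14) (y + 4 * 2 ^ l + 201 * n + 12)) :
    HasResources n q l (compress (circuitOp C)) :=
  ⟨C, hC.implements, (Int.ofNat_le.2 hs.1).trans h.1, (Int.ofNat_le.2 hs.2).trans h.2⟩

/-- The polynomial depends on the column only, so the coordinate oracle runs while the row is still
folded; afterwards the row is unfolded and the column is added to it. -/
theorem exists_auxpP (hml : m + 1 = 2 ^ l) (hln : l ≤ n) (hn : 1 ≤ n) (hq : 1 ≤ q)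
    (ha : -1 ≤ a) (hab : a < b) (hb : b ≤ 1) (hP : IsCoordPoly P q) (hN : 0 < N)
    (hNmax : ∀ i j, ‖(pHat n a b ^ m) i j‖ ^ 2 ≤ N) :
    ∃ U, IsAuxpP n m l a b N P U ∧ HasResources n q l U := by
  obtain ⟨C, C1, C2, C3⟩ := exists_row_prepare hml hln hN hNmax
  obtain ⟨O, x, y, O1, O2, O3, O4⟩ := exists_col_oracle hP hn hq hln ha hab hb
  obtain ⟨E, E1, E2, E3⟩ := exists_sign_fold (n := n) l
  obtain ⟨A, A1, A2, A3, A4⟩ := exists_add_row hn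
  have hE : ActsOn E (unflagged n) := E1.mono (by rintro _ ⟨t, rfl⟩; simp [unflagged])
  have cE : Clean (circuitOp E) := clean_of_actsOn (E1.mono (by rintro _ ⟨t, rfl⟩; exact ⟨_, rfl⟩))
  have cO : Clean (circuitOp O) := clean_of_actsOn (O1.mono Set.inter_subset_left)
  have hclean : Clean (circuitOp (C ++ (O ++ (E ++ A)))) :=
    (clean_of_actsOn C1).append (cO.append (cE.append A1))
  have hD : ∀ r j : Fin (2 ^ n), (pHat n a b ^ m) 0 r ≠ 0 → ∃ bad, Flagged {flagWire n 1} bad ∧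
      circuitOp (O ++ (E ++ A)) *ᵥ ket (allBits n (signFold n l r) j) =
        ((P.eval (gridPoint n a b j) : ℝ) : ℂ) • ket (allBits n (r + j : Fin (2 ^ n)) j) + bad := by
    intro r j hr
    obtain ⟨bad, h1, h2⟩ := O4 (signFold n l r) j (folded_signFold hml hln hr)
    refine ⟨circuitOp (E ++ A) *ᵥ bad, h1.circuit (hE.append A2) (by rintro w rfl; simp [unflagged]),
      ?_⟩
    rw [circuitOp_append_mulVec, h2, Matrix.mulVec_add, Matrix.mulVec_smul,
      circuitOp_append_mulVec E A (ket _), E3, A4, signFold_signFold]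
  have hu : unflagged n ⊆ {w | w ≠ flagWire n 0} := fun w hw => hw.1
  have haux := exists_auxiliary_of_block (p := fun _ j => ((P.eval (gridPoint n a b j) : ℝ) : ℂ))
    C3 ((O1.mono Set.inter_subset_right).append ((hE.append A2).mono hu)) hD hclean
  refine ⟨_, ?_, hasResources_of_costs hclean O3
    ((C2.append (O2.append (E2.append A3))).mono (by omega) (by omega))⟩
  rw [IsAuxpP]
  convert haux using 1
  ext i j
  rw [aeval_xHat, Matrix.mul_diagonal, Matrix.of_apply, mul_comm]

/-- The coordinate oracle reads the column and needs a folded row, but the polynomial is wanted at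
$r+j$. So the offset is unfolded to be added into the column, folded again for the oracle, and
unfolded once more to restore the column and to form $r+j$ in the row. -/
theorem exists_auxPp (hml : m + 1 = 2 ^ l) (hln : l ≤ n) (hn : 1 ≤ n) (hq : 1 ≤ q)
    (ha : -1 ≤ a) (hab : a < b) (hb : b ≤ 1) (hP : IsCoordPoly P q) (hN : 0 < N)
    (hNmax : ∀ i j, ‖(pHat n a b ^ m) i j‖ ^ 2 ≤ N) :
    ∃ U, IsAuxPp n m l a b N P U ∧ HasResources n q l U := by
  obtain ⟨C, C1, C2, C3⟩ := exists_row_prepare hml hln hN hNmax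
  obtain ⟨O, x, y, O1, O2, O3, O4⟩ := exists_col_oracle hP hn hq hln ha hab hb
  obtain ⟨E, E1, E2, E3⟩ := exists_sign_fold (n := n) l
  obtain ⟨A, A1, A2, A3, A4⟩ := exists_add_row hn
  obtain ⟨B, B1, B2, B3, B4⟩ := exists_add_col hn
  obtain ⟨S, S1, S2, S3, S4⟩ := exists_sub_col hn
  have hE : ActsOn E (unflagged n) := E1.mono (by rintro _ ⟨t, rfl⟩; simp [unflagged])
  have cE : Clean (circuitOp E) := clean_of_actsOn (E1.mono (by rintro _ ⟨t, rfl⟩; exact ⟨_, rfl⟩))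
  have cO : Clean (circuitOp O) := clean_of_actsOn (O1.mono Set.inter_subset_left)
  have hclean : Clean (circuitOp (C ++ (E ++ (B ++ (E ++ (O ++ (E ++ (S ++ A)))))))) :=
    (clean_of_actsOn C1).append (cE.append (B1.append (cE.append (cO.append
      (cE.append (S1.append A1))))))
  have hD : ∀ r j : Fin (2 ^ n), (pHat n a b ^ m) 0 r ≠ 0 → ∃ bad, Flagged {flagWire n 1} bad ∧
      circuitOp (E ++ (B ++ (E ++ (O ++ (E ++ (S ++ A)))))) *ᵥ ket (allBits n (signFold n l r) j) =
        ((P.eval (gridPoint n a b (r + j)) : ℝ) : ℂ) • ket (allBits n (r + j : Fin (2 ^ n)) j) +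
          bad := by
    intro r j hr
    obtain ⟨bad, h1, h2⟩ := O4 (signFold n l r) (r + j) (folded_signFold hml hln hr)
    refine ⟨circuitOp (E ++ (S ++ A)) *ᵥ bad, h1.circuit (hE.append (S2.append A2))
      (by rintro w rfl; simp [unflagged]), ?_⟩
    rw [circuitOp_append_mulVec, E3, circuitOp_append_mulVec, B4, circuitOp_append_mulVec, E3,
      signFold_signFold, signFold_signFold, circuitOp_append_mulVec, h2, Matrix.mulVec_add, Matrix.mulVec_smul,
      circuitOp_append_mulVec E _ (ket _), E3, signFold_signFold,
      circuitOp_append_mulVec S _ (ket _), S4, A4]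
  have hu : unflagged n ⊆ {w | w ≠ flagWire n 0} := fun w hw => hw.1
  have haux := exists_auxiliary_of_block (p := fun i _ => ((P.eval (gridPoint n a b i) : ℝ) : ℂ))
    C3 ((hE.mono hu).append ((B2.mono hu).append ((hE.mono hu).append
      ((O1.mono Set.inter_subset_right).append ((hE.append (S2.append A2)).mono hu))))) hD hclean
  refine ⟨_, ?_, hasResources_of_costs hclean O3 ((C2.append (E2.append (B3.append (E2.append
    (O2.append (E2.append (S3.append A3))))))).mono (by omega) (by omega))⟩
  rw [IsAuxPp]
  convert haux using 1
  ext i j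
  rw [aeval_xHat, Matrix.diagonal_mul, Matrix.of_apply]

end Implementation

end BlockEnc

end

theorem mainTheorem7 (n m l q : ℕ) (hn : 1 ≤ n) (hq : 1 ≤ q) (hml : m + 1 = 2 ^ l) (hln : l ≤ n)
    (a b : ℝ) (ha : -1 ≤ a) (hab : a < b) (hb : b ≤ 1)
    (hnorm : ∑ i : Fin (2 ^ n), BlockEnc.gridPoint n a b i ^ 2 = 1)
    (P : Polynomial ℝ) (hP : BlockEnc.IsCoordPoly P q)
    (N : ℝ) (hN : 0 < N) (hNmax : ∀ i j, ‖(BlockEnc.pHat n a b ^ m) i j‖ ^ 2 ≤ N) :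
    (∀ (OP : BlockEnc.Op (Fin 2 ⊕ Fin n)) (OS : BlockEnc.Op (Fin 1 ⊕ Fin l))
        (OBS : BlockEnc.Op (Fin n ⊕ Fin n)),
        BlockEnc.IsCoordPolyOracle n a b P OP →
        BlockEnc.IsSparseAmplitudeOracle l (BlockEnc.pHat n a b ^ m) N OS →
        BlockEnc.IsBandedSparseAccess l (BlockEnc.pHat n a b ^ m) OBS →
          BlockEnc.IsAuxPp n m l a b N P (BlockEnc.composePp hln OP OS OBS) ∧
          BlockEnc.IsAuxpP n m l a b N P (BlockEnc.composepP hln OP OS OBS)) ∧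
    (∃ U, BlockEnc.IsAuxPp n m l a b N P U ∧ BlockEnc.HasResources n q l U) ∧
    (∃ U, BlockEnc.IsAuxpP n m l a b N P U ∧ BlockEnc.HasResources n q l U) := by
  exact ⟨fun _ _ _ hOP hOS hOBS => ⟨BlockEnc.isAuxPp_composePp hln hml hOP hOS hOBS,
      BlockEnc.isAuxpP_composepP hln hml hOP hOS hOBS⟩,
    BlockEnc.exists_auxPp hml hln hn hq ha hab hb hP hN hNmax,
    BlockEnc.exists_auxpP hml hln hn hq ha hab hb hP hN hNmax⟩
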